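/- **Conventions.** Let $C_k$ be the real Clifford algebra of $\mathbb R^k$ with $v^2=-|v|^2$, let $Spin(k)\subset C_k$ be the spin group, and let $Spin^c(k)=(Spin(k)\times U(1))/\{\pm(1,1)\}$ be its complex version, the group of all products $[A,z]=zA\in C_k\otimes\mathbb C$ with $A\in Spin(k)$, $z\in U(1)$. Let $\lambda^c\colon Spin^c(k)\to SO(k)$, $\lambda^c([A,z])v=AvA^{-1}$, and $\det\colon Spin^c(k)\to U(1)$, $\det[A,z]=z^2$. The Lie algebra is $\mathfrak{spin}^c(k)=\mathfrak{spin}(k)\oplus\mathfrak u(1)$, with $\mathfrak u(1)=i\mathbb R$. The group $U(1)\subset Spin^c(k)$ consists of the elements $[1,z]$. Let a Lie group $G$ act smoothly by orientation preserving isometries on an oriented Riemannian manifold $M$ of dimension $k$, and let $SOF(M)$ be its bundle of oriented orthonormal frames, regarded as orientation preserving isometries $\mathbb R^k\to T_xM$. A *$G$-equivariant spin$^c$ structure* on $M$ is a principal $Spin^c(k)$-bundle $\pi\colon P\to M$ with a smooth action of $G$ on $P$ that commutes with the action of $Spin^c(k)$, and a smooth $G$-equivariant map $\Lambda\colon P\to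 SOF(M)$ over $M$ with $\Lambda(pg)=\Lambda(p)\circ\lambda^c(g)$ for $g\in Spin^c(k)$. Let $\omega$ be a closed $G$-invariant two-form on $M$. A *$G$-equivariant spin$^c$ prequantization* of $(M,\omega)$ is such a $P$ together with a smooth one-form $\theta\in\Omega^1(P;\mathfrak u(1))$ that is $G$-invariant and $Spin^c(k)$-invariant, is a connection form on the principal $U(1)$-bundle $P\to SOF(M)$ (so $\theta(\xi_P)=\xi$ for all $\xi\in\mathfrak u(1)$), and satisfies $\theta(\zeta_P)=0$ for all $\zeta\in\mathfrak{spin}(k)$ and $d\theta=\pi^*(-i\,\omega)$. Here $\xi_P$ is the vector field on $P$ generated by $\xi$. **Claim.** Let a Lie group $G$ act by orientation preserving isometries on oriented Riemannian manifolds $M$ and $N$, of dimensions $m$ and $n$. Let $\omega_M$, $\omega_N$ be closed $G$-invariant two-forms on $M$, $N$, and let $(P_M,\theta_M)$, $(P_N,\theta_N)$ be $G$-equivariant spin$^c$ prequantizations of $(M,\omega_M)$, $(N,\omega_N)$, with structure maps $\Lambda_M$, $\Lambda_N$. Embed $Spin^c(m)$ and $Spin^c(n)$ in $Spin^c(m+n)$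 through $\mathbb R^m\oplus\mathbb R^n=\mathbb R^{m+n}$, and let $$P_{M\times N}=(P_M\times P_N)\times_{Spin^c(m)\times Spin^c(n)}Spin^c(m+n)$$ be the quotient of $P_M\times P_N\times Spin^c(m+n)$ by $(p,q,h)\sim(pa,qb,(ab)^{-1}h)$ for $a\in Spin^c(m)$, $b\in Spin^c(n)$, with quotient map $\mathsf q$ and $[p,q,h]=\mathsf q(p,q,h)$. Then: 1. $P_{M\times N}$ is a (Hausdorff, second countable) smooth manifold for which $\mathsf q$ is a smooth submersion, and the form $\theta_{M\times N}=\theta_M+\theta_N+\tfrac12\det_*\circ\,\theta^L$ is well defined on it; that is, there is a one-form $\theta_{M\times N}\in\Omega^1(P_{M\times N};\mathfrak u(1))$ with $$\theta_{M\times N}\big(\mathsf q_*(u,v,w)\big)=\theta_M(u)+\theta_N(v)+\tfrac12\det\nolimits_*\big(\theta^L(w)\big)$$ for all $u\in TP_M$, $v\in TP_N$, $w\in T\,Spin^c(m+n)$, where $\theta^L$ is the left invariant Maurer–Cartan form of $Spin^c(m+n)$. 2. Give $M\times N$ the product metric and the product orientation, and let $G$ act on $M\times N$ and on $P_{M\times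 N}$ either diagonally, by $g(x,y)=(gx,gy)$ and $g[p,q,h]=[gp,gq,h]$, or through the first factor only, by $g(x,y)=(gx,y)$ and $g[p,q,h]=[gp,q,h]$. In either case $P_{M\times N}$, with the right action $[p,q,h]\,x=[p,q,hx]$ of $Spin^c(m+n)$ and the map $[p,q,h]\mapsto(\Lambda_M(p)\oplus\Lambda_N(q))\circ\lambda^c(h)$ to $SOF(M\times N)$, is a $G$-equivariant spin$^c$ structure on $M\times N$, and $(P_{M\times N},\theta_{M\times N})$ is a $G$-equivariant spin$^c$ prequantization of $(M\times N,\omega_M\oplus\omega_N)$. -/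

import Mathlib

open scoped TensorProduct Manifold ContDiff Topology

namespace SpinC

noncomputable section

open NormedSpace (exp)

abbrev Vec (k : ℕ) : Type := EuclideanSpace ℝ (Fin k)

def cliffordForm (k : ℕ) : QuadraticForm ℝ (Vec k) :=
  -LinearMap.BilinMap.toQuadraticMap (innerₗ (Vec k))

abbrev Cliff (k : ℕ) : Type := CliffordAlgebra (cliffordForm k)

open CliffordAlgebra

theorem cliffordForm_apply {k : ℕ} (v : Vec k) : cliffordForm k v = -inner ℝ v v := rfl

theorem cliffordForm_polar {k : ℕ} (v w : Vec k) :
    QuadraticMap.polar (cliffordForm k) v w = -(2 * inner ℝ v w) := by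
  simp only [QuadraticMap.polar, cliffordForm_apply, inner_add_left, inner_add_right,
    real_inner_comm w v]
  ring

instance (k : ℕ) : Module.Finite ℝ (Cliff k) := by
  have : Module.Finite ℝ (ExteriorAlgebra ℝ (Vec k)) :=
    Module.Finite.of_basis (EuclideanSpace.basisFun (Fin k) ℝ).toBasis.ExteriorAlgebra
  exact Module.Finite.equiv (equivExterior (cliffordForm k)).symm

/-- The contraction that corresponds to the twisted commutator with a vector. -/
theorem twisted_commutator {k : ℕ} (v : Vec k) (x : Cliff k) :
    ι _ v * x - involute x * ι _ v =
      contractLeft (-(2 : ℝ) • innerₗ (Vec k) v) x := by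
  induction x using CliffordAlgebra.left_induction with
  | algebraMap r =>
    rw [involute.commutes, contractLeft_algebraMap, Algebra.commutes, sub_self]
  | add x y hx hy => rw [map_add, map_add, ← hx, ← hy]; noncomm_ring
  | ι_mul x a hx =>
    rw [map_mul, involute_ι, contractLeft_ι_mul, ← hx]
    have h : ι (cliffordForm k) v * ι _ a =
        algebraMap ℝ _ (-(2 * inner ℝ v a)) - ι _ a * ι _ v := by
      rw [← cliffordForm_polar, ← ι_mul_ι_add_swap, add_sub_cancel_right]
    have h2 : (-(2 : ℝ) • innerₗ (Vec k) v) a = -(2 * inner ℝ v a) := by simp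
    rw [← mul_assoc, h, h2, Algebra.smul_def]
    noncomm_ring

theorem exterior_scalar {k : ℕ} (x : CliffordAlgebra (0 : QuadraticForm ℝ (Vec k)))
    (h : ∀ d : Module.Dual ℝ (Vec k), contractLeft d x = 0) :
    ∃ r : ℝ, x = algebraMap ℝ _ r := by
  let b := (EuclideanSpace.basisFun (Fin k) ℝ).toBasis
  let N : CliffordAlgebra (0 : QuadraticForm ℝ (Vec k)) →ₗ[ℝ]
      CliffordAlgebra (0 : QuadraticForm ℝ (Vec k)) :=
    ∑ i, (LinearMap.mulLeft ℝ (ι _ (b i))) ∘ₗ (contractLeft (b.coord i))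
  have hN : ∀ y, N y = ∑ i, ι _ (b i) * contractLeft (b.coord i) y := by
    intro y; simp [N, LinearMap.sum_apply]
  have hNι : ∀ v y, N (ι _ v * y) = ι _ v * y + ι _ v * N y := by
    intro v y
    have h1 : ι (0 : QuadraticForm ℝ (Vec k)) v = ∑ i, b.coord i v • ι _ (b i) := by
      simp only [← map_smul, ← map_sum, Module.Basis.coord_apply, b.sum_repr]
    rw [hN, hN]
    have h2 : ∀ i, ι (0 : QuadraticForm ℝ (Vec k)) (b i) *
        contractLeft (b.coord i) (ι _ v * y) =
        (b.coord i v • ι _ (b i)) * y +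
          ι _ v * (ι _ (b i) * contractLeft (b.coord i) y) := by
      intro i
      have h3 : ι (0 : QuadraticForm ℝ (Vec k)) (b i) * ι _ v = - (ι _ v * ι _ (b i)) :=
        eq_neg_of_add_eq_zero_left (ExteriorAlgebra.ι_add_mul_swap _ _)
      rw [contractLeft_ι_mul, mul_sub, ← mul_assoc, h3, mul_smul_comm, smul_mul_assoc]
      noncomm_ring
    rw [Finset.sum_congr rfl fun i _ => h2 i, Finset.sum_add_distrib, ← Finset.sum_mul, ← h1,
      ← Finset.mul_sum]
  let A := fun n : ℕ => LinearMap.range (ExteriorAlgebra.ι ℝ (M := Vec k)) ^ n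
  have hNn : ∀ n : ℕ, ∀ y ∈ A n, N y = (n : ℝ) • y := by
    intro n
    induction n with
    | zero =>
      intro y hy
      obtain ⟨r, rfl⟩ := Submodule.mem_one.mp hy
      rw [hN]
      refine (Finset.sum_eq_zero fun i _ => ?_).trans (by simp)
      erw [contractLeft_algebraMap, mul_zero]
    | succ n ih =>
      intro y hy
      have hy' : y ∈ LinearMap.range (ExteriorAlgebra.ι ℝ (M := Vec k)) * A n := by
        rw [← pow_succ']; exact hy
      clear hy
      induction hy' using Submodule.mul_induction_on' with
      | mem_mul_mem v hv z hz =>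
        obtain ⟨v, rfl⟩ := hv
        erw [hNι, ih z hz, mul_smul_comm]
        push_cast
        rw [add_smul, one_smul, add_comm]
      | add u hu v hv h1 h2 =>
        rw [map_add, h1, h2, smul_add]
  have hx0 : N x = 0 := by rw [hN]; simp [h]
  let _ : GradedAlgebra A := ExteriorAlgebra.gradedAlgebra ℝ (Vec k)
  have hcomm : ∀ (j : ℕ) (y : ExteriorAlgebra ℝ (Vec k)),
      GradedRing.proj A j (N y) = (j : ℝ) • GradedRing.proj A j y := by
    intro j y
    induction y using DirectSum.Decomposition.inductionOn A with
    | zero => rw [map_zero, map_zero, smul_zero]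
    | @homogeneous i m =>
      rw [hNn i m m.2]
      simp only [GradedRing.proj_apply]
      by_cases hij : i = j
      · subst hij
        rw [DirectSum.decompose_of_mem_same A m.2,
          DirectSum.decompose_of_mem_same A (Submodule.smul_mem _ _ m.2)]
      · rw [DirectSum.decompose_of_mem_ne A m.2 hij,
          DirectSum.decompose_of_mem_ne A (Submodule.smul_mem _ _ m.2) hij, smul_zero]
    | add a b ha hb => rw [map_add, map_add, map_add, smul_add, ha, hb]
  have hz : ∀ j : ℕ, j ≠ 0 → GradedRing.proj A j x = 0 := by
    intro j hj
    have h1 := hcomm j x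
    rw [hx0, map_zero] at h1
    exact (smul_eq_zero.mp h1.symm).resolve_left (by exact_mod_cast hj)
  classical
  have hx : x = GradedRing.proj A 0 x := by
    conv_lhs => rw [← DirectSum.sum_support_decompose A x]
    refine Finset.sum_eq_single 0 (fun j _ hj => hz j hj) fun h0 => ?_
    simpa using h0
  have hmem : GradedRing.proj A 0 x ∈ A 0 := (DirectSum.decompose A x 0).2
  obtain ⟨r, hr⟩ := Submodule.mem_one.mp hmem
  exact ⟨r, by rw [hx, ← hr]⟩

theorem scalar_of_twisted {k : ℕ} (x : Cliff k) (h : ∀ v, ι _ v * x = involute x * ι _ v) :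
    ∃ r : ℝ, x = algebraMap ℝ _ r := by
  have h1 : ∀ d : Module.Dual ℝ (Vec k), contractLeft d x = 0 := by
    intro d
    obtain ⟨v, rfl⟩ := (InnerProductSpace.toDual ℝ (Vec k)).surjective d.toContinuousLinearMap |>.imp
      fun v hv => show d = (-(2:ℝ)) • innerₗ (Vec k) ((-(1/2:ℝ)) • v) by
        ext w
        have := congrArg (fun f : Vec k →L[ℝ] ℝ => f w) hv
        simp at this
        simp [← this]
    rw [← twisted_commutator, h, sub_self]
  obtain ⟨r, hr⟩ := exterior_scalar (equivExterior (cliffordForm k) x) (fun d => by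
    have := changeForm_contractLeft (h := changeForm.associated_neg_proof (Q := cliffordForm k)) d x
    rw [h1, map_zero] at this
    exact this.symm)
  refine ⟨r, (equivExterior (cliffordForm k)).injective ?_⟩
  rw [hr]
  exact (changeForm_algebraMap changeForm.associated_neg_proof r).symm

/-- `C_k ⊗ ℂ`. -/
def CCliff (k : ℕ) : Type := ℂ ⊗[ℝ] Cliff k

instance (k : ℕ) : Ring (CCliff k) := inferInstanceAs (Ring (ℂ ⊗[ℝ] Cliff k))
instance (k : ℕ) : Algebra ℂ (CCliff k) := inferInstanceAs (Algebra ℂ (ℂ ⊗[ℝ] Cliff k))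
instance (k : ℕ) : Algebra ℝ (CCliff k) := inferInstanceAs (Algebra ℝ (ℂ ⊗[ℝ] Cliff k))
instance (k : ℕ) : IsScalarTower ℝ ℂ (CCliff k) :=
  inferInstanceAs (IsScalarTower ℝ ℂ (ℂ ⊗[ℝ] Cliff k))
instance (k : ℕ) : Module.Finite ℝ (CCliff k) :=
  inferInstanceAs (Module.Finite ℝ (ℂ ⊗[ℝ] Cliff k))

/-- The inclusion `C_k → C_k ⊗ ℂ`. -/
def incl (k : ℕ) : Cliff k →ₐ[ℝ] CCliff k :=
  (Algebra.TensorProduct.includeRight : Cliff k →ₐ[ℝ] ℂ ⊗[ℝ] Cliff k)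

/-- The inclusion `ℝ^k → C_k ⊗ ℂ`. -/
def vec {k : ℕ} (v : Vec k) : CCliff k := incl k (ι _ v)

theorem incl_injective (k : ℕ) : Function.Injective (incl k) :=
  Algebra.TensorProduct.includeRight_injective (algebraMap ℝ ℂ).injective

instance (k : ℕ) : Nontrivial (CCliff k) := (incl_injective k).nontrivial

theorem smul_incl_induction {k : ℕ} {p : CCliff k → Prop} (x : CCliff k) (h0 : p 0)
    (h : ∀ (z : ℂ) (a : Cliff k), p (z • incl k a)) (hadd : ∀ x y, p x → p y → p (x + y)) : p x := by
  refine TensorProduct.induction_on x h0 (fun z a => ?_) hadd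
  have := h z a
  have h2 : z • incl k a = (z ⊗ₜ[ℝ] a : ℂ ⊗[ℝ] Cliff k) := by
    change z • ((1 : ℂ) ⊗ₜ[ℝ] a : ℂ ⊗[ℝ] Cliff k) = _
    rw [TensorProduct.smul_tmul', smul_eq_mul, mul_one]
  rwa [h2] at this

/-- The complex linear extension of a real linear map. -/
def clift {k l : ℕ} (f : Cliff k →ₗ[ℝ] Cliff l) : CCliff k →ₗ[ℂ] CCliff l :=
  (f.baseChange ℂ : ℂ ⊗[ℝ] Cliff k →ₗ[ℂ] ℂ ⊗[ℝ] Cliff l)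

theorem clift_incl {k l : ℕ} (f : Cliff k →ₗ[ℝ] Cliff l) (a : Cliff k) :
    clift f (incl k a) = incl l (f a) :=
  LinearMap.baseChange_tmul (f := f) 1 a

theorem clift_smul_incl {k l : ℕ} (f : Cliff k →ₗ[ℝ] Cliff l) (z : ℂ) (a : Cliff k) :
    clift f (z • incl k a) = z • incl l (f a) := by
  rw [map_smul, clift_incl]

/-- The complex linear extension of a homomorphism of algebras. -/
def cmap {k l : ℕ} (f : Cliff k →ₐ[ℝ] Cliff l) : CCliff k →ₐ[ℂ] CCliff l :=
  (Algebra.TensorProduct.map (AlgHom.id ℂ ℂ) f : ℂ ⊗[ℝ] Cliff k →ₐ[ℂ] ℂ ⊗[ℝ] Cliff l)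

theorem cmap_incl {k l : ℕ} (f : Cliff k →ₐ[ℝ] Cliff l) (a : Cliff k) :
    cmap f (incl k a) = incl l (f a) :=
  Algebra.TensorProduct.map_tmul (AlgHom.id ℂ ℂ) f 1 a

/-- The conjugate linear extension of the involution `star`, as a homomorphism to the opposite
algebra. -/
def cstar (k : ℕ) : CCliff k →ₐ[ℝ] (CCliff k)ᵐᵒᵖ :=
  ((Algebra.TensorProduct.opAlgEquiv ℝ ℝ ℂ (Cliff k)).toAlgHom.comp
    (Algebra.TensorProduct.map ((AlgEquiv.toOpposite ℝ ℂ).toAlgHom.comp Complex.conjAe.toAlgHom)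
      ((reverseOp (Q := cliffordForm k)).comp involute)) :
    ℂ ⊗[ℝ] Cliff k →ₐ[ℝ] (ℂ ⊗[ℝ] Cliff k)ᵐᵒᵖ)

theorem smul_incl {k : ℕ} (z : ℂ) (a : Cliff k) :
    z • incl k a = (z ⊗ₜ[ℝ] a : ℂ ⊗[ℝ] Cliff k) := by
  change z • ((1 : ℂ) ⊗ₜ[ℝ] a : ℂ ⊗[ℝ] Cliff k) = _
  rw [TensorProduct.smul_tmul', smul_eq_mul, mul_one]

theorem cstar_smul_incl {k : ℕ} (z : ℂ) (a : Cliff k) :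
    cstar k (z • incl k a) = MulOpposite.op (starRingEnd ℂ z • incl k (star a)) := by
  rw [smul_incl, smul_incl]; rfl

/-- `Spin(k)`. -/
abbrev Spin (k : ℕ) : Type := spinGroup (cliffordForm k)

/-- The homomorphism `U(1) × Spin(k) → C_k ⊗ ℂ`, `(z, A) ↦ z A`. -/
def spincHom (k : ℕ) : Circle × Spin k →* (CCliff k)ˣ where
  toFun p := Units.map (algebraMap ℂ (CCliff k)).toMonoidHom (Circle.toUnits p.1) *
    Units.map (incl k).toRingHom.toMonoidHom (spinGroup.toUnits p.2)
  map_one' := by simp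
  map_mul' p q := by
    ext
    simp only [Prod.fst_mul, Prod.snd_mul, map_mul, Units.val_mul, Units.coe_map]
    have := Algebra.commutes (R := ℂ) (q.1 : ℂ) (incl k (p.2 : Cliff k))
    simp only [mul_assoc]
    congr 1
    simp only [← mul_assoc]
    congr 1

def SpincGroup (k : ℕ) : Subgroup (CCliff k)ˣ := (spincHom k).range

theorem spincHom_val {k : ℕ} (z : Circle) (A : Spin k) :
    (spincHom k (z, A) : CCliff k) = (z : ℂ) • incl k (A : Cliff k) := by
  rw [Algebra.smul_def]; rfl

theorem reverse_mul_self {k : ℕ} (A : Spin k) : reverse (A : Cliff k) * A = 1 := by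
  have := spinGroup.star_mul_self_of_mem A.2
  rwa [star_def, spinGroup.involute_eq A.2] at this

theorem spincHom_sq {k : ℕ} {z w : Circle} {A B : Spin k}
    (h : spincHom k (z, A) = spincHom k (w, B)) : z ^ 2 = w ^ 2 := by
  have key : ∀ (z : Circle) (A : Spin k), clift reverse (spincHom k (z, A) : CCliff k) *
      (spincHom k (z, A) : CCliff k) = algebraMap ℂ _ ((z ^ 2 : Circle) : ℂ) := by
    intro z A
    rw [spincHom_val, clift_smul_incl, smul_mul_smul_comm, ← map_mul, reverse_mul_self, map_one,
      Algebra.algebraMap_eq_smul_one, Circle.coe_pow, sq]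
  have h1 := key z A
  rw [h, key w B] at h1
  exact (Circle.ext ((algebraMap ℂ (CCliff k)).injective h1)).symm

abbrev Spinc (k : ℕ) : Type := SpincGroup k

theorem vec_injective (k : ℕ) : Function.Injective (vec : Vec k → CCliff k) := by
  let _ : Invertible (2 : ℝ) := invertibleOfNonzero two_ne_zero
  intro v w h
  have h1 := congrArg (equivExterior (cliffordForm k)) (incl_injective k h)
  have h2 : ∀ u, equivExterior (cliffordForm k) (ι _ u) = ExteriorAlgebra.ι ℝ u :=
    fun u => changeForm_ι changeForm.associated_neg_proof u
  rw [h2, h2] at h1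
  exact ExteriorAlgebra.ι_leftInverse.injective h1

theorem vec_sq {k : ℕ} (v : Vec k) : vec v * vec v = algebraMap ℝ (CCliff k) (-inner ℝ v v) := by
  rw [vec, ← map_mul, ι_sq_scalar, AlgHom.commutes, cliffordForm_apply]

theorem vec_add {k : ℕ} (v w : Vec k) : vec (v + w) = vec v + vec w := by simp [vec]
theorem vec_smul {k : ℕ} (r : ℝ) (w : Vec k) : vec (r • w) = r • vec w := by simp [vec]

/-- A product of reflections is the twisted conjugation by an element of the pin group. -/
theorem exists_pin {k : ℕ} (l : List (Vec k)) :
    ∃ y ∈ pinGroup (cliffordForm k), (involute y = y ∨ involute y = -y) ∧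
      ∀ v, involute y * ι _ v =
        ι _ ((l.map fun a => Submodule.reflection (ℝ ∙ a)ᗮ).prod v) * y := by
  induction l with
  | nil => exact ⟨1, one_mem _, by simp, by simp⟩
  | cons a l ih =>
    obtain ⟨y, hy, hpar, h⟩ := ih
    by_cases ha : a = 0
    · refine ⟨y, hy, hpar, fun v => ?_⟩
      rw [h v]
      subst ha
      have : Submodule.reflection (ℝ ∙ (0 : Vec k))ᗮ = 1 := by
        ext1 w
        exact Submodule.reflection_mem_subspace_eq_self (by simp)
      rw [List.map_cons, List.prod_cons, this, one_mul]
    · obtain ⟨u, hu, hau⟩ : ∃ u : Vec k, ‖u‖ = 1 ∧ (ℝ ∙ a) = (ℝ ∙ u) := by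
        refine ⟨‖a‖⁻¹ • a, norm_smul_inv_norm ha, ?_⟩
        rw [Submodule.span_singleton_smul_eq]
        exact (inv_ne_zero (norm_ne_zero_iff.mpr ha)).isUnit
      have hQ : ι (cliffordForm k) u * ι _ u = -1 := by
        rw [ι_sq_scalar, cliffordForm_apply, real_inner_self_eq_norm_sq, hu]; simp
      let U : (Cliff k)ˣ := ⟨ι _ u, -ι _ u, by rw [mul_neg, hQ, neg_neg], by rw [neg_mul, hQ, neg_neg]⟩
      have hpin : ι _ u ∈ pinGroup (cliffordForm k) := by
        refine pinGroup.mem_iff.mpr ⟨⟨U, Subgroup.subset_closure ⟨u, rfl⟩, rfl⟩, ?_⟩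
        rw [Unitary.mem_iff, star_ι, neg_mul, mul_neg, hQ]; simp
      refine ⟨ι _ u * y, mul_mem hpin hy, ?_, fun v => ?_⟩
      · rw [map_mul, involute_ι]
        rcases hpar with hp | hp <;> rw [hp] <;> simp
      · rw [map_mul, involute_ι, mul_assoc, h v, List.map_cons, List.prod_cons,
          LinearIsometryEquiv.coe_mul, Function.comp_apply]
        set w := (l.map fun a => Submodule.reflection (ℝ ∙ a)ᗮ).prod v
        have hr : Submodule.reflection (ℝ ∙ a)ᗮ w = w - (2 * inner ℝ u w) • u := by
          have h0 : Submodule.reflection (ℝ ∙ a)ᗮ w = Submodule.reflection (ℝ ∙ u)ᗮ w := by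
            simp only [hau]
          rw [h0, Submodule.reflection_orthogonal_apply, Submodule.reflection_singleton_apply, hu]
          simp [mul_smul, two_smul]
        have hs : ι (cliffordForm k) u * ι _ w =
            algebraMap ℝ _ (-(2 * inner ℝ u w)) - ι _ w * ι _ u := by
          rw [← cliffordForm_polar, ← ι_mul_ι_add_swap, add_sub_cancel_right]
        rw [hr, map_sub, map_smul, ← mul_assoc, ← mul_assoc, sub_mul, smul_mul_assoc, hQ, neg_mul, hs,
          map_neg, Algebra.algebraMap_eq_smul_one]
        congr 1
        module

theorem twisted_scalar {k : ℕ} (x : CCliff k)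
    (h : ∀ v, vec v * x = cmap involute x * vec v) : ∃ c : ℂ, x = algebraMap ℂ _ c := by
  let P : (ℂ →ₗ[ℝ] ℝ) → CCliff k →ₗ[ℝ] Cliff k := fun f =>
    ((TensorProduct.lid ℝ (Cliff k)).toLinearMap ∘ₗ TensorProduct.map f LinearMap.id :
      ℂ ⊗[ℝ] Cliff k →ₗ[ℝ] Cliff k)
  have hP : ∀ f z a, P f (z • incl k a) = f z • a := by
    intro f z a
    rw [smul_incl]
    exact TensorProduct.lid_tmul (R := ℝ) a (f z)
  have hsc : ∀ f, ∃ r : ℝ, P f x = algebraMap ℝ _ r := by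
    refine fun f => scalar_of_twisted _ fun v => ?_
    have h1 : ∀ y, P f (vec v * y) = ι _ v * P f y := by
      intro y
      induction y using smul_incl_induction with
      | h0 => simp
      | h z a => rw [vec, mul_smul_comm, ← map_mul, hP, hP, mul_smul_comm]
      | hadd a b ha hb => rw [mul_add, map_add, map_add, mul_add, ha, hb]
    have h2 : ∀ y, P f (cmap involute y * vec v) = involute (P f y) * ι _ v := by
      intro y
      induction y using smul_incl_induction with
      | h0 => simp
      | h z a =>
        rw [vec, map_smul, cmap_incl, smul_mul_assoc, ← map_mul, hP, hP, map_smul, smul_mul_assoc]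
      | hadd a b ha hb => rw [map_add, add_mul, map_add, map_add, map_add, add_mul, ha, hb]
    rw [← h1, h, h2]
  have hdec : ∀ y : CCliff k,
      y = incl k (P Complex.reLm y) + Complex.I • incl k (P Complex.imLm y) := by
    intro y
    induction y using smul_incl_induction with
    | h0 => simp
    | h z a =>
      rw [hP, hP, map_smul, map_smul, ← algebraMap_smul ℂ (Complex.reLm z) (incl k a),
        ← algebraMap_smul ℂ (Complex.imLm z) (incl k a), smul_smul, ← add_smul]
      congr 1
      simp [mul_comm Complex.I]
    | hadd a b ha hb =>
      conv_lhs => rw [ha, hb]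
      simp only [map_add, smul_add]
      abel
  obtain ⟨r, hr⟩ := hsc Complex.reLm
  obtain ⟨s, hs⟩ := hsc Complex.imLm
  refine ⟨r + Complex.I * s, ?_⟩
  rw [hdec x, hr, hs, AlgHom.commutes, AlgHom.commutes, map_add, map_mul, Algebra.smul_def]
  rfl

theorem mem_even_of_involute {k : ℕ} {y : Cliff k} (hinv : involute y = y) :
    y ∈ even (cliffordForm k) := by
  obtain ⟨a, ha, b, hb, hab⟩ := Submodule.mem_sup.mp
    ((evenOdd_isCompl (cliffordForm k)).sup_eq_top ▸ Submodule.mem_top : y ∈ _)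
  rw [← hab, map_add, involute_eq_of_mem_even ha, involute_eq_of_mem_odd hb] at hinv
  have h3 : (2 : ℝ) • b = 0 := by
    rw [two_smul]; nth_rw 1 [← neg_neg b, add_left_cancel hinv]; simp
  have hb0 := (smul_eq_zero.mp h3).resolve_left two_ne_zero
  rw [hb0, add_zero] at hab
  rw [← hab]
  exact ha

theorem mem_spinc {k : ℕ} (x : (CCliff k)ˣ) (heven : cmap involute (x : CCliff k) = x)
    (hstar : cstar k x = MulOpposite.op ↑x⁻¹) (hV : ∀ v, ∃ w, (x : CCliff k) * vec v = vec w * (x : CCliff k)) :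
    x ∈ SpincGroup k := by
  choose T hT using hV
  have hx : Function.Injective fun y : CCliff k => y * x := fun a b h => by simpa using h
  let TL : Vec k →ₗ[ℝ] Vec k :=
    { toFun := T
      map_add' := fun v w => vec_injective k (hx (by
        simp only [vec_add, add_mul, ← hT, mul_add]))
      map_smul' := fun r v => vec_injective k (hx (by
        simp only [vec_smul, smul_mul_assoc, ← hT, mul_smul_comm, RingHom.id_apply])) }
  have hnorm : ∀ v, ‖TL v‖ = ‖v‖ := by
    intro v
    have h1 : vec (T v) * vec (T v) * x = vec v * vec v * x := by
      rw [mul_assoc, ← hT, ← mul_assoc, ← hT, mul_assoc, vec_sq, Algebra.commutes]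
    have h2 := hx h1
    rw [vec_sq, vec_sq] at h2
    have h3 := neg_injective ((algebraMap ℝ (CCliff k)).injective h2)
    rw [real_inner_self_eq_norm_sq, real_inner_self_eq_norm_sq] at h3
    exact (pow_left_inj₀ (norm_nonneg _) (norm_nonneg _) two_ne_zero).mp h3
  let φ : Vec k ≃ₗᵢ[ℝ] Vec k := LinearIsometry.toLinearIsometryEquiv ⟨TL, hnorm⟩ rfl
  obtain ⟨l, -, hl⟩ := φ.reflections_generate_dim
  obtain ⟨y, hy, hpar, hyv⟩ := exists_pin l
  rw [← hl] at hyv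
  have hyy : star y * y = 1 := pinGroup.star_mul_self_of_mem hy
  have hyy' : y * star y = 1 := pinGroup.mul_star_self_of_mem hy
  have hφ : ∀ v, φ v = T v := fun v => rfl
  obtain ⟨c, hc⟩ := twisted_scalar (incl k (star y) * (x : CCliff k)) (fun v => by
    rw [map_mul, heven, cmap_incl, mul_assoc, hT, ← mul_assoc, ← mul_assoc]
    congr 1
    rw [vec, vec, ← map_mul, ← map_mul]
    congr 1
    have : involute (star y) * involute y = 1 := by rw [← map_mul, hyy, map_one]
    calc ι _ v * star y = involute (star y) * (involute y * ι _ v) * star y := by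
          rw [← mul_assoc, this, one_mul]
      _ = involute (star y) * ι _ (T v) := by rw [hyv, hφ, mul_assoc, mul_assoc, hyy', mul_one])
  have hxc : (x : CCliff k) = c • incl k y := by
    have := congrArg (fun z => incl k y * z) hc
    simp only [← mul_assoc, ← map_mul, hyy', map_one, one_mul] at this
    rw [this, Algebra.smul_def, Algebra.commutes]
  have hnc : ‖c‖ = 1 := by
    have h1 : (starRingEnd ℂ c • incl k (star y)) * (c • incl k y) = 1 := by
      have h2 := congrArg MulOpposite.unop hstar
      rw [hxc, cstar_smul_incl, MulOpposite.unop_op, MulOpposite.unop_op] at h2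
      rw [h2, ← hxc, Units.inv_mul]
    rw [smul_mul_smul_comm, ← map_mul, hyy, map_one, ← Algebra.algebraMap_eq_smul_one,
      ← (algebraMap ℂ (CCliff k)).map_one] at h1
    have h3 := (algebraMap ℂ (CCliff k)).injective h1
    rw [mul_comm, Complex.mul_conj] at h3
    rw [Complex.norm_def, show Complex.normSq c = 1 by exact_mod_cast h3, Real.sqrt_one]
  have hc0 : c ≠ 0 := by rintro rfl; simp at hnc
  have hinv : involute y = y := by
    refine hpar.resolve_right fun h => ?_
    rw [hxc, map_smul, cmap_incl, h, map_neg] at heven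
    have h1 := smul_right_injective (CCliff k) hc0 heven
    have h2 : incl k y = 0 := by
      have h3 : (2 : ℝ) • incl k y = 0 := by
        rw [two_smul]; nth_rw 1 [← h1]; simp
      exact (smul_eq_zero.mp h3).resolve_left two_ne_zero
    rw [map_eq_zero_iff _ (incl_injective k)] at h2
    simp [h2] at hyy
  have heven' : y ∈ even (cliffordForm k) := mem_even_of_involute hinv
  refine ⟨(⟨c, mem_sphere_zero_iff_norm.mpr hnc⟩, ⟨y, spinGroup.mem_iff.mpr ⟨hy, heven'⟩⟩), ?_⟩
  ext
  exact (spincHom_val _ _).trans hxc.symm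

section ExpChart
variable {A : Type*} [NormedRing A] [NormedAlgebra ℝ A]

theorem contDiff_exp' [CompleteSpace A] : ContDiff ℝ ∞ (exp : A → A) :=
  contDiff_iff_contDiffAt.mpr fun x => (NormedSpace.exp_analytic (𝕂 := ℝ) x).contDiffAt

/-- A smooth local logarithm. -/
theorem exists_log [CompleteSpace A] (U : Set A) (hU : U ∈ 𝓝 (0 : A)) :
    ∃ e : OpenPartialHomeomorph A A, 0 ∈ e.source ∧ (∀ a, e a = exp a) ∧ e.source ⊆ U ∧
      ContDiffOn ℝ ∞ e.symm e.target := by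
  have h0 : HasStrictFDerivAt (exp : A → A)
      ((ContinuousLinearEquiv.refl ℝ A : A ≃L[ℝ] A) : A →L[ℝ] A) 0 :=
    hasStrictFDerivAt_exp_zero
  let e0 := h0.toOpenPartialHomeomorph exp
  let W : Set A := {a | fderiv ℝ (exp : A → A) a ∈
    Set.range ((↑) : (A ≃L[ℝ] A) → A →L[ℝ] A)}
  have hWo : IsOpen W :=
    ContinuousLinearEquiv.isOpen.preimage (contDiff_exp'.continuous_fderiv (by simp))
  have hW0 : (0 : A) ∈ W := ⟨ContinuousLinearEquiv.refl ℝ A, h0.hasFDerivAt.fderiv.symm⟩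
  have hV : IsOpen (interior U ∩ W) := isOpen_interior.inter hWo
  refine ⟨e0.restrOpen _ hV, ⟨h0.mem_toOpenPartialHomeomorph_source,
    mem_interior_iff_mem_nhds.mpr hU, hW0⟩, fun a => rfl, fun a ha => interior_subset ha.2.1, ?_⟩
  intro x hx
  set e := e0.restrOpen _ hV
  have hs := e.map_target hx
  obtain ⟨f', hf'⟩ := hs.2.2
  refine ContDiffAt.contDiffWithinAt ?_
  refine e.contDiffAt_symm (f₀' := f') hx ?_ contDiff_exp'.contDiffAt
  rw [hf']
  exact (contDiff_exp'.differentiable (by simp) _).hasFDerivAt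

/-- `exp a` as a unit. -/
def expUnit [CompleteSpace A] (a : A) : Aˣ :=
  have h : exp a * exp (-a) = 1 ∧ exp (-a) * exp a = 1 := by
    let _ : NormedAlgebra ℚ A := .restrictScalars ℚ ℝ A
    rw [← NormedSpace.exp_add_of_commute (Commute.refl a).neg_right,
      ← NormedSpace.exp_add_of_commute (Commute.refl a).neg_left]
    simp
  ⟨exp a, exp (-a), h.1, h.2⟩

/-- The data of a closed linear group with its Lie algebra: a subgroup of the units of an algebra,
and a linear subspace which is carried by the exponential to the subgroup, and which contains all
small logarithms of elements of the subgroup. -/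
structure IsLieSubgroup [CompleteSpace A] (H : Subgroup Aˣ) (L : Submodule ℝ A) : Prop where
  expUnit_mem : ∀ a ∈ L, expUnit a ∈ H
  log_mem : ∃ U ∈ 𝓝 (0 : A), ∀ a ∈ U, expUnit a ∈ H → a ∈ L

variable [FiniteDimensional ℝ A] [CompleteSpace A] {H : Subgroup Aˣ} {L : Submodule ℝ A}

namespace IsLieSubgroup
variable (h : IsLieSubgroup H L)

def log : OpenPartialHomeomorph A A :=
  (exists_log h.log_mem.choose h.log_mem.choose_spec.1).choose

theorem log_spec : 0 ∈ h.log.source ∧ (∀ a, h.log a = exp a) ∧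
    h.log.source ⊆ h.log_mem.choose ∧ ContDiffOn ℝ ∞ h.log.symm h.log.target :=
  (exists_log h.log_mem.choose h.log_mem.choose_spec.1).choose_spec

end IsLieSubgroup

theorem exists_proj (L : Submodule ℝ A) : ∃ f : A →L[ℝ] L, ∀ a : L, f a = a := by
  obtain ⟨f, hf⟩ := L.subtype.exists_leftInverse_of_injective (by simp)
  exact ⟨f.toContinuousLinearMap, fun a => congrArg (fun g => g a) hf⟩

/-- A linear projection to the Lie algebra. -/
def proj (L : Submodule ℝ A) : A →L[ℝ] L := (exists_proj L).choose
theorem proj_coe (L : Submodule ℝ A) (a : L) : proj L a = a := (exists_proj L).choose_spec a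

namespace IsLieSubgroup
variable (h : IsLieSubgroup H L)

theorem log_symm_mem {x : H} (hx : ((x : Aˣ) : A) ∈ h.log.target) :
    h.log.symm (x : Aˣ) ∈ L := by
  have h1 := h.log.map_target hx
  refine h.log_mem.choose_spec.2 _ (h.log_spec.2.2.1 h1) ?_
  have : expUnit (h.log.symm (x : Aˣ)) = x :=
    Units.ext ((h.log_spec.2.1 _).symm.trans (h.log.right_inv hx))
  rw [this]
  exact x.2

/-- The chart at the identity, given by the logarithm. -/
def chartOne : OpenPartialHomeomorph H L where
  toFun x := proj L (h.log.symm (x : Aˣ))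
  invFun a := ⟨expUnit (a : A), h.expUnit_mem a a.2⟩
  source := {x | ((x : Aˣ) : A) ∈ h.log.target}
  target := {a | (a : A) ∈ h.log.source}
  map_source' x hx := by
    have := proj_coe L ⟨_, h.log_symm_mem hx⟩
    change ((proj L (h.log.symm (x : Aˣ)) : L) : A) ∈ h.log.source
    rw [this]
    exact h.log.map_target hx
  map_target' a ha := by
    change exp (a : A) ∈ h.log.target
    rw [← h.log_spec.2.1]
    exact h.log.map_source ha
  left_inv' x hx := by
    have := proj_coe L ⟨_, h.log_symm_mem hx⟩
    refine Subtype.ext (Units.ext ?_)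
    change exp ((proj L _ : L) : A) = _
    rw [this, ← h.log_spec.2.1]
    exact h.log.right_inv hx
  right_inv' a ha := by
    change proj L (h.log.symm (exp (a : A))) = a
    rw [← h.log_spec.2.1, h.log.left_inv ha, proj_coe]
  open_source := h.log.open_target.preimage (Units.continuous_val.comp continuous_subtype_val)
  open_target := h.log.open_source.preimage continuous_subtype_val
  continuousOn_toFun := (proj L).continuous.comp_continuousOn
    (h.log.continuousOn_symm.comp
      (Units.continuous_val.comp continuous_subtype_val).continuousOn fun _ hx => hx)
  continuousOn_invFun := by
    refine (Continuous.subtype_mk ?_ _).continuousOn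
    have hc : Continuous (exp : A → A) := contDiff_exp'.continuous
    exact Units.continuous_iff.mpr ⟨hc.comp continuous_subtype_val,
      hc.comp continuous_subtype_val.neg⟩

/-- The chart at `g`, a left translate of the chart at the identity. -/
def chart (g : H) : OpenPartialHomeomorph H L :=
  (Homeomorph.mulLeft g⁻¹).toOpenPartialHomeomorph.trans h.chartOne

/-- The manifold structure of a closed linear group. -/
@[reducible] def chartedSpace : ChartedSpace L H where
  atlas := Set.range h.chart
  chartAt := h.chart
  mem_chart_source g := by
    have : (1 : A) ∈ h.log.target := by
      have := h.log.map_source h.log_spec.1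
      rwa [h.log_spec.2.1, NormedSpace.exp_zero] at this
    simpa [chart, chartOne] using this
  chart_mem_atlas g := ⟨g, rfl⟩

theorem chart_apply (g x : H) :
    h.chart g x = proj L (h.log.symm (((g⁻¹ : H) : Aˣ) * ((x : Aˣ) : A))) := rfl

theorem chart_symm_apply (g : H) (a : L) :
    (((h.chart g).symm a : H) : Aˣ) = ((g : Aˣ) : A) * exp (a : A) := by
  rfl

theorem mem_chart_source_iff (g x : H) :
    x ∈ (h.chart g).source ↔ (((g⁻¹ : H) : Aˣ) * ((x : Aˣ) : A)) ∈ h.log.target := by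
  simp [chart, chartOne]

theorem contDiffOn_proj_log : ContDiffOn ℝ ∞ (fun x => proj L (h.log.symm x)) h.log.target :=
  (proj L).contDiff.comp_contDiffOn h.log_spec.2.2.2

theorem isManifold :
    letI := h.chartedSpace
    IsManifold 𝓘(ℝ, L) ∞ H := by
  letI := h.chartedSpace
  refine isManifold_of_contDiffOn _ _ _ ?_
  rintro _ _ ⟨g, rfl⟩ ⟨g', rfl⟩
  simp only [modelWithCornersSelf_coe, modelWithCornersSelf_coe_symm, Function.comp_id,
    Function.id_comp, Set.preimage_id, Set.range_id, Set.inter_univ]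
  have h1 : ContDiff ℝ ∞ fun a : L =>
      (((g'⁻¹ : H) : Aˣ) : A) * (((g : Aˣ) : A) * exp (a : A)) :=
    contDiff_const.mul (contDiff_const.mul (contDiff_exp'.comp L.subtypeL.contDiff))
  refine (h.contDiffOn_proj_log.comp h1.contDiffOn (t := h.log.target) fun a ha => ?_).congr
    fun a ha => ?_
  · have := (h.mem_chart_source_iff g' _).mp ha.2
    rwa [OpenPartialHomeomorph.symm_symm, chart_symm_apply] at this
  · change h.chart g' ((h.chart g).symm a) = _
    rw [chart_apply, chart_symm_apply]
    rfl

theorem contMDiff_val :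
    letI := h.chartedSpace
    ContMDiff 𝓘(ℝ, L) 𝓘(ℝ, A) ∞ (fun x : H => ((x : Aˣ) : A)) := by
  letI := h.chartedSpace
  have := h.isManifold
  intro g
  have h1 : ContMDiff 𝓘(ℝ, L) 𝓘(ℝ, A) ∞ fun a : L => ((g : Aˣ) : A) * exp (a : A) :=
    (contDiff_const.mul (contDiff_exp'.comp L.subtypeL.contDiff)).contMDiff
  have h2 : ContMDiffOn 𝓘(ℝ, L) 𝓘(ℝ, A) ∞
      ((fun a : L => ((g : Aˣ) : A) * exp (a : A)) ∘ (h.chart g)) (h.chart g).source :=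
    h1.comp_contMDiffOn (contMDiffOn_of_mem_maximalAtlas
      (IsManifold.subset_maximalAtlas ⟨g, rfl⟩))
  refine ((h2.congr fun x hx => ?_).contMDiffAt
    ((h.chart g).open_source.mem_nhds (h.chartedSpace.mem_chart_source g)))
  rw [Function.comp_apply, ← h.chart_symm_apply, (h.chart g).left_inv hx]

theorem contMDiff_of_val {E X M : Type*} [NormedAddCommGroup E] [NormedSpace ℝ E]
    [TopologicalSpace X] {I : ModelWithCorners ℝ E X} [TopologicalSpace M] [ChartedSpace X M]
    {f : M → H} (hf : ContMDiff I 𝓘(ℝ, A) ∞ fun x => ((f x : Aˣ) : A)) :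
    letI := h.chartedSpace
    ContMDiff I 𝓘(ℝ, L) ∞ f := by
  letI := h.chartedSpace
  have := h.isManifold
  have hc : Continuous f := by
    refine Continuous.subtype_mk (f := fun x => (f x : Aˣ)) ?_ _
    exact Units.isOpenEmbedding_val.isInducing.continuous_iff.mpr hf.continuous
  intro x
  rw [contMDiffAt_iff_target]
  refine ⟨hc.continuousAt, ?_⟩
  let g := f x
  have h1 : ContMDiff I 𝓘(ℝ, A) ∞ fun y => (((g⁻¹ : H) : Aˣ) : A) * ((f y : Aˣ) : A) :=
    (contDiff_const.mul contDiff_id).contMDiff.comp hf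
  have h2 : ContMDiffOn I 𝓘(ℝ, L) ∞ (fun y => h.chart g (f y)) (f ⁻¹' (h.chart g).source) :=
    h.contDiffOn_proj_log.contMDiffOn.comp h1.contMDiffOn fun y hy =>
      (h.mem_chart_source_iff g _).mp hy
  exact h2.contMDiffAt (((h.chart g).open_source.preimage hc).mem_nhds
    (h.chartedSpace.mem_chart_source g))

theorem lieGroup :
    letI := h.chartedSpace
    LieGroup 𝓘(ℝ, L) ∞ H := by
  letI := h.chartedSpace
  have := h.isManifold
  have hmul : ContMDiff 𝓘(ℝ, A × A) 𝓘(ℝ, A) ∞ fun p : A × A => p.1 * p.2 :=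
    (contDiff_fst.mul contDiff_snd).contMDiff
  refine { h.isManifold with contMDiff_mul := ?_, contMDiff_inv := ?_ }
  · refine h.contMDiff_of_val ?_
    exact hmul.comp ((h.contMDiff_val.comp contMDiff_fst).prodMk_space
      (h.contMDiff_val.comp contMDiff_snd))
  · refine h.contMDiff_of_val fun x => ?_
    have h1 : ContMDiffAt 𝓘(ℝ, A) 𝓘(ℝ, A) ∞ Ring.inverse (((x : Aˣ) : A)) :=
      (contDiffAt_ringInverse ℝ (x : Aˣ)).contMDiffAt
    refine (h1.comp x (h.contMDiff_val x)).congr_of_eventuallyEq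
      (Filter.Eventually.of_forall fun y => ?_)
    exact (Ring.inverse_unit (y : Aˣ)).symm

end IsLieSubgroup
end ExpChart

section SubalgebraExp
variable {B : Type*} [NormedRing B] [NormedAlgebra ℝ B] [FiniteDimensional ℝ B] [CompleteSpace B]

theorem exp_mem_subalgebra (S : Subalgebra ℝ B) (D : B) (hD : D ∈ S) : exp D ∈ S := by
  let _ : NormedAlgebra ℚ S := .restrictScalars ℚ ℝ S
  let _ : NormedAlgebra ℚ B := .restrictScalars ℚ ℝ B
  have : CompleteSpace S := FiniteDimensional.complete ℝ S
  have h := NormedSpace.map_exp S.val continuous_subtype_val ⟨D, hD⟩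
  exact h ▸ (exp (⟨D, hD⟩ : S)).2

theorem log_mem_subalgebra (S : Subalgebra ℝ B) :
    ∃ U ∈ 𝓝 (0 : B), ∀ D ∈ U, exp D ∈ S → D ∈ S := by
  let _ : NormedAlgebra ℚ S := .restrictScalars ℚ ℝ S
  let _ : NormedAlgebra ℚ B := .restrictScalars ℚ ℝ B
  have : CompleteSpace S := FiniteDimensional.complete ℝ S
  obtain ⟨e, he0, he, -, -⟩ := exists_log (A := B) Set.univ Filter.univ_mem
  obtain ⟨f, hf0, hf, hfU, -⟩ := exists_log (A := S) ((↑) ⁻¹' e.source)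
    (continuous_subtype_val.continuousAt.preimage_mem_nhds (e.open_source.mem_nhds he0))
  obtain ⟨O, hO, hOf⟩ := isOpen_induced_iff.mp f.open_target
  have h1 : (1 : B) ∈ O := by
    have h2 := f.map_source hf0
    rw [hf, NormedSpace.exp_zero, ← hOf] at h2
    exact h2
  refine ⟨e.source ∩ exp ⁻¹' O, Filter.inter_mem (e.open_source.mem_nhds he0)
    ((contDiff_exp' (A := B)).continuous.continuousAt.preimage_mem_nhds
      (by rw [NormedSpace.exp_zero]; exact hO.mem_nhds h1)), fun D hD hDS => ?_⟩
  have h3 : (⟨exp D, hDS⟩ : S) ∈ f.target := by rw [← hOf]; exact hD.2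
  have h4 : exp ((f.symm ⟨exp D, hDS⟩ : S) : B) = exp D := by
    have h5 := f.right_inv h3
    rw [hf] at h5
    have h6 := NormedSpace.map_exp S.val continuous_subtype_val (f.symm ⟨exp D, hDS⟩)
    rw [h5] at h6
    exact h6.symm
  have h7 : e ((f.symm ⟨exp D, hDS⟩ : S) : B) = e D := by rw [he, h4, he]
  rw [← e.injOn (hfU (f.map_target h3)) hD.1 h7]
  exact (f.symm ⟨exp D, hDS⟩ : S).2

/-- The commutator with `a`, as an operator. -/
def adOp : B →L[ℝ] (B →L[ℝ] B) := ContinuousLinearMap.mul ℝ B - (ContinuousLinearMap.mul ℝ B).flip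

theorem adOp_apply (a y : B) : adOp a y = a * y - y * a := rfl

theorem exp_adOp (a y : B) : exp (adOp a) y = exp a * y * exp (-a) := by
  let _ : NormedAlgebra ℚ B := .restrictScalars ℚ ℝ B
  let _ : NormedAlgebra ℚ Bᵐᵒᵖ := .restrictScalars ℚ ℝ Bᵐᵒᵖ
  let _ : NormedAlgebra ℚ (B →L[ℝ] B) := .restrictScalars ℚ ℝ (B →L[ℝ] B)
  let lm : B →+* (B →L[ℝ] B) :=
    { toFun := ContinuousLinearMap.mul ℝ B
      map_one' := by ext; simp
      map_mul' := fun a b => by ext; simp [mul_assoc]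
      map_zero' := by simp
      map_add' := by simp }
  let rm : Bᵐᵒᵖ →+* (B →L[ℝ] B) :=
    { toFun := fun b => (ContinuousLinearMap.mul ℝ B).flip b.unop
      map_one' := by ext; simp
      map_mul' := fun a b => by ext; simp [mul_assoc]
      map_zero' := by simp
      map_add' := by simp }
  have hl := NormedSpace.map_exp lm (ContinuousLinearMap.mul ℝ B).continuous a
  have hr := NormedSpace.map_exp rm ((ContinuousLinearMap.mul ℝ B).flip.continuous.comp
    MulOpposite.continuous_unop) (MulOpposite.op (-a))
  have had : adOp a = lm a + rm (MulOpposite.op (-a)) := by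
    ext y
    simp [adOp_apply, lm, rm, sub_eq_add_neg]
  have hcomm : Commute (lm a) (rm (MulOpposite.op (-a))) := by
    ext y
    simp [lm, rm, mul_assoc]
  rw [had, NormedSpace.exp_add_of_commute hcomm, ← hl, ← hr, NormedSpace.exp_op]
  simp [lm, rm, mul_assoc]

end SubalgebraExp

section SpincLie
variable (k : ℕ)

/-- A basis used to define a norm on `C_k ⊗ ℂ`. -/
def ccliffBasis := Module.finBasis ℝ (CCliff k)

open scoped Matrix.Norms.Operator in
instance : NormedRing (CCliff k) :=
  NormedRing.induced (CCliff k) _ (Algebra.leftMulMatrix (ccliffBasis k))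
    (Algebra.leftMulMatrix_injective _)

open scoped Matrix.Norms.Operator in
instance : NormedAlgebra ℝ (CCliff k) :=
  NormedAlgebra.induced ℝ (CCliff k) _ (Algebra.leftMulMatrix (ccliffBasis k))

instance : CompleteSpace (CCliff k) := FiniteDimensional.complete ℝ _

variable {k}

theorem spinc_even {x : (CCliff k)ˣ} (hx : x ∈ SpincGroup k) :
    cmap involute (x : CCliff k) = x := by
  obtain ⟨⟨z, A⟩, rfl⟩ := hx
  rw [spincHom_val, map_smul, cmap_incl, spinGroup.involute_eq A.2]

theorem spinc_star {x : (CCliff k)ˣ} (hx : x ∈ SpincGroup k) :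
    cstar k x = MulOpposite.op ↑x⁻¹ := by
  obtain ⟨⟨z, A⟩, rfl⟩ := hx
  rw [← map_inv, spincHom_val, cstar_smul_incl]
  congr 1
  rw [Prod.inv_mk, spincHom_val, Circle.coe_inv_eq_conj, ← spinGroup.star_eq_inv,
    spinGroup.coe_star]

theorem spinc_conj (x : Spinc k) (v : Vec k) :
    ∃ w : Vec k, (x.1 : CCliff k) * vec v * (↑x.1⁻¹ : CCliff k) = vec w := by
  obtain ⟨_, ⟨z, A⟩, rfl⟩ := x
  let _ : Invertible (2 : ℝ) := invertibleOfNonzero two_ne_zero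
  obtain ⟨w, hw⟩ := spinGroup.conjAct_smul_ι_mem_range_ι (x := spinGroup.toUnits A) A.2 v
  refine ⟨w, ?_⟩
  have hw' := congrArg (incl k) hw
  rw [ConjAct.units_smul_def, ConjAct.ofConjAct_toConjAct, map_mul, map_mul] at hw'
  refine Eq.trans ?_ hw'.symm
  change (spincHom k (z, A) : CCliff k) * vec v * (↑(spincHom k (z, A))⁻¹ : CCliff k) = _
  rw [← map_inv, spincHom_val, Prod.inv_mk, spincHom_val, smul_mul_assoc, smul_mul_smul_comm,
    ← Circle.coe_mul, mul_inv_cancel, Circle.coe_one, one_smul]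
  rfl

/-- The Lie algebra of `Spin^c(k)`: the even elements `a` of `C_k ⊗ ℂ` with `a* = -a` whose
commutator with each vector is a vector. -/
def spincLie (k : ℕ) : Submodule ℝ (CCliff k) where
  carrier := {a | cmap involute a = a ∧ cstar k a = MulOpposite.op (-a) ∧
    ∀ v : Vec k, ∃ w : Vec k, a * vec v - vec v * a = vec w}
  zero_mem' := ⟨map_zero _, by simp, fun v => ⟨0, by simp [vec]⟩⟩
  add_mem' := by
    rintro a b ⟨h1, h2, h3⟩ ⟨h1', h2', h3'⟩
    refine ⟨by rw [map_add, h1, h1'], by rw [map_add, h2, h2', ← MulOpposite.op_add, neg_add],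
      fun v => ?_⟩
    obtain ⟨w, hw⟩ := h3 v
    obtain ⟨w', hw'⟩ := h3' v
    exact ⟨w + w', by rw [vec_add, ← hw, ← hw']; noncomm_ring⟩
  smul_mem' := by
    rintro r a ⟨h1, h2, h3⟩
    refine ⟨?_, by rw [map_smul, h2, ← MulOpposite.op_smul, smul_neg], fun v => ?_⟩
    · rw [← algebraMap_smul ℂ r a, map_smul, h1]
    · obtain ⟨w, hw⟩ := h3 v
      exact ⟨r • w, by rw [vec_smul, ← hw, smul_sub, smul_mul_assoc, mul_smul_comm]⟩

/-- The operators on `C_k ⊗ ℂ` that preserve the space of vectors. -/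
def vecPreserving (k : ℕ) : Subalgebra ℝ (CCliff k →L[ℝ] CCliff k) where
  carrier := {T | ∀ v : Vec k, ∃ w : Vec k, T (vec v) = vec w}
  mul_mem' := fun {S T} hS hT v => by
    obtain ⟨w, hw⟩ := hT v
    obtain ⟨u, hu⟩ := hS w
    exact ⟨u, by rw [mul_apply_eq_comp, hw, hu]⟩
  add_mem' := fun {S T} hS hT v => by
    obtain ⟨w, hw⟩ := hT v
    obtain ⟨u, hu⟩ := hS v
    exact ⟨u + w, by rw [add_apply, hw, hu, vec_add]⟩
  algebraMap_mem' := fun r v => ⟨r • v, by rw [vec_smul, Algebra.algebraMap_eq_smul_one]; rfl⟩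

theorem continuous_linear {F : Type*} [AddCommGroup F] [Module ℝ F] [TopologicalSpace F]
    [IsTopologicalAddGroup F] [ContinuousSMul ℝ F] (f : CCliff k →ₗ[ℝ] F) : Continuous f :=
  f.continuous_of_finiteDimensional

theorem isLieSubgroup_spinc (k : ℕ) : IsLieSubgroup (SpincGroup k) (spincLie k) := by
  let _ : NormedAlgebra ℚ (CCliff k) := .restrictScalars ℚ ℝ _
  let _ : NormedAlgebra ℚ (CCliff k)ᵐᵒᵖ := .restrictScalars ℚ ℝ _
  have : FiniteDimensional ℝ (CCliff k →L[ℝ] CCliff k) := inferInstance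
  have hc1 : Continuous (cmap (involute (Q := cliffordForm k))) :=
    continuous_linear ((cmap (involute (Q := cliffordForm k))).toLinearMap.restrictScalars ℝ)
  have hc2 : Continuous (cstar k) := continuous_linear (cstar k).toLinearMap
  have he1 : ∀ a, cmap involute (exp a) = exp (cmap (involute (Q := cliffordForm k)) a) :=
    NormedSpace.map_exp _ hc1
  have he2 : ∀ a, cstar k (exp a) = exp (cstar k a) := NormedSpace.map_exp _ hc2
  constructor
  · rintro a ⟨h1, h2, h3⟩
    refine mem_spinc _ ?_ ?_ ?_
    · change cmap involute (exp a) = exp a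
      rw [he1, h1]
    · change cstar k (exp a) = MulOpposite.op (exp (-a))
      rw [he2, h2, NormedSpace.exp_op]
    · intro v
      obtain ⟨w, hw⟩ := exp_mem_subalgebra (vecPreserving k) (adOp a) h3 v
      refine ⟨w, ?_⟩
      change exp a * vec v = vec w * exp a
      have h4 : exp (-a) * exp a = 1 := (expUnit a).inv_mul
      rw [← hw, exp_adOp, mul_assoc, h4, mul_one]
  · obtain ⟨e, he0, he, -, -⟩ := exists_log (A := CCliff k) Set.univ Filter.univ_mem
    obtain ⟨U, hU, hUS⟩ := log_mem_subalgebra (vecPreserving k)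
    have hes := e.open_source.mem_nhds he0
    have hc3 : Continuous fun a : CCliff k => -(cstar k a).unop :=
      (MulOpposite.continuous_unop.comp hc2).neg
    refine ⟨(e.source ∩ cmap involute ⁻¹' e.source) ∩
      ((fun a : CCliff k => -(cstar k a).unop) ⁻¹' e.source ∩ adOp ⁻¹' U),
      Filter.inter_mem (Filter.inter_mem hes (hc1.continuousAt.preimage_mem_nhds ?_))
      (Filter.inter_mem (hc3.continuousAt.preimage_mem_nhds ?_)
        (adOp.continuous.continuousAt.preimage_mem_nhds ?_)), ?_⟩
    · rwa [map_zero]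
    · simpa using hes
    · rwa [map_zero]
    · rintro a ⟨⟨ha1, ha2⟩, ha3, ha4⟩ ha
      have h1 := spinc_even ha
      have h2 := spinc_star ha
      change cmap involute (exp a) = exp a at h1
      change cstar k (exp a) = MulOpposite.op (exp (-a)) at h2
      refine ⟨e.injOn ha2 ha1 (by rw [he, he, ← he1, h1]), ?_, ?_⟩
      · have h5 : -(cstar k a).unop = a := by
          refine e.injOn ha3 ha1 ?_
          rw [he, he]
          have h6 : exp (cstar k a).unop = exp (-a) := by
            rw [NormedSpace.exp_unop, ← he2, h2, MulOpposite.unop_op]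
          have h7 : exp (-a) * exp (-(cstar k a).unop) = 1 :=
            h6 ▸ (expUnit (cstar k a).unop).mul_inv
          have h8 : exp a * exp (-a) = 1 := (expUnit a).mul_inv
          calc exp (-(cstar k a).unop) = exp a * (exp (-a) * exp (-(cstar k a).unop)) := by
                rw [← mul_assoc, h8, one_mul]
            _ = exp a := by rw [h7, mul_one]
        rw [← h5, neg_neg, h5]
        rfl
      · refine hUS _ ha4 fun v => ?_
        obtain ⟨w, hw⟩ := spinc_conj (⟨expUnit a, ha⟩ : Spinc k) v
        exact ⟨w, by rw [exp_adOp]; exact hw⟩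

instance (k : ℕ) : ChartedSpace (spincLie k) (Spinc k) := (isLieSubgroup_spinc k).chartedSpace
instance (k : ℕ) : LieGroup 𝓘(ℝ, spincLie k) ∞ (Spinc k) := (isLieSubgroup_spinc k).lieGroup
end SpincLie

section SpincMaps

/-- The determinant `Spin^c(k) → U(1)`, `[A, z] ↦ z ^ 2`. -/
def det {k : ℕ} (x : Spinc k) : Circle := (Classical.choose x.2).1 ^ 2

theorem det_eq {k : ℕ} (x : Spinc k) (z : Circle) (A : Spin k) (h : spincHom k (z, A) = x.1) :
    det x = z ^ 2 :=
  spincHom_sq ((Classical.choose_spec x.2).trans h.symm)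

/-- The element `[A, z]` of `Spin^c(k)`. -/
def spincMk {k : ℕ} (A : Spin k) (z : Circle) : Spinc k := ⟨spincHom k (z, A), (z, A), rfl⟩

/-- The homomorphism `λ^c` from `Spin^c(k)` to the rotations of `ℝ^k`: `[A, z] ↦ (v ↦ A v A⁻¹)`.
Since scalars are central, this is the conjugation by `[A, z]` in `C_k ⊗ ℂ`. -/
def rot {k : ℕ} (x : Spinc k) (v : Vec k) : Vec k := Classical.choose (spinc_conj x v)

theorem rot_spec {k : ℕ} (x : Spinc k) (v : Vec k) :
    (x.1 : CCliff k) * vec v * (↑x.1⁻¹ : CCliff k) = vec (rot x v) :=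
  Classical.choose_spec (spinc_conj x v)

theorem map_mem_spinGroup {k l : ℕ} (f : cliffordForm k →qᵢ cliffordForm l) {x : Cliff k}
    (hx : x ∈ spinGroup (cliffordForm k)) :
    CliffordAlgebra.map f x ∈ spinGroup (cliffordForm l) := by
  obtain ⟨u, hu, rfl⟩ := pinGroup.mem_lipschitzGroup (spinGroup.mem_pin hx)
  have hmi : ∀ y, involute (CliffordAlgebra.map f y) = CliffordAlgebra.map f (involute y) := by
    intro y
    have : (involute.comp (CliffordAlgebra.map f)) = (CliffordAlgebra.map f).comp involute := by
      ext v
      simp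
    exact DFunLike.congr_fun this y
  have hmr : ∀ y, reverse (CliffordAlgebra.map f y) = CliffordAlgebra.map f (reverse y) := by
    intro y
    induction y using CliffordAlgebra.induction with
    | algebraMap r => simp
    | ι v => simp
    | mul a b ha hb => rw [map_mul, reverse.map_mul, ha, hb, reverse.map_mul, map_mul]
    | add a b ha hb => simp only [map_add, ha, hb]
  have hms : ∀ y, star (CliffordAlgebra.map f y) = CliffordAlgebra.map f (star y) := by
    intro y
    rw [star_def, star_def, hmi, hmr]
  refine spinGroup.mem_iff.mpr ⟨pinGroup.mem_iff.mpr ⟨⟨Units.map (CliffordAlgebra.map f) u, ?_, rfl⟩,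
    ?_⟩, ?_⟩
  · change u ∈ Subgroup.comap (Units.map (CliffordAlgebra.map f : Cliff k →* Cliff l))
      (lipschitzGroup (cliffordForm l))
    refine (Subgroup.closure_le _).mpr ?_ hu
    rintro y ⟨v, hv⟩
    refine Subgroup.subset_closure ⟨f v, ?_⟩
    change _ = CliffordAlgebra.map f (y : Cliff k)
    rw [← hv, map_apply_ι]
  · have hunit := Unitary.mem_iff.mp (pinGroup.mem_unitary (spinGroup.mem_pin hx))
    rw [Unitary.mem_iff, hms, ← map_mul, ← map_mul, hunit.1, hunit.2, map_one]
    exact ⟨rfl, rfl⟩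
  · exact mem_even_of_involute (by rw [hmi, spinGroup.involute_eq hx])

/-- The homomorphism `Spin^c(k) → Spin^c(l)` induced by a linear isometric embedding. -/
def spincMap {k l : ℕ} (f : cliffordForm k →qᵢ cliffordForm l) (x : Spinc k) : Spinc l :=
  ⟨Units.map (cmap (CliffordAlgebra.map f)).toRingHom.toMonoidHom x.1, by
    obtain ⟨_, ⟨z, A⟩, rfl⟩ := x
    refine ⟨(z, ⟨_, map_mem_spinGroup f A.2⟩), Units.ext ?_⟩
    rw [spincHom_val]
    change _ = cmap (CliffordAlgebra.map f) (spincHom k (z, A) : CCliff k)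
    rw [spincHom_val, map_smul, cmap_incl]⟩

/-- `ℝ^m → ℝ^(m+n)`, `v ↦ (v, 0)`. -/
def inlVec (m n : ℕ) : cliffordForm m →qᵢ cliffordForm (m + n) where
  toFun v := WithLp.toLp 2 (Fin.append v 0)
  map_add' v w := by
    ext i; refine Fin.addCases (fun i => ?_) (fun i => ?_) i <;> simp
  map_smul' r v := by
    ext i; refine Fin.addCases (fun i => ?_) (fun i => ?_) i <;> simp
  map_app' v := by
    rw [cliffordForm_apply, cliffordForm_apply, PiLp.inner_apply, PiLp.inner_apply,
      Fin.sum_univ_add]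
    simp

/-- `ℝ^n → ℝ^(m+n)`, `v ↦ (0, v)`. -/
def inrVec (m n : ℕ) : cliffordForm n →qᵢ cliffordForm (m + n) where
  toFun v := WithLp.toLp 2 (Fin.append 0 v)
  map_add' v w := by
    ext i; refine Fin.addCases (fun i => ?_) (fun i => ?_) i <;> simp
  map_smul' r v := by
    ext i; refine Fin.addCases (fun i => ?_) (fun i => ?_) i <;> simp
  map_app' v := by
    rw [cliffordForm_apply, cliffordForm_apply, PiLp.inner_apply, PiLp.inner_apply,
      Fin.sum_univ_add]
    simp

/-- The homomorphism `Spin^c(m) × Spin^c(n) → Spin^c(m+n)`, `(x, y) ↦ x y`. -/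
def spincMul {m n : ℕ} (x : Spinc m) (y : Spinc n) : Spinc (m + n) :=
  spincMap (inlVec m n) x * spincMap (inrVec m n) y

/-- The projection `ℝ^(m+n) → ℝ^m`. -/
def fstVec {m n : ℕ} (v : Vec (m + n)) : Vec m := WithLp.toLp 2 fun i => v (Fin.castAdd n i)

/-- The projection `ℝ^(m+n) → ℝ^n`. -/
def sndVec {m n : ℕ} (v : Vec (m + n)) : Vec n := WithLp.toLp 2 fun i => v (Fin.natAdd m i)

/-- The Lie algebra `T_1 Spin^c(k)`. -/
abbrev LieSpinc (k : ℕ) : Type := TangentSpace 𝓘(ℝ, spincLie k) (1 : Spinc k)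

/-- The velocity at time `0` of a curve in `Spin^c(k)` that starts at `1`. -/
def velocity {k : ℕ} (γ : ℝ → Spinc k) : LieSpinc k :=
  let v : spincLie k := mfderiv 𝓘(ℝ, ℝ) 𝓘(ℝ, spincLie k) γ 0 (1 : ℝ)
  v

/-- The subalgebra `𝔰𝔭𝔦𝔫(k)` of `𝔰𝔭𝔦𝔫^c(k)`: the velocities of the smooth curves in `Spin(k)`
that start at `1`. -/
def spinLie (k : ℕ) : Set (LieSpinc k) :=
  {ζ | ∃ γ : ℝ → Spinc k, ContMDiff 𝓘(ℝ, ℝ) 𝓘(ℝ, spincLie k) ∞ γ ∧ γ 0 = 1 ∧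
    (∀ t, ∃ A : Spin k, γ t = spincMk A 1) ∧ velocity γ = ζ}

/-- The element `i s` of `𝔲(1) ⊂ 𝔰𝔭𝔦𝔫^c(k)`. -/
def u1Vec (k : ℕ) (s : ℝ) : LieSpinc k := velocity fun t => spincMk 1 (Circle.exp (s * t))

/-- The differential `det_* : 𝔰𝔭𝔦𝔫^c(k) → 𝔲(1) = i ℝ ⊂ ℂ` of the determinant. -/
def detStar {k : ℕ} (ξ : LieSpinc k) : ℂ :=
  mfderiv 𝓘(ℝ, spincLie k) 𝓘(ℝ, ℂ) (fun x : Spinc k => (det x : ℂ)) 1 ξ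

/-- The left invariant Maurer-Cartan form of `Spin^c(k)`. -/
def maurerCartan {k : ℕ} (h : Spinc k) (w : TangentSpace 𝓘(ℝ, spincLie k) h) : LieSpinc k :=
  let v : spincLie k := mfderiv 𝓘(ℝ, spincLie k) 𝓘(ℝ, spincLie k) (fun x : Spinc k => h⁻¹ * x) h w
  v

end SpincMaps

section Forms

variable {E H M V : Type*} [NormedAddCommGroup E] [NormedSpace ℝ E] [TopologicalSpace H]
  {I : ModelWithCorners ℝ E H} [TopologicalSpace M] [ChartedSpace H M]
  [NormedAddCommGroup V] [NormedSpace ℝ V] {n : ℕ}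

/-- Differential forms of degree `n` on `M` with values in `V` (not necessarily smooth). -/
abbrev DForm (I : ModelWithCorners ℝ E H) (M : Type*) [TopologicalSpace M] [ChartedSpace H M]
    (n : ℕ) (V : Type*) [NormedAddCommGroup V] [NormedSpace ℝ V] : Type _ :=
  ∀ x : M, TangentSpace I x [⋀^Fin n]→L[ℝ] V

/-- The form in the preferred chart at `x₀`: its pullback by the inverse of the chart. -/
def DForm.inChart (α : DForm I M n V) (x₀ : M) (y : E) : E [⋀^Fin n]→L[ℝ] V :=
  (α ((extChartAt I x₀).symm y)).compContinuousLinearMap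
    (mfderiv 𝓘(ℝ, E) I (extChartAt I x₀).symm y)

/-- Smoothness of a form on a manifold without boundary. -/
def DForm.IsSmooth (α : DForm I M n V) : Prop :=
  ∀ x₀ : M, ContDiffOn ℝ ∞ (α.inChart x₀) (extChartAt I x₀).target

/-- The exterior derivative of a smooth form on a manifold without boundary, computed in charts. -/
def DForm.extD (α : DForm I M n V) : DForm I M (n + 1) V := fun x =>
  (extDeriv (α.inChart x) (extChartAt I x x)).compContinuousLinearMap
    (mfderiv I 𝓘(ℝ, E) (extChartAt I x) x)

end Forms

section Geometry

variable {EG : Type*} [NormedAddCommGroup EG] [NormedSpace ℝ EG]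
  {G : Type*} [Group G] [TopologicalSpace G] [ChartedSpace EG G]
  {E H M : Type*} [NormedAddCommGroup E] [NormedSpace ℝ E] [TopologicalSpace H]
  {I : ModelWithCorners ℝ E H} [TopologicalSpace M] [ChartedSpace H M] [IsManifold I ∞ M]
  {EP P : Type*} [NormedAddCommGroup EP] [NormedSpace ℝ EP]
  [TopologicalSpace P] [ChartedSpace EP P]
  {k : ℕ}

/-- A family of vectors is a positively oriented basis. -/
def IsPositive {V : Type*} [AddCommGroup V] [Module ℝ V] {k : ℕ}
    (o : Orientation ℝ V (Fin k)) (v : Fin k → V) : Prop :=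
  ∃ b : Module.Basis (Fin k) ℝ V, ⇑b = v ∧ b.orientation = o

/-- An oriented Riemannian manifold of dimension `k`, with a smooth action of `G` by orientation
preserving isometries. -/
structure OrientedRiemannianAction (I : ModelWithCorners ℝ E H) (M : Type*) [TopologicalSpace M]
    [ChartedSpace H M] [IsManifold I ∞ M] (EG G : Type*) [NormedAddCommGroup EG]
    [NormedSpace ℝ EG] [Group G] [TopologicalSpace G] [ChartedSpace EG G] (k : ℕ) where
  /-- the action -/
  act : G →* Equiv.Perm M
  contMDiff_act : ContMDiff (𝓘(ℝ, EG).prod I) I ∞ fun p : G × M => act p.1 p.2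
  /-- the Riemannian metric -/
  metric : Bundle.ContMDiffRiemannianMetric I ∞ E (fun x : M => TangentSpace I x)
  /-- the orientation -/
  orientation : ∀ x : M, Orientation ℝ (TangentSpace I x) (Fin k)
  /-- near each point there is a smooth positively oriented frame -/
  exists_frame : ∀ x₀ : M, ∃ U ∈ 𝓝 x₀, ∃ X : Fin k → ∀ x : M, TangentSpace I x,
    (∀ i, ContMDiffOn I I.tangent ∞ (fun x => (⟨x, X i x⟩ : TangentBundle I M)) U) ∧
    ∀ x ∈ U, IsPositive (orientation x) fun i => X i x
  act_isometry : ∀ (g : G) (x : M) (u v : TangentSpace I x),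
    metric.inner (act g x) (mfderiv I I (act g) x u) (mfderiv I I (act g) x v) =
      metric.inner x u v
  act_orientation : ∀ (g : G) (x : M) (v : Fin k → TangentSpace I x),
    IsPositive (orientation x) v →
      IsPositive (orientation (act g x)) fun i => mfderiv I I (act g) x (v i)

/-- The bundle `SOF(M)` of oriented orthonormal frames: its points are the orientation preserving
linear isometries from `ℝ^k` to the tangent spaces of `M`. -/
structure SOF (B : OrientedRiemannianAction I M EG G k) where
  /-- the base point -/
  base : M
  /-- the frame -/
  frame : Vec k →ₗ[ℝ] TangentSpace I base
  isometry : ∀ u v, B.metric.inner base (frame u) (frame v) = inner ℝ u v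
  positive : IsPositive (B.orientation base) fun i => frame (EuclideanSpace.single i 1)

/-- The tangent vector that corresponds to `v ∈ ℝ^k` under a frame. -/
def SOF.apply {B : OrientedRiemannianAction I M EG G k} (f : SOF B) (v : Vec k) :
    TangentBundle I M := ⟨f.base, f.frame v⟩

/-- A `G`-equivariant spin^c structure on `M`: a principal `Spin^c(k)`-bundle `P → M` with an
equivariant map `P → SOF(M)` over `M` and a compatible action of `G`. A map to `SOF(M)` is smooth
if its evaluations at the vectors of `ℝ^k` are smooth maps to the tangent bundle. -/
structure EquivariantSpincStructure (B : OrientedRiemannianAction I M EG G k) (EP P : Type*)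
    [NormedAddCommGroup EP] [NormedSpace ℝ EP] [TopologicalSpace P] [ChartedSpace EP P] where
  /-- the principal right action -/
  ract : P → Spinc k → P
  ract_one : ∀ p, ract p 1 = p
  ract_mul : ∀ p x y, ract p (x * y) = ract (ract p x) y
  contMDiff_ract : ContMDiff (𝓘(ℝ, EP).prod 𝓘(ℝ, spincLie k)) 𝓘(ℝ, EP) ∞
    fun q : P × Spinc k => ract q.1 q.2
  /-- the map `P → SOF(M)` -/
  toSOF : P → SOF B
  contMDiff_toSOF : ∀ v, ContMDiff 𝓘(ℝ, EP) I.tangent ∞ fun p => (toSOF p).apply v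
  toSOF_ract : ∀ p x v, (toSOF (ract p x)).apply v = (toSOF p).apply (rot x v)
  /-- the action of `G` -/
  act : G →* Equiv.Perm P
  contMDiff_act : ContMDiff (𝓘(ℝ, EG).prod 𝓘(ℝ, EP)) 𝓘(ℝ, EP) ∞ fun q : G × P => act q.1 q.2
  act_ract : ∀ g p x, act g (ract p x) = ract (act g p) x
  toSOF_act : ∀ g p v, (toSOF (act g p)).apply v =
    tangentMap I I (B.act g) ((toSOF p).apply v)
  /-- smooth equivariant local trivializations of `P → M` -/
  locallyTrivial : ∀ x₀ : M, ∃ U : Set M, IsOpen U ∧ x₀ ∈ U ∧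
    ∃ (τ : P → Spinc k) (σ : M × Spinc k → P),
      ContMDiffOn 𝓘(ℝ, EP) 𝓘(ℝ, spincLie k) ∞ τ {p | (toSOF p).base ∈ U} ∧
      ContMDiffOn (I.prod 𝓘(ℝ, spincLie k)) 𝓘(ℝ, EP) ∞ σ (U ×ˢ Set.univ) ∧
      (∀ p, (toSOF p).base ∈ U → σ ((toSOF p).base, τ p) = p) ∧
      (∀ x ∈ U, ∀ h, (toSOF (σ (x, h))).base = x ∧ τ (σ (x, h)) = h) ∧
      ∀ p, (toSOF p).base ∈ U → ∀ h, τ (ract p h) = τ p * h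

namespace EquivariantSpincStructure

variable {B : OrientedRiemannianAction I M EG G k} (S : EquivariantSpincStructure B EP P)

/-- The projection `π : P → M`. -/
def proj (p : P) : M := (S.toSOF p).base

/-- The value at `p` of the vector field `ξ_P` generated by `ξ ∈ 𝔰𝔭𝔦𝔫^c(k)`. -/
def fundVec (p : P) (ξ : LieSpinc k) : TangentSpace 𝓘(ℝ, EP) p :=
  let v : EP := mfderiv 𝓘(ℝ, spincLie k) 𝓘(ℝ, EP) (fun h => S.ract p h) 1 ξ
  v

end EquivariantSpincStructure

/-- `(P, θ)` is a `G`-equivariant spin^c prequantization of `(M, η)`. The Lie algebra `𝔲(1)` is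
identified with `i ℝ ⊂ ℂ`. -/
structure IsSpincPrequantization {B : OrientedRiemannianAction I M EG G k}
    (S : EquivariantSpincStructure B EP P) (η : DForm I M 2 ℝ) (θ : DForm 𝓘(ℝ, EP) P 1 ℂ) :
    Prop where
  form_smooth : η.IsSmooth
  form_closed : ∀ x, η.extD x = 0
  form_invariant : ∀ (g : G) (x : M) (v : Fin 2 → TangentSpace I x),
    η (B.act g x) (fun i => mfderiv I I (B.act g) x (v i)) = η x v
  smooth : θ.IsSmooth
  imaginary : ∀ p v, (θ p v).re = 0
  act_invariant : ∀ (g : G) (p : P) (v : TangentSpace 𝓘(ℝ, EP) p),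
    θ (S.act g p) ![mfderiv 𝓘(ℝ, EP) 𝓘(ℝ, EP) (S.act g) p v] = θ p ![v]
  ract_invariant : ∀ (h : Spinc k) (p : P) (v : TangentSpace 𝓘(ℝ, EP) p),
    θ (S.ract p h) ![mfderiv 𝓘(ℝ, EP) 𝓘(ℝ, EP) (fun q => S.ract q h) p v] = θ p ![v]
  /-- `θ` is a connection form on the principal `U(1)`-bundle `P → SOF(M)` -/
  vertical : ∀ (p : P) (s : ℝ), θ p ![S.fundVec p (u1Vec k s)] = s * Complex.I
  spin_vertical : ∀ (p : P), ∀ ζ ∈ spinLie k, θ p ![S.fundVec p ζ] = 0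
  curvature : ∀ (p : P) (v : Fin 2 → TangentSpace 𝓘(ℝ, EP) p),
    θ.extD p v =
      -Complex.I * (η (S.proj p) (fun i => mfderiv 𝓘(ℝ, EP) I S.proj p (v i)) : ℝ)

end Geometry

section Product

variable {EG : Type*} [NormedAddCommGroup EG] [NormedSpace ℝ EG]
  {G : Type*} [Group G] [TopologicalSpace G] [ChartedSpace EG G]
  {E H M : Type*} [NormedAddCommGroup E] [NormedSpace ℝ E] [TopologicalSpace H]
  {I : ModelWithCorners ℝ E H} [TopologicalSpace M] [ChartedSpace H M] [IsManifold I ∞ M]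
  {E' H' N : Type*} [NormedAddCommGroup E'] [NormedSpace ℝ E'] [TopologicalSpace H']
  {J : ModelWithCorners ℝ E' H'} [TopologicalSpace N] [ChartedSpace H' N] [IsManifold J ∞ N]
  {EP P : Type*} [NormedAddCommGroup EP] [NormedSpace ℝ EP]
  [TopologicalSpace P] [ChartedSpace EP P]
  {EQ Q : Type*} [NormedAddCommGroup EQ] [NormedSpace ℝ EQ]
  [TopologicalSpace Q] [ChartedSpace EQ Q]
  {ER R : Type*} [NormedAddCommGroup ER] [NormedSpace ℝ ER]
  [TopologicalSpace R] [ChartedSpace ER R]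
  {m n : ℕ}

/-- The two-form `η ⊕ η'` on `M × N`. -/
def sumForm (η : DForm I M 2 ℝ) (η' : DForm J N 2 ℝ) : DForm (I.prod J) (M × N) 2 ℝ := fun z =>
  (η z.1).compContinuousLinearMap (ContinuousLinearMap.fst ℝ E E') +
    (η' z.2).compContinuousLinearMap (ContinuousLinearMap.snd ℝ E E')

/-- `B` is the product of two oriented Riemannian manifolds, where `g ∈ G` acts by
`(x, y) ↦ (g x, ε(g) y)`. -/
structure IsProduct (BM : OrientedRiemannianAction I M EG G m)
    (BN : OrientedRiemannianAction J N EG G n) (ε : G →* G)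
    (B : OrientedRiemannianAction (I.prod J) (M × N) EG G (m + n)) : Prop where
  act_eq : ∀ g x y, B.act g (x, y) = (BM.act g x, BN.act (ε g) y)
  metric_eq : ∀ (x : M) (y : N) (u u' : TangentSpace I x) (v v' : TangentSpace J y),
    B.metric.inner (x, y) (u, v) (u', v') = BM.metric.inner x u u' + BN.metric.inner y v v'
  orientation_eq : ∀ (x : M) (y : N) (u : Fin m → TangentSpace I x)
    (v : Fin n → TangentSpace J y), IsPositive (BM.orientation x) u →
    IsPositive (BN.orientation y) v →
    IsPositive (B.orientation (x, y))
      (Fin.append (fun i => ((u i, 0) : E × E')) (fun i => ((0, v i) : E × E')))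

variable {BM : OrientedRiemannianAction I M EG G m} {BN : OrientedRiemannianAction J N EG G n}
  (S : EquivariantSpincStructure BM EP P) (T : EquivariantSpincStructure BN EQ Q)

/-- The relation `(p, q, h) ∼ (p a, q b, (a b)⁻¹ h)` on `P_M × P_N × Spin^c(m+n)`, for
`a ∈ Spin^c(m)` and `b ∈ Spin^c(n)`. -/
def prodRel (z w : P × Q × Spinc (m + n)) : Prop :=
  ∃ (a : Spinc m) (b : Spinc n),
    w = (S.ract z.1 a, T.ract z.2.1 b, (spincMul a b)⁻¹ * z.2.2)

/-- The associated bundle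
`P_{M×N} = (P_M × P_N) ×_{Spin^c(m) × Spin^c(n)} Spin^c(m+n)`, with the quotient topology. -/
def ProdBundle : Type _ := Quot (prodRel S T)

instance : TopologicalSpace (ProdBundle S T) :=
  inferInstanceAs (TopologicalSpace (Quot (prodRel S T)))

/-- The quotient map `P_M × P_N × Spin^c(m+n) → P_{M×N}`. -/
def prodMk (z : P × Q × Spinc (m + n)) : ProdBundle S T := Quot.mk _ z

/-- `R` is the spin^c structure on `M × N` with total space `P_{M×N}` whose structure maps are
induced by those of `P_M` and `P_N`, where `g ∈ G` acts by `[p, q, h] ↦ [g p, ε(g) q, h]`. -/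
structure IsProductSpinc [ChartedSpace ER (ProdBundle S T)] (ε : G →* G)
    {B : OrientedRiemannianAction (I.prod J) (M × N) EG G (m + n)}
    (R : EquivariantSpincStructure B ER (ProdBundle S T)) : Prop where
  ract_eq : ∀ p q h x, R.ract (prodMk S T (p, q, h)) x = prodMk S T (p, q, h * x)
  act_eq : ∀ g p q h,
    R.act g (prodMk S T (p, q, h)) = prodMk S T (S.act g p, T.act (ε g) q, h)
  toSOF_eq : ∀ p q h v, (R.toSOF (prodMk S T (p, q, h))).apply v =
    ⟨(S.proj p, T.proj q), (((S.toSOF p).frame (fstVec (rot h v)),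
      (T.toSOF q).frame (sndVec (rot h v))) : E × E')⟩

end Product

end

end SpinC

open SpinC

/-! On `P_M × P_N × Spin^c(m+n)` consider the one-form `Θ = θ_M + θ_N + ½ det_* ∘ θ^L`
(`totalForm`). The bundle `P_{M×N}` is the quotient of this product by an action of `Spin^c(m) ×
Spin^c(n)`. The heart of the matter is that `Θ` is basic for this action, so that it descends; every
required property is then checked upstairs, because the quotient map `q` is a submersion.

Why `Θ` is basic: `det_*` vanishes on `𝔰𝔭𝔦𝔫(k)` and is multiplication by 2 on `𝔲(1)`, so the
conditions on a spin^c connection say that `θ(ξ_P) = ½ det_* ξ` for all `ξ`. With the invariance of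
`θ` this gives `(f·a)^*θ = f^*θ + ½ a^*(det_* ∘ θ^L)` for variable `f` in `P` and `a` in `Spin^c(k)`
(`IsSpincPrequantization.pullback_ract`). The form `det_* ∘ θ^L` is `conj(det) d(det)`, the
logarithmic derivative of a character: pulled back along a product it is a sum, along an inverse it
changes sign, and `det(ab) = det a · det b` for `a ∈ Spin^c(m)`, `b ∈ Spin^c(n)`. Hence, when `(f,
g, h)` is replaced by `(f a, g b, (ab)⁻¹ h)`, the changes of the three terms cancel
(`totalForm_pullback_torsorAct`). Since `a` and `b` may vary, this contains both the invariance of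
`Θ` and its vanishing along the orbits.

Why there is an action: vectors of `ℝ^m` and `ℝ^n` anticommute and elements of `Spin` are even, so
the two subgroups of `Spin^c(m+n)` commute and `(a, b) ↦ ab` is a homomorphism. For the same reason
`λ^c(ab) = λ^c(a) ⊕ λ^c(b)`, so `(Λ_M(p) ⊕ Λ_N(q)) ∘ λ^c(h)` depends only on `[p, q, h]`. It is an
oriented frame because `λ^c(h)` has determinant 1: a vector acts as a reflection, and spin elements
are even (`lipschitz_twisted_conj`).

Why the quotient is a manifold: equivariant fibre coordinates `τ`, `τ'` of the two bundles give the
map `(p, q, h) ↦ (x, y, τ(p) τ'(q) h)`, which is constant on the orbits, and local sections `s`,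
`s'` give its right inverse `(x, y, h) ↦ (s(x), s'(y), h)`. These trivializations have smooth
transition maps, and `q` has smooth local sections.

The conditions on the descended form: along `[p, q, h] x` only the third term moves, which yields `½
det_* ξ` on fundamental vectors. The form `det_* ∘ θ^L` is closed since `det` takes values in a
circle, so `dΘ = dθ_M + dθ_N` is the pullback of `-i(ω_M ⊕ ω_N)`. Both actions of `G` are treated
together: `g` acts on the second factor as `ε(g)` for a smooth endomorphism `ε` of `G`, the identity
in one case and trivial in the other. The invariance of `θ_N` under all of `G` covers every such
`ε`, and the form on the quotient does not depend on `ε`. -/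

namespace SpinC

noncomputable section

/-! ### Smooth dependence of the pullback of an alternating map on the linear map -/

section AlternatingPullback

variable {E F V : Type*} [NormedAddCommGroup E] [NormedSpace ℝ E] [NormedAddCommGroup F]
  [NormedSpace ℝ F] [NormedAddCommGroup V] [NormedSpace ℝ V]

/-- The sum over all permutations, as a continuous linear map. -/
def alternatizationCLM (n : ℕ) :
    ContinuousMultilinearMap ℝ (fun _ : Fin n => E) V →L[ℝ] E [⋀^Fin n]→L[ℝ] V :=
  LinearMap.mkContinuous
    { toFun := ContinuousMultilinearMap.alternatization
      map_add' := map_add _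
      map_smul' := fun r f => by
        ext v
        simp only [ContinuousMultilinearMap.alternatization_apply_apply,
          RingHom.id_apply, smul_apply]
        rw [ContinuousAlternatingMap.smul_apply,
          ContinuousMultilinearMap.alternatization_apply_apply, Finset.smul_sum]
        exact Finset.sum_congr rfl fun σ _ => smul_comm (Equiv.Perm.sign σ) r (f (v ∘ σ)) }
    -- The bound is `n!`: each of the `n!` summands has norm at most `‖f‖ ∏ ‖v i‖`.
    (Fintype.card (Equiv.Perm (Fin n))) fun f => by
      refine ContinuousAlternatingMap.opNorm_le_bound _ (mul_nonneg (Nat.cast_nonneg _) (norm_nonneg _)) fun v => ?_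
      change ‖ContinuousMultilinearMap.alternatization f v‖ ≤ _
      rw [ContinuousMultilinearMap.alternatization_apply_apply]
      refine (norm_sum_le _ _).trans ?_
      rw [← Finset.card_univ, mul_assoc, ← nsmul_eq_mul]
      refine Finset.sum_le_card_nsmul _ _ _ fun σ _ => ?_
      have h1 : ‖Equiv.Perm.sign σ • f (v ∘ σ)‖ = ‖f (v ∘ σ)‖ := by
        rcases Int.units_eq_one_or (Equiv.Perm.sign σ) with h | h <;> simp [h]
      rw [h1]
      refine (f.le_opNorm _).trans_eq ?_
      congr 1
      exact Equiv.prod_comp σ fun i => ‖v i‖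

/-- Since `f` is alternating, all `n!` signed summands equal `f (L v)`. The pullback of an
alternating map thus becomes the pullback of a multilinear map, which is smooth in `L`, followed by
a fixed continuous linear map. -/
theorem compContinuousLinearMap_eq_alternatizationCLM {n : ℕ} (f : F [⋀^Fin n]→L[ℝ] V)
    (L : E →L[ℝ] F) : f.compContinuousLinearMap L =
      ((n.factorial : ℝ)⁻¹) • alternatizationCLM n
        (f.toContinuousMultilinearMap.compContinuousLinearMap fun _ => L) := by
  ext v
  have h : alternatizationCLM n
        (f.toContinuousMultilinearMap.compContinuousLinearMap fun _ => L) v =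
      ∑ σ : Equiv.Perm (Fin n), Equiv.Perm.sign σ • f (fun i => L ((v ∘ σ) i)) :=
    ContinuousMultilinearMap.alternatization_apply_apply _ _
  have h2 : ∀ σ : Equiv.Perm (Fin n), Equiv.Perm.sign σ • f (fun i => L ((v ∘ σ) i)) =
      f (fun i => L (v i)) := by
    intro σ
    have := f.toAlternatingMap.map_perm (fun i => L (v i)) σ
    change f (fun i => L (v (σ i))) = _ at this
    simp only [Function.comp_apply]
    rw [this, smul_smul, Int.units_mul_self, one_smul]
    rfl
  rw [ContinuousAlternatingMap.smul_apply, h, Finset.sum_congr rfl fun σ _ => h2 σ,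
    Finset.sum_const, Finset.card_univ, Fintype.card_perm, Fintype.card_fin,
    ← Nat.cast_smul_eq_nsmul ℝ, smul_smul, inv_mul_cancel₀ (by positivity), one_smul]
  rfl

theorem contDiff_compContinuousLinearMap (n : ℕ) :
    ContDiff ℝ ∞ fun p : (F [⋀^Fin n]→L[ℝ] V) × (E →L[ℝ] F) =>
      p.1.compContinuousLinearMap p.2 := by
  simp only [compContinuousLinearMap_eq_alternatizationCLM]
  refine ContDiff.const_smul _ ((alternatizationCLM (E := E) (V := V) n).contDiff.comp ?_)
  have h1 : ContDiff ℝ ∞ fun p : (F [⋀^Fin n]→L[ℝ] V) × (E →L[ℝ] F) =>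
      ContinuousMultilinearMap.compContinuousLinearMapContinuousMultilinear ℝ
        (fun _ : Fin n => E) (fun _ => F) V fun _ => p.2 :=
    (ContinuousMultilinearMap.contDiff _).comp (contDiff_pi.mpr fun _ => contDiff_snd)
  have h2 : ContDiff ℝ ∞ fun f : F [⋀^Fin n]→L[ℝ] V => f.toContinuousMultilinearMap :=
    (ContinuousAlternatingMap.toContinuousMultilinearMapLI
      (𝕜 := ℝ) (E := F) (F := V) (ι := Fin n)).contDiff
  exact h1.clm_apply (h2.comp contDiff_fst)

end AlternatingPullback

/-! ### Pullback of differential forms and naturality of the exterior derivative -/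

section Pullback

variable {E H M : Type*} [NormedAddCommGroup E] [NormedSpace ℝ E] [TopologicalSpace H]
  {I : ModelWithCorners ℝ E H} [TopologicalSpace M] [ChartedSpace H M]
  {E' H' N : Type*} [NormedAddCommGroup E'] [NormedSpace ℝ E'] [TopologicalSpace H']
  {J : ModelWithCorners ℝ E' H'} [TopologicalSpace N] [ChartedSpace H' N]
  {E'' H'' K : Type*} [NormedAddCommGroup E''] [NormedSpace ℝ E''] [TopologicalSpace H'']
  {L : ModelWithCorners ℝ E'' H''} [TopologicalSpace K] [ChartedSpace H'' K]
  {F : Type*} [NormedAddCommGroup F] [NormedSpace ℝ F]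
  {V : Type*} [NormedAddCommGroup V] [NormedSpace ℝ V] {n : ℕ}

/-- The pullback of a differential form by a map. -/
def DForm.pullback (I : ModelWithCorners ℝ E H) (f : M → N) (α : DForm J N n V) :
    DForm I M n V := fun x => (α (f x)).compContinuousLinearMap (mfderiv I J f x)

theorem DForm.pullback_apply (f : M → N) (α : DForm J N n V) (x : M)
    (v : Fin n → TangentSpace I x) :
    α.pullback I f x v = α (f x) fun i => mfderiv I J f x (v i) := rfl

/-- Equal base points have distinct types of tangent spaces. Reading both alternating maps on the
model space `E'` makes it possible to replace the point and the linear map at the same time. -/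
theorem DForm.compContinuousLinearMap_congr (α : DForm J N n V) {x y : N} (h : x = y)
    {A B : F →L[ℝ] E'} (hAB : A = B) :
    (show E' [⋀^Fin n]→L[ℝ] V from α x).compContinuousLinearMap A =
      (show E' [⋀^Fin n]→L[ℝ] V from α y).compContinuousLinearMap B := by
  subst h hAB; rfl

theorem DForm.pullback_congr (α : DForm J N n V) {f g : M → N} {x : M} (h : f =ᶠ[𝓝 x] g) :
    α.pullback I f x = α.pullback I g x :=
  α.compContinuousLinearMap_congr (F := E) h.eq_of_nhds h.mfderiv_eq

theorem DForm.pullback_pullback (α : DForm L K n V) {g : N → K} {f : M → N} {x : M}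
    (hg : MDifferentiableAt J L g (f x)) (hf : MDifferentiableAt I J f x) :
    (α.pullback J g).pullback I f x = α.pullback I (g ∘ f) x := by
  exact (α.compContinuousLinearMap_congr (F := E) rfl (mfderiv_comp x hg hf)).symm

/-- A form on a vector space, as a function. -/
def DForm.onSpace (α : DForm 𝓘(ℝ, F) F n V) : F → F [⋀^Fin n]→L[ℝ] V := α

/-- The pullback of a form to a vector space, expressed in a chart of the target. -/
theorem DForm.pullback_eq_inChart [IsManifold J ∞ N] [J.Boundaryless]
    (α : DForm J N n V) {f : F → N} {y : F} (x₀ : N)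
    (hf : MDifferentiableAt 𝓘(ℝ, F) J f y) (hy : f y ∈ (extChartAt J x₀).source) :
    (α.pullback 𝓘(ℝ, F) f).onSpace y = (α.inChart x₀ (extChartAt J x₀ (f y))).compContinuousLinearMap
      (fderiv ℝ (extChartAt J x₀ ∘ f) y) := by
  have h1 : MDifferentiableAt J 𝓘(ℝ, E') (extChartAt J x₀) (f y) :=
    mdifferentiableAt_extChartAt (by rwa [← extChartAt_source J])
  have h2 : MDifferentiableAt 𝓘(ℝ, F) 𝓘(ℝ, E') (extChartAt J x₀ ∘ f) y := h1.comp y hf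
  have h3 : MDifferentiableAt 𝓘(ℝ, E') J (extChartAt J x₀).symm ((extChartAt J x₀ ∘ f) y) :=
    (contMDiffOn_extChartAt_symm (n := ∞) x₀).contMDiffAt
      (extChartAt_target_mem_nhds' ((extChartAt J x₀).map_source hy)) |>.mdifferentiableAt (by simp)
  -- The chart expression of `α` is itself the pullback by `φ⁻¹`, so the right-hand side is the
  -- pullback along `φ⁻¹ ∘ φ ∘ f`, which agrees with `f` near `y`.
  have h4 := α.pullback_pullback h3 h2
  rw [← mfderiv_eq_fderiv]
  refine Eq.trans ?_ h4.symm
  refine α.pullback_congr ?_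
  filter_upwards [hf.continuousAt.preimage_mem_nhds (extChartAt_source_mem_nhds' (I := J) hy)]
    with z hz
  exact ((extChartAt J x₀).left_inv hz).symm

variable [IsManifold J ∞ N] [J.Boundaryless]

/-- Near each point `f` stays in the domain of one chart `φ`. There the pullback is built from the
smooth chart expression of `α` and the derivative of `φ ∘ f` by an operation that is jointly smooth.
-/
theorem DForm.IsSmooth.contDiffOn_pullback {α : DForm J N n V} (hα : α.IsSmooth) {f : F → N}
    {U : Set F} (hU : IsOpen U) (hf : ContMDiffOn 𝓘(ℝ, F) J ∞ f U) :
    ContDiffOn ℝ ∞ (α.pullback 𝓘(ℝ, F) f).onSpace U := by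
  intro y₀ hy₀
  refine ContDiffAt.contDiffWithinAt ?_
  set φ := extChartAt J (f y₀)
  have hW : IsOpen (U ∩ f ⁻¹' φ.source) :=
    hf.continuousOn.isOpen_inter_preimage hU (isOpen_extChartAt_source _)
  have hyW : y₀ ∈ U ∩ f ⁻¹' φ.source := ⟨hy₀, mem_extChartAt_source _⟩
  have hg : ContDiffOn ℝ ∞ (φ ∘ f) (U ∩ f ⁻¹' φ.source) := by
    rw [← contMDiffOn_iff_contDiffOn]
    refine ContMDiffOn.comp (t := φ.source) ?_ (hf.mono Set.inter_subset_left) fun y hy => hy.2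
    rw [extChartAt_source]
    exact contMDiffOn_extChartAt
  have h1 : ContDiffOn ℝ ∞ (fun y => α.inChart (f y₀) ((φ ∘ f) y)) (U ∩ f ⁻¹' φ.source) :=
    (hα (f y₀)).comp hg fun y hy => φ.map_source hy.2
  have h2 : ContDiffOn ℝ ∞ (fderiv ℝ (φ ∘ f)) (U ∩ f ⁻¹' φ.source) :=
    hg.fderiv_of_isOpen hW (by simp)
  have h3 := (contDiff_compContinuousLinearMap n).comp_contDiffOn (h1.prodMk h2)
  refine (h3.contDiffAt (hW.mem_nhds hyW)).congr_of_eventuallyEq ?_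
  filter_upwards [hW.mem_nhds hyW] with y hy
  exact α.pullback_eq_inChart (f y₀)
    ((hf.contMDiffAt (hU.mem_nhds hy.1)).mdifferentiableAt (by simp)) hy.2

/-- Naturality of `d` on vector spaces, applied to `φ ∘ f`, where `φ` is the chart at `f y₀`: this
is the chart in which `extD` at `f y₀` is computed. -/
theorem DForm.IsSmooth.extDeriv_pullback {α : DForm J N n V} (hα : α.IsSmooth) {f : F → N}
    {U : Set F} (hU : IsOpen U) (hf : ContMDiffOn 𝓘(ℝ, F) J ∞ f U) {y₀ : F} (hy₀ : y₀ ∈ U) :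
    extDeriv (α.pullback 𝓘(ℝ, F) f).onSpace y₀ =
      (α.extD.pullback 𝓘(ℝ, F) f).onSpace y₀ := by
  set φ := extChartAt J (f y₀) with hφ
  have hW : IsOpen (U ∩ f ⁻¹' φ.source) :=
    hf.continuousOn.isOpen_inter_preimage hU (isOpen_extChartAt_source _)
  have hyW : y₀ ∈ U ∩ f ⁻¹' φ.source := ⟨hy₀, mem_extChartAt_source _⟩
  have hg : ContDiffOn ℝ ∞ (φ ∘ f) (U ∩ f ⁻¹' φ.source) := by
    rw [← contMDiffOn_iff_contDiffOn]
    refine ContMDiffOn.comp (t := φ.source) ?_ (hf.mono Set.inter_subset_left) fun y hy => hy.2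
    rw [hφ, extChartAt_source]
    exact contMDiffOn_extChartAt
  have hfd : ∀ y ∈ U, MDifferentiableAt 𝓘(ℝ, F) J f y := fun y hy =>
    (hf.contMDiffAt (hU.mem_nhds hy)).mdifferentiableAt (by simp)
  have h1 : (α.pullback 𝓘(ℝ, F) f).onSpace =ᶠ[𝓝 y₀] fun y =>
      (α.inChart (f y₀) ((φ ∘ f) y)).compContinuousLinearMap (fderiv ℝ (φ ∘ f) y) := by
    filter_upwards [hW.mem_nhds hyW] with y hy
    exact α.pullback_eq_inChart (f y₀) (hfd y hy.1) hy.2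
  have h2 : DifferentiableAt ℝ (α.inChart (f y₀)) ((φ ∘ f) y₀) :=
    ((hα (f y₀)).contDiffAt (extChartAt_target_mem_nhds _)).differentiableAt (by simp)
  rw [h1.extDeriv_eq, _root_.extDeriv_pullback h2 (hg.contDiffAt (hW.mem_nhds hyW))
    (by simpa using ENat.LEInfty.out)]
  have h3 : MDifferentiableAt J 𝓘(ℝ, E') φ (f y₀) :=
    mdifferentiableAt_extChartAt (mem_chart_source _ _)
  rw [← mfderiv_eq_fderiv, mfderiv_comp y₀ h3 (hfd y₀ hy₀)]
  rfl

section
variable [IsManifold I ∞ M] [I.Boundaryless]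

/-- A form is smooth if it is locally a pullback of a smooth form. -/
theorem DForm.isSmooth_of_locally_pullback {β : DForm I M n V}
    (h : ∀ x : M, ∃ U, IsOpen U ∧ x ∈ U ∧ ∃ (f : M → N) (α : DForm J N n V),
      α.IsSmooth ∧ ContMDiffOn I J ∞ f U ∧ ∀ y ∈ U, β y = α.pullback I f y) : β.IsSmooth := by
  intro x₀ y₀ hy₀
  set φ := extChartAt I x₀
  obtain ⟨U, hU, hxU, f, α, hα, hf, hβ⟩ := h (φ.symm y₀)
  have hW : IsOpen (φ.target ∩ φ.symm ⁻¹' U) :=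
    (continuousOn_extChartAt_symm x₀).isOpen_inter_preimage (isOpen_extChartAt_target x₀) hU
  have hs : ContMDiffOn 𝓘(ℝ, E) I ∞ φ.symm φ.target := contMDiffOn_extChartAt_symm x₀
  have hfs : ContMDiffOn 𝓘(ℝ, E) J ∞ (f ∘ φ.symm) (φ.target ∩ φ.symm ⁻¹' U) :=
    hf.comp (hs.mono Set.inter_subset_left) fun y hy => hy.2
  refine ContDiffAt.contDiffWithinAt ?_
  refine ((hα.contDiffOn_pullback hW hfs).contDiffAt
    (hW.mem_nhds ⟨hy₀, hxU⟩)).congr_of_eventuallyEq ?_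
  filter_upwards [hW.mem_nhds ⟨hy₀, hxU⟩] with y hy
  refine Eq.trans ?_ (α.pullback_pullback
    ((hf.contMDiffAt (hU.mem_nhds hy.2)).mdifferentiableAt (by simp))
    ((hs.contMDiffAt ((isOpen_extChartAt_target x₀).mem_nhds hy.1)).mdifferentiableAt (by simp)))
  rw [inChart, hβ _ hy.2]
  rfl

theorem DForm.IsSmooth.pullback {α : DForm J N n V} (hα : α.IsSmooth) {f : M → N}
    (hf : ContMDiff I J ∞ f) : (α.pullback I f).IsSmooth :=
  DForm.isSmooth_of_locally_pullback fun x =>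
    ⟨Set.univ, isOpen_univ, Set.mem_univ x, f, α, hα, hf.contMDiffOn, fun _ _ => rfl⟩

/-- At each point `extD` uses the preferred chart there. With `φ` the chart at `x`, the left-hand
side is computed from the pullback by `f ∘ φ⁻¹`, to which the statement for maps from a vector space
applies; pulling back by `φ` cancels `φ⁻¹`. -/
theorem DForm.IsSmooth.extD_pullback {α : DForm J N n V} (hα : α.IsSmooth) {f : M → N}
    (hf : ContMDiff I J ∞ f) (x : M) : (α.pullback I f).extD x = α.extD.pullback I f x := by
  set φ := extChartAt I x
  have hs : ContMDiffOn 𝓘(ℝ, E) I ∞ φ.symm φ.target := contMDiffOn_extChartAt_symm x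
  have hU := isOpen_extChartAt_target (I := I) x
  have hx : φ x ∈ φ.target := mem_extChartAt_target x
  have hd : ∀ y ∈ φ.target, MDifferentiableAt 𝓘(ℝ, E) I φ.symm y := fun y hy =>
    (hs.contMDiffAt (hU.mem_nhds hy)).mdifferentiableAt (by simp)
  have h1 : (α.pullback I f).inChart x =ᶠ[𝓝 (φ x)]
      (α.pullback 𝓘(ℝ, E) (f ∘ φ.symm)).onSpace := by
    filter_upwards [hU.mem_nhds hx] with y hy
    exact α.pullback_pullback (hf.mdifferentiable (by simp) _) (hd y hy)
  have h2 := hα.extDeriv_pullback hU (hf.comp_contMDiffOn hs) hx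
  have h3 : MDifferentiableAt I 𝓘(ℝ, E) φ x :=
    mdifferentiableAt_extChartAt (mem_chart_source _ _)
  rw [extD, h1.extDeriv_eq, h2]
  refine (α.extD.pullback_pullback (I := I) (f := φ) (g := f ∘ φ.symm) (x := x)
    ((hf.mdifferentiable (by simp) _).comp _ (hd _ hx)) h3).trans (α.extD.pullback_congr ?_)
  filter_upwards [extChartAt_source_mem_nhds (I := I) x] with y hy
  exact congrArg f (φ.left_inv hy)

end

theorem DForm.IsSmooth.add {α β : DForm I M n V} (hα : α.IsSmooth) (hβ : β.IsSmooth) :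
    DForm.IsSmooth (fun x => α x + β x) := fun x₀ => (hα x₀).add (hβ x₀)

theorem DForm.IsSmooth.const_smul {α : DForm I M n V} (hα : α.IsSmooth) (c : ℝ) :
    DForm.IsSmooth (fun x => c • α x) := fun x₀ => (hα x₀).const_smul c

theorem DForm.IsSmooth.differentiableAt_inChart [I.Boundaryless] {α : DForm I M n V} (hα : α.IsSmooth) (x : M) :
    DifferentiableAt ℝ (α.inChart x) (extChartAt I x x) :=
  ((hα x).contDiffAt (extChartAt_target_mem_nhds x)).differentiableAt (by simp)

theorem DForm.IsSmooth.extD_add [I.Boundaryless] {α β : DForm I M n V} (hα : α.IsSmooth) (hβ : β.IsSmooth)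
    (x : M) : DForm.extD (fun x => α x + β x) x = α.extD x + β.extD x := by
  have h := extDeriv_add (hα.differentiableAt_inChart x) (hβ.differentiableAt_inChart x)
  exact congrArg (fun β => ContinuousAlternatingMap.compContinuousLinearMap β
    (mfderiv I 𝓘(ℝ, E) (extChartAt I x) x)) h

theorem DForm.extD_const_smul (α : DForm I M n V) (c : ℝ) (x : M) :
    DForm.extD (fun x => c • α x) x = c • α.extD x := by
  have h := extDeriv_smul (x := extChartAt I x x) c (α.inChart x)
  exact congrArg (fun β => ContinuousAlternatingMap.compContinuousLinearMap β
    (mfderiv I 𝓘(ℝ, E) (extChartAt I x) x)) h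

end Pullback

end

noncomputable section

open CliffordAlgebra

/-! ### Algebra of `Spin^c(k)`: determinant, rotations, orientation -/

section SpincAlgebra

variable {k l : ℕ}

theorem exists_spincMk (x : Spinc k) : ∃ (A : Spin k) (z : Circle), x = spincMk A z := by
  obtain ⟨_, ⟨z, A⟩, rfl⟩ := x
  exact ⟨A, z, rfl⟩

theorem spincMk_val (A : Spin k) (z : Circle) :
    ((spincMk A z).1 : CCliff k) = (z : ℂ) • incl k (A : Cliff k) := spincHom_val z A

theorem spinc_ext {x y : Spinc k} (h : (x.1 : CCliff k) = y.1) : x = y :=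
  Subtype.ext (Units.ext h)

theorem spincMk_mul (A B : Spin k) (z w : Circle) :
    spincMk A z * spincMk B w = spincMk (A * B) (z * w) :=
  Subtype.ext (map_mul (spincHom k) (z, A) (w, B)).symm

theorem spincMk_one : spincMk (1 : Spin k) 1 = 1 := Subtype.ext (map_one (spincHom k))

theorem det_spincMk (A : Spin k) (z : Circle) : det (spincMk A z) = z ^ 2 := det_eq _ z A rfl

theorem det_mul (x y : Spinc k) : det (x * y) = det x * det y := by
  obtain ⟨A, z, rfl⟩ := exists_spincMk x
  obtain ⟨B, w, rfl⟩ := exists_spincMk y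
  rw [spincMk_mul, det_spincMk, det_spincMk, det_spincMk, mul_pow]

theorem det_one : det (1 : Spinc k) = 1 := by rw [← spincMk_one, det_spincMk, one_pow]

theorem det_inv (x : Spinc k) : det x⁻¹ = (det x)⁻¹ :=
  eq_inv_of_mul_eq_one_left (by rw [← det_mul, inv_mul_cancel, det_one])

theorem spincMap_val (f : cliffordForm k →qᵢ cliffordForm l) (x : Spinc k) :
    ((spincMap f x).1 : CCliff l) = cmap (CliffordAlgebra.map f) (x.1 : CCliff k) := rfl

theorem spincMap_mul (f : cliffordForm k →qᵢ cliffordForm l) (x y : Spinc k) :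
    spincMap f (x * y) = spincMap f x * spincMap f y :=
  spinc_ext (map_mul (cmap (CliffordAlgebra.map f)) (x.1 : CCliff k) y.1)

theorem spincMap_one (f : cliffordForm k →qᵢ cliffordForm l) : spincMap f 1 = 1 :=
  spinc_ext (map_one (cmap (CliffordAlgebra.map f)))

theorem spincMap_spincMk (f : cliffordForm k →qᵢ cliffordForm l) (A : Spin k) (z : Circle) :
    spincMap f (spincMk A z) = spincMk ⟨_, map_mem_spinGroup f A.2⟩ z :=
  spinc_ext (by rw [spincMap_val, spincMk_val, spincMk_val, map_smul, cmap_incl])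

theorem det_spincMap (f : cliffordForm k →qᵢ cliffordForm l) (x : Spinc k) :
    det (spincMap f x) = det x := by
  obtain ⟨A, z, rfl⟩ := exists_spincMk x
  rw [spincMap_spincMk, det_spincMk, det_spincMk]

theorem mul_vec (x : Spinc k) (v : Vec k) :
    (x.1 : CCliff k) * vec v = vec (rot x v) * (x.1 : CCliff k) := by
  rw [← rot_spec, mul_assoc _ _ (x.1 : CCliff k), Units.inv_mul, mul_one]

/-- Vectors embed injectively, so `x v = w x` determines `w`. Since `rot` is obtained by a choice,
all its properties are derived from this equation. -/
theorem rot_eq {x : Spinc k} {v w : Vec k}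
    (h : (x.1 : CCliff k) * vec v = vec w * (x.1 : CCliff k)) : rot x v = w :=
  vec_injective k (by rw [← rot_spec, h, mul_assoc, Units.mul_inv, mul_one])

theorem rot_mul (x y : Spinc k) (v : Vec k) : rot (x * y) v = rot x (rot y v) :=
  rot_eq (by
    change (x.1 : CCliff k) * y.1 * vec v = _ * ((x.1 : CCliff k) * y.1)
    rw [mul_assoc, mul_vec, ← mul_assoc, mul_vec, mul_assoc])

theorem rot_add (x : Spinc k) (v w : Vec k) : rot x (v + w) = rot x v + rot x w :=
  rot_eq (by rw [vec_add, vec_add, mul_add, add_mul, mul_vec, mul_vec])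

theorem rot_smul (x : Spinc k) (r : ℝ) (v : Vec k) : rot x (r • v) = r • rot x v :=
  rot_eq (by rw [vec_smul, vec_smul, mul_smul_comm, smul_mul_assoc, mul_vec])

/-- The rotation `λ^c(x)` as a linear map. -/
def rotLin (x : Spinc k) : Vec k →ₗ[ℝ] Vec k where
  toFun := rot x
  map_add' := rot_add x
  map_smul' := rot_smul x

/-- The square of a vector is the central scalar `-|v|²`, which conjugation fixes. -/
theorem inner_rot_self (x : Spinc k) (v : Vec k) : inner ℝ (rot x v) (rot x v) = inner ℝ v v := by
  have h : vec (rot x v) * vec (rot x v) * (x.1 : CCliff k) =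
      vec v * vec v * (x.1 : CCliff k) := by
    rw [mul_assoc, ← mul_vec, ← mul_assoc, ← mul_vec, mul_assoc, vec_sq, Algebra.commutes]
  have h2 := (Units.isUnit x.1).mul_right_cancel h
  rw [vec_sq, vec_sq] at h2
  exact neg_injective ((algebraMap ℝ (CCliff k)).injective h2)

theorem inner_rot (x : Spinc k) (v w : Vec k) : inner ℝ (rot x v) (rot x w) = inner ℝ v w := by
  have h1 := inner_rot_self x (v + w)
  rw [rot_add, inner_add_left, inner_add_right, inner_add_right, inner_add_left, inner_add_right,
    inner_add_right, inner_rot_self, inner_rot_self, real_inner_comm, real_inner_comm v w] at h1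
  have h2 : inner ℝ (rot x v) (rot x w) = inner ℝ (rot x w) (rot x v) := real_inner_comm _ _
  have h3 : inner ℝ v w = inner ℝ w v := real_inner_comm _ _
  linarith

/-- A nonzero vector is odd and acts by twisted conjugation as the reflection in its orthogonal
hyperplane, of determinant `-1`. Parity and determinant are both multiplicative, so they agree on
the group generated by the invertible vectors. -/
theorem lipschitz_twisted_conj (u : (Cliff k)ˣ) (hu : u ∈ lipschitzGroup (cliffordForm k)) :
    ∃ T : Vec k ≃ₗ[ℝ] Vec k, (∀ w, involute (u : Cliff k) * ι _ w = ι _ (T w) * (u : Cliff k)) ∧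
      ((involute (u : Cliff k) = u ∧ LinearMap.det (T : Vec k →ₗ[ℝ] Vec k) = 1) ∨
        (involute (u : Cliff k) = -u ∧ LinearMap.det (T : Vec k →ₗ[ℝ] Vec k) = -1)) := by
  induction hu using Subgroup.closure_induction with
  | mem u hu =>
    obtain ⟨a, ha⟩ := hu
    have ha0 : a ≠ 0 := by
      rintro rfl
      rw [map_zero] at ha
      exact u.ne_zero ha.symm
    refine ⟨(Submodule.reflection (ℝ ∙ a)ᗮ).toLinearEquiv, fun w => ?_, Or.inr ⟨?_, ?_⟩⟩
    · have hs : ι (cliffordForm k) a * ι _ w =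
          algebraMap ℝ _ (-(2 * inner ℝ a w)) - ι _ w * ι _ a := by
        rw [← cliffordForm_polar, ← ι_mul_ι_add_swap, add_sub_cancel_right]
      have hr : Submodule.reflection (ℝ ∙ a)ᗮ w = w - (2 * (inner ℝ a w / ‖a‖ ^ 2)) • a := by
        rw [Submodule.reflection_orthogonal_apply, Submodule.reflection_singleton_apply]
        simp [mul_smul, two_smul]
      rw [← ha, involute_ι, neg_mul, hs]
      change _ = ι _ (Submodule.reflection (ℝ ∙ a)ᗮ w) * _
      have hc : 2 * (inner ℝ a w / ‖a‖ ^ 2) * -‖a‖ ^ 2 = -(2 * inner ℝ a w) := by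
        have := norm_ne_zero_iff.mpr ha0
        field_simp
      rw [hr, map_sub, map_smul, sub_mul, smul_mul_assoc, ι_sq_scalar, cliffordForm_apply,
        real_inner_self_eq_norm_sq, Algebra.smul_def, ← map_mul (algebraMap ℝ (Cliff k)), hc, neg_sub]
    · rw [← ha, involute_ι]
    · refine (Submodule.det_reflection _).trans ?_
      rw [Submodule.orthogonal_orthogonal, finrank_span_singleton ha0, pow_one]
  | one => exact ⟨LinearEquiv.refl ℝ _, by simp, Or.inl (by simp)⟩
  | mul u v _ _ hu hv =>
    obtain ⟨T, hT, hT'⟩ := hu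
    obtain ⟨S, hS, hS'⟩ := hv
    refine ⟨S.trans T, fun w => ?_, ?_⟩
    · rw [Units.val_mul, map_mul, mul_assoc, hS, ← mul_assoc, hT, mul_assoc]
      rfl
    · have hd : LinearMap.det ((S.trans T : Vec k ≃ₗ[ℝ] Vec k) : Vec k →ₗ[ℝ] Vec k) =
          LinearMap.det (T : Vec k →ₗ[ℝ] Vec k) * LinearMap.det (S : Vec k →ₗ[ℝ] Vec k) := by
        rw [← LinearMap.det_comp]; rfl
      rw [hd, Units.val_mul, map_mul]
      rcases hT' with ⟨h1, h2⟩ | ⟨h1, h2⟩ <;> rcases hS' with ⟨h3, h4⟩ | ⟨h3, h4⟩ <;>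
        rw [h1, h2, h3, h4] <;> simp
  | inv u _ hu =>
    obtain ⟨T, hT, hT'⟩ := hu
    have hi : involute (↑u⁻¹ : Cliff k) * involute (u : Cliff k) = 1 := by
      rw [← map_mul, Units.inv_mul, map_one]
    have eq_inv_of_mul : ∀ {y : Cliff k}, y * u = 1 → y = ↑u⁻¹ := fun {y} h => by
      rw [← mul_one y, ← u.mul_inv, ← mul_assoc, h, one_mul]
    refine ⟨T.symm, fun w => ?_, ?_⟩
    · have h1 := hT (T.symm w)
      rw [LinearEquiv.apply_symm_apply] at h1
      calc involute (↑u⁻¹ : Cliff k) * ι _ w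
          = involute (↑u⁻¹ : Cliff k) * (ι _ w * (u : Cliff k)) * (↑u⁻¹ : Cliff k) := by
            rw [mul_assoc, mul_assoc, Units.mul_inv, mul_one]
        _ = _ := by rw [← h1, ← mul_assoc, hi, one_mul]
    · have hd := T.det_symm_mul_det
      rcases hT' with ⟨h1, h2⟩ | ⟨h1, h2⟩
      · left
        rw [h2, mul_one] at hd
        rw [h1] at hi
        exact ⟨eq_inv_of_mul hi, hd⟩
      · right
        rw [h2] at hd
        rw [h1, mul_neg, ← neg_mul] at hi
        refine ⟨neg_eq_iff_eq_neg.mp (eq_inv_of_mul hi), by linarith⟩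

/-- For an even element the twisted conjugation is the ordinary one, and the sign attached to an
even element is `+1`. This is why `λ^c` preserves the orientation of frames. -/
theorem det_rotLin (x : Spinc k) : LinearMap.det (rotLin x) = 1 := by
  obtain ⟨A, z, rfl⟩ := exists_spincMk x
  obtain ⟨u, hu, huA⟩ := pinGroup.mem_lipschitzGroup (spinGroup.mem_pin A.2)
  obtain ⟨T, hT, hT'⟩ := lipschitz_twisted_conj u hu
  have hinv : involute (u : Cliff k) = u := by
    have := spinGroup.involute_eq A.2
    rwa [← huA] at this
  have h1 : LinearMap.det (T : Vec k →ₗ[ℝ] Vec k) = 1 := by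
    rcases hT' with h | h
    · exact h.2
    -- An element that is both even and odd satisfies `2u = 0`, which is impossible for a unit.
    · exfalso
      have h2 : (2 : ℝ) • (u : Cliff k) = 0 := by
        rw [two_smul]; nth_rw 1 [← hinv, h.1]; simp
      exact u.ne_zero ((smul_eq_zero.mp h2).resolve_left two_ne_zero)
  have h2 : rotLin (spincMk A z) = (T : Vec k →ₗ[ℝ] Vec k) := by
    ext1 v
    refine rot_eq ?_
    have h3 := congrArg (incl k) (hT v)
    rw [hinv, map_mul, map_mul] at h3
    have h4 : (u : Cliff k) = (A : Cliff k) := huA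
    rw [h4] at h3
    rw [spincMk_val, smul_mul_assoc, mul_smul_comm]
    exact congrArg _ h3
  rw [h2, h1]

/-! ### The commuting subgroups `Spin^c(m)` and `Spin^c(n)` of `Spin^c(m+n)` -/

section Sum

variable {m n : ℕ}

theorem inlVec_apply (v : Vec m) : inlVec m n v = WithLp.toLp 2 (Fin.append v 0) := rfl

theorem inrVec_apply (v : Vec n) : inrVec m n v = WithLp.toLp 2 (Fin.append 0 v) := rfl

theorem inner_inlVec_inrVec (v : Vec m) (w : Vec n) :
    inner ℝ (inlVec m n v) (inrVec m n w) = 0 := by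
  rw [PiLp.inner_apply, Fin.sum_univ_add]
  simp [inlVec_apply, inrVec_apply]

/-- Vectors of the two orthogonal summands anticommute, so moving a vector past a product of `r`
vectors costs the sign `(-1)^r`, which is what `involute` records. -/
theorem map_inr_mul_ι_inl (x : Cliff n) (v : Vec m) :
    CliffordAlgebra.map (inrVec m n) x * ι _ (inlVec m n v) =
      ι _ (inlVec m n v) * CliffordAlgebra.map (inrVec m n) (involute x) := by
  induction x using CliffordAlgebra.induction with
  | algebraMap r => rw [involute.commutes, AlgHom.commutes, Algebra.commutes]
  | ι w =>
    have h : ι (cliffordForm (m + n)) (inrVec m n w) * ι _ (inlVec m n v) =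
        -(ι _ (inlVec m n v) * ι _ (inrVec m n w)) := by
      refine eq_neg_of_add_eq_zero_left ?_
      rw [ι_mul_ι_add_swap, cliffordForm_polar, real_inner_comm, inner_inlVec_inrVec]
      simp
    rw [involute_ι, map_neg, map_apply_ι, h, mul_neg]
  | mul a b ha hb => rw [map_mul, map_mul, map_mul, mul_assoc, hb, ← mul_assoc, ha, mul_assoc]
  | add a b ha hb => rw [map_add, map_add, map_add, add_mul, mul_add, ha, hb]

theorem map_inr_comm_map_inl {x : Cliff n} (hx : involute x = x) (y : Cliff m) :
    CliffordAlgebra.map (inrVec m n) x * CliffordAlgebra.map (inlVec m n) y =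
      CliffordAlgebra.map (inlVec m n) y * CliffordAlgebra.map (inrVec m n) x := by
  induction y using CliffordAlgebra.induction with
  | algebraMap r => rw [AlgHom.commutes, Algebra.commutes]
  | ι w => rw [map_apply_ι, map_inr_mul_ι_inl, hx]
  | mul a b ha hb => rw [map_mul, ← mul_assoc, ha, mul_assoc, hb, mul_assoc]
  | add a b ha hb => rw [map_add, add_mul, mul_add, ha, hb]

theorem map_inl_mul_ι_inr {x : Cliff m} (hx : involute x = x) (v : Vec n) :
    CliffordAlgebra.map (inlVec m n) x * ι _ (inrVec m n v) =
      ι _ (inrVec m n v) * CliffordAlgebra.map (inlVec m n) x := by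
  have key : ∀ x : Cliff m, CliffordAlgebra.map (inlVec m n) x * ι _ (inrVec m n v) =
      ι _ (inrVec m n v) * CliffordAlgebra.map (inlVec m n) (involute x) := by
    intro x
    induction x using CliffordAlgebra.induction with
    | algebraMap r => rw [involute.commutes, AlgHom.commutes, Algebra.commutes]
    | ι w =>
      have h : ι (cliffordForm (m + n)) (inlVec m n w) * ι _ (inrVec m n v) =
          -(ι _ (inrVec m n v) * ι _ (inlVec m n w)) := by
        refine eq_neg_of_add_eq_zero_left ?_
        rw [ι_mul_ι_add_swap, cliffordForm_polar, inner_inlVec_inrVec]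
        simp
      rw [involute_ι, map_neg, map_apply_ι, h, mul_neg]
    | mul a b ha hb => rw [map_mul, map_mul, map_mul, mul_assoc, hb, ← mul_assoc, ha, mul_assoc]
    | add a b ha hb => rw [map_add, map_add, map_add, add_mul, mul_add, ha, hb]
  rw [key, hx]

/-- The spin part of `x` is even, so it passes each vector of `ℝ^m` without a sign, and the phases
are central. -/
theorem spincMap_inr_comm_inl (x : Spinc n) (y : Spinc m) :
    spincMap (inrVec m n) x * spincMap (inlVec m n) y =
      spincMap (inlVec m n) y * spincMap (inrVec m n) x := by
  obtain ⟨A, z, rfl⟩ := exists_spincMk x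
  obtain ⟨B, w, rfl⟩ := exists_spincMk y
  rw [spincMap_spincMk, spincMap_spincMk, spincMk_mul, spincMk_mul, mul_comm z w]
  congr 1
  exact Subtype.ext (map_inr_comm_map_inl (spinGroup.involute_eq A.2) _)

/-- The two subgroups commute. Thus `(a, b) ↦ ab` is a homomorphism, and the relation that defines
the product bundle is the orbit relation of a group action. -/
theorem spincMul_mul (a a' : Spinc m) (b b' : Spinc n) :
    spincMul (a * a') (b * b') = spincMul a b * spincMul a' b' := by
  rw [spincMul, spincMul, spincMul, spincMap_mul, spincMap_mul, mul_assoc, mul_assoc,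
    ← mul_assoc (spincMap (inrVec m n) b), spincMap_inr_comm_inl, mul_assoc]

theorem spincMul_one : spincMul (1 : Spinc m) (1 : Spinc n) = 1 := by
  rw [spincMul, spincMap_one, spincMap_one, one_mul]

theorem rot_spincMap (f : cliffordForm k →qᵢ cliffordForm l) (x : Spinc k) (v : Vec k) :
    rot (spincMap f x) (f v) = f (rot x v) := by
  refine rot_eq ?_
  have h : ∀ v : Vec k, vec (f v) = cmap (CliffordAlgebra.map f) (vec v) := fun v => by
    rw [vec, vec, cmap_incl, map_apply_ι]
  rw [spincMap_val, h, h, ← map_mul, ← map_mul, mul_vec]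

theorem rot_inl_inr (a : Spinc m) (w : Vec n) :
    rot (spincMap (inlVec m n) a) (inrVec m n w) = inrVec m n w := by
  obtain ⟨A, z, rfl⟩ := exists_spincMk a
  refine rot_eq ?_
  rw [spincMap_spincMk, spincMk_val, smul_mul_assoc, mul_smul_comm, vec, ← map_mul, ← map_mul]
  congr 2
  exact map_inl_mul_ι_inr (spinGroup.involute_eq A.2) w

theorem rot_inr_inl (b : Spinc n) (v : Vec m) :
    rot (spincMap (inrVec m n) b) (inlVec m n v) = inlVec m n v := by
  obtain ⟨B, z, rfl⟩ := exists_spincMk b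
  refine rot_eq ?_
  rw [spincMap_spincMk, spincMk_val, smul_mul_assoc, mul_smul_comm, vec, ← map_mul, ← map_mul]
  congr 2
  exact (map_inr_mul_ι_inl _ v).trans (by rw [spinGroup.involute_eq B.2])

theorem inl_fst_add_inr_snd (v : Vec (m + n)) :
    inlVec m n (fstVec v) + inrVec m n (sndVec v) = v := by
  ext i
  refine Fin.addCases (fun i => ?_) (fun i => ?_) i <;> simp [inlVec_apply, inrVec_apply, fstVec, sndVec]

theorem fstVec_add_inl_inr (v : Vec m) (w : Vec n) :
    fstVec (inlVec m n v + inrVec m n w) = v := by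
  ext i; simp [inlVec_apply, inrVec_apply, fstVec]

theorem sndVec_add_inl_inr (v : Vec m) (w : Vec n) :
    sndVec (inlVec m n v + inrVec m n w) = w := by
  ext i; simp [inlVec_apply, inrVec_apply, sndVec]

/-- Each factor rotates its own summand and fixes the other pointwise, so `λ^c(ab)` is block
diagonal. This lets direct sums of frames descend to the quotient. -/
theorem rot_spincMul (a : Spinc m) (b : Spinc n) (v : Vec (m + n)) :
    rot (spincMul a b) v = inlVec m n (rot a (fstVec v)) + inrVec m n (rot b (sndVec v)) := by
  conv_lhs => rw [← inl_fst_add_inr_snd v]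
  rw [rot_add, spincMul, rot_mul, rot_mul, rot_inr_inl, rot_spincMap, rot_spincMap, rot_inl_inr]

theorem fstVec_rot_spincMul (a : Spinc m) (b : Spinc n) (v : Vec (m + n)) :
    fstVec (rot (spincMul a b) v) = rot a (fstVec v) := by
  rw [rot_spincMul, fstVec_add_inl_inr]

theorem sndVec_rot_spincMul (a : Spinc m) (b : Spinc n) (v : Vec (m + n)) :
    sndVec (rot (spincMul a b) v) = rot b (sndVec v) := by
  rw [rot_spincMul, sndVec_add_inl_inr]

theorem inner_fstVec_add_inner_sndVec (v w : Vec (m + n)) :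
    inner ℝ (fstVec v) (fstVec w) + inner ℝ (sndVec v) (sndVec w) = inner ℝ v w := by
  rw [PiLp.inner_apply, PiLp.inner_apply, PiLp.inner_apply, Fin.sum_univ_add]
  rfl

end Sum

end SpincAlgebra

end

noncomputable section

open CliffordAlgebra
open NormedSpace (exp)

/-! ### Smoothness of the structure maps and the splitting of the Lie algebra -/

section SpincSmooth

variable {k l m n : ℕ}
  {E H M : Type*} [NormedAddCommGroup E] [NormedSpace ℝ E] [TopologicalSpace H]
  {I : ModelWithCorners ℝ E H} [TopologicalSpace M] [ChartedSpace H M]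

theorem contMDiff_spinc_val (k : ℕ) : ContMDiff 𝓘(ℝ, spincLie k) 𝓘(ℝ, CCliff k) ∞
    fun x : Spinc k => (x.1 : CCliff k) :=
  (isLieSubgroup_spinc k).contMDiff_val

theorem contMDiff_spinc_of_val {f : M → Spinc k}
    (hf : ContMDiff I 𝓘(ℝ, CCliff k) ∞ fun x => ((f x).1 : CCliff k)) :
    ContMDiff I 𝓘(ℝ, spincLie k) ∞ f :=
  (isLieSubgroup_spinc k).contMDiff_of_val hf

theorem contDiff_of_linear {F : Type*} [NormedAddCommGroup F] [NormedSpace ℝ F]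
    (f : CCliff k →ₗ[ℝ] F) : ContDiff ℝ ∞ f :=
  (f.toContinuousLinearMap).contDiff

/-- The product of the reverse of `zA` with `zA` is the scalar `z²`, because `reverse(A) A = 1` for
spin elements; `φ` is a left inverse of the inclusion of scalars. This replaces the choice in the
definition of `det` by a formula that is polynomial in `x`. -/
theorem exists_det_eq (k : ℕ) : ∃ φ : CCliff k →ₗ[ℝ] ℂ, ∀ x : Spinc k,
    (det x : ℂ) = φ (clift reverse (x.1 : CCliff k) * (x.1 : CCliff k)) := by
  obtain ⟨φ, hφ⟩ := (Algebra.linearMap ℂ (CCliff k)).exists_leftInverse_of_injective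
    (LinearMap.ker_eq_bot.mpr (algebraMap ℂ (CCliff k)).injective)
  refine ⟨φ.restrictScalars ℝ, fun x => ?_⟩
  obtain ⟨A, z, rfl⟩ := exists_spincMk x
  rw [spincMk_val, clift_smul_incl, smul_mul_smul_comm, ← map_mul, reverse_mul_self, map_one,
    ← Algebra.algebraMap_eq_smul_one, det_spincMk]
  refine Eq.trans ?_ (LinearMap.congr_fun hφ ((z : ℂ) * z)).symm
  rw [Circle.coe_pow, sq]
  rfl

theorem contMDiff_det (k : ℕ) :
    ContMDiff 𝓘(ℝ, spincLie k) 𝓘(ℝ, ℂ) ∞ fun x : Spinc k => (det x : ℂ) := by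
  obtain ⟨φ, hφ⟩ := exists_det_eq k
  simp only [hφ]
  have h1 : ContDiff ℝ ∞ fun x : CCliff k => φ (clift reverse x * x) :=
    (contDiff_of_linear φ).comp
      ((contDiff_of_linear ((clift reverse).restrictScalars ℝ)).mul contDiff_id)
  exact h1.contMDiff.comp (contMDiff_spinc_val k)

theorem contMDiff_spincMap (f : cliffordForm k →qᵢ cliffordForm l) :
    ContMDiff 𝓘(ℝ, spincLie k) 𝓘(ℝ, spincLie l) ∞ (spincMap f) := by
  refine contMDiff_spinc_of_val ?_
  exact (contDiff_of_linear ((cmap (CliffordAlgebra.map f)).toLinearMap.restrictScalars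
    ℝ)).contMDiff.comp (contMDiff_spinc_val k)

theorem contMDiff_spincMul : ContMDiff (𝓘(ℝ, spincLie m).prod 𝓘(ℝ, spincLie n))
    𝓘(ℝ, spincLie (m + n)) ∞ fun p : Spinc m × Spinc n => spincMul p.1 p.2 :=
  ((contMDiff_spincMap _).comp contMDiff_fst).mul ((contMDiff_spincMap _).comp contMDiff_snd)

/-- A linear left inverse of the inclusion of vectors recovers `rot x v` from `x v x⁻¹`, an
expression that is visibly smooth in `x`. -/
theorem contMDiff_rot (v : Vec k) :
    ContMDiff 𝓘(ℝ, spincLie k) 𝓘(ℝ, Vec k) ∞ fun x : Spinc k => rot x v := by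
  let j : Vec k →ₗ[ℝ] CCliff k :=
    { toFun := vec, map_add' := vec_add, map_smul' := vec_smul }
  obtain ⟨φ, hφ⟩ := j.exists_leftInverse_of_injective
    (LinearMap.ker_eq_bot.mpr (vec_injective k))
  have h1 : ∀ x : Spinc k, rot x v =
      φ ((x.1 : CCliff k) * vec v * ((x⁻¹).1 : CCliff k)) := by
    intro x
    refine (LinearMap.congr_fun hφ (rot x v)).symm.trans (congrArg φ ?_)
    exact (rot_spec x v).symm
  simp only [h1]
  have h2 : ContDiff ℝ ∞ fun p : CCliff k × CCliff k => φ (p.1 * vec v * p.2) :=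
    (contDiff_of_linear φ).comp ((contDiff_fst.mul contDiff_const).mul contDiff_snd)
  exact h2.contMDiff.comp ((contMDiff_spinc_val k).prodMk_space
    ((contMDiff_spinc_val k).comp (contMDiff_inv _ _)))

/-- The one-parameter subgroup with velocity `a`. -/
def expCurve (a : spincLie k) (t : ℝ) : Spinc k :=
  ⟨expUnit ((t • a : spincLie k) : CCliff k), (isLieSubgroup_spinc k).expUnit_mem _ (t • a).2⟩

theorem expCurve_val (a : spincLie k) (t : ℝ) :
    ((expCurve a t).1 : CCliff k) = exp (t • (a : CCliff k)) := rfl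

theorem expCurve_zero (a : spincLie k) : expCurve a 0 = 1 :=
  spinc_ext (by rw [expCurve_val, zero_smul, NormedSpace.exp_zero]; rfl)

theorem expCurve_add (a : spincLie k) (s t : ℝ) :
    expCurve a (s + t) = expCurve a s * expCurve a t := by
  let _ : NormedAlgebra ℚ (CCliff k) := .restrictScalars ℚ ℝ _
  refine spinc_ext ?_
  rw [expCurve_val, add_smul, NormedSpace.exp_add_of_commute
    (((Commute.refl (a : CCliff k)).smul_left s).smul_right t)]
  rfl

theorem contMDiff_expCurve (a : spincLie k) :
    ContMDiff 𝓘(ℝ, ℝ) 𝓘(ℝ, spincLie k) ∞ (expCurve a) :=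
  contMDiff_spinc_of_val
    (contDiff_exp'.comp (contDiff_id.smul contDiff_const)).contMDiff

/-- The chart at 1 is the logarithm, in which the curve is `t ↦ t a` for small `t`. So every element
of the Lie algebra is the velocity of an explicit one-parameter group. -/
theorem velocity_expCurve (a : spincLie k) : velocity (expCurve a) = a := by
  have h1 : HasMFDerivAt 𝓘(ℝ, ℝ) 𝓘(ℝ, spincLie k) (expCurve a) 0
      (ContinuousLinearMap.toSpanSingleton ℝ a : ℝ →L[ℝ] spincLie k) := by
    refine ⟨(contMDiff_expCurve a).continuous.continuousAt, HasFDerivAt.hasFDerivWithinAt ?_⟩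
    have h2 : HasFDerivAt (fun t : ℝ => t • a)
        (ContinuousLinearMap.toSpanSingleton ℝ a : ℝ →L[ℝ] spincLie k) 0 :=
      (ContinuousLinearMap.toSpanSingleton ℝ a).hasFDerivAt
    refine h2.congr_of_eventuallyEq ?_
    have h3 : ∀ᶠ t : ℝ in 𝓝 0, t • (a : CCliff k) ∈ (isLieSubgroup_spinc k).log.source := by
      refine (continuous_id.smul continuous_const).continuousAt.preimage_mem_nhds ?_
      refine (isLieSubgroup_spinc k).log.open_source.mem_nhds ?_
      simpa using (isLieSubgroup_spinc k).log_spec.1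
    filter_upwards [h3] with t ht
    change (isLieSubgroup_spinc k).chart (expCurve a 0) (expCurve a t) = t • a
    rw [IsLieSubgroup.chart_apply, expCurve_zero, inv_one]
    change proj _ ((isLieSubgroup_spinc k).log.symm (1 * exp (t • (a : CCliff k)))) = _
    rw [one_mul, ← (isLieSubgroup_spinc k).log_spec.2.1, (isLieSubgroup_spinc k).log.left_inv ht]
    exact proj_coe _ (t • a)
  rw [velocity, h1.mfderiv]
  exact one_smul ℝ a

theorem hasDerivAt_det_curve {γ : ℝ → Spinc k} (hγ : ContMDiff 𝓘(ℝ, ℝ) 𝓘(ℝ, spincLie k) ∞ γ)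
    (h0 : γ 0 = 1) : HasDerivAt (fun t => (det (γ t) : ℂ)) (detStar (velocity γ)) 0 := by
  have h1 : HasMFDerivAt 𝓘(ℝ, spincLie k) 𝓘(ℝ, ℂ) (fun x : Spinc k => (det x : ℂ)) (γ 0)
      (mfderiv 𝓘(ℝ, spincLie k) 𝓘(ℝ, ℂ) (fun x : Spinc k => (det x : ℂ)) 1) := by
    rw [h0]
    exact ((contMDiff_det k).mdifferentiable (by simp) 1).hasMFDerivAt
  have h2 := h1.comp (0 : ℝ) (hγ.mdifferentiable (by simp) 0).hasMFDerivAt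
  exact HasFDerivAt.hasDerivAt (𝕜 := ℝ) (F := ℂ) (hasMFDerivAt_iff_hasFDerivAt.mp h2)

theorem detStar_add (ξ η : LieSpinc k) : detStar (ξ + η) = detStar ξ + detStar η :=
  map_add (mfderiv 𝓘(ℝ, spincLie k) 𝓘(ℝ, ℂ) (fun x : Spinc k => (det x : ℂ)) 1) ξ η

/-- The determinant has modulus one along the one-parameter group of `ξ`, so the derivative of
`|det|²` at time 0, which is `2 Re(det_* ξ)`, vanishes. -/
theorem detStar_re (ξ : spincLie k) : (detStar (k := k) ξ).re = 0 := by
  have h1 := hasDerivAt_det_curve (contMDiff_expCurve ξ) (expCurve_zero ξ)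
  rw [velocity_expCurve] at h1
  have h2 := h1.norm_sq
  have h3 : (fun t => ‖(det (expCurve ξ t) : ℂ)‖ ^ 2) = fun _ => (1 : ℝ) := by
    funext t; rw [Circle.norm_coe, one_pow]
  rw [h3] at h2
  have h4 := h2.unique (hasDerivAt_const (0 : ℝ) (1 : ℝ))
  rw [expCurve_zero, det_one, Complex.inner] at h4
  simpa using h4

theorem contMDiff_u1Curve (s : ℝ) : ContMDiff 𝓘(ℝ, ℝ) 𝓘(ℝ, spincLie k) ∞
    fun t : ℝ => (spincMk 1 (Circle.exp (s * t)) : Spinc k) := by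
  refine contMDiff_spinc_of_val ?_
  have h1 : ∀ t : ℝ, ((spincMk (1 : Spin k) (Circle.exp (s * t))).1 : CCliff k) =
      Complex.exp ((s * t : ℝ) * Complex.I) • (1 : CCliff k) := by
    intro t
    rw [spincMk_val, Circle.coe_exp]
    congr 1
  simp only [h1]
  let φ : ℂ →ₗ[ℝ] CCliff k := (Algebra.linearMap ℂ (CCliff k)).restrictScalars ℝ
  have h2 : ∀ z : ℂ, z • (1 : CCliff k) = φ.toContinuousLinearMap z := fun z =>
    (Algebra.algebraMap_eq_smul_one z).symm
  simp only [h2]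
  refine ContDiff.contMDiff (φ.toContinuousLinearMap.contDiff.comp ?_)
  exact Complex.contDiff_exp.comp ((Complex.ofRealCLM.contDiff.comp
    (contDiff_const.mul contDiff_id)).mul contDiff_const)

/-- Along this curve the determinant is `z² = e^{2ist}`. The factor 2 is the reason for the factor
`½` in front of `det_* ∘ θ^L`. -/
theorem detStar_u1Vec (s : ℝ) : detStar (u1Vec k s) = 2 * s * Complex.I := by
  have h0 : (spincMk 1 (Circle.exp (s * 0)) : Spinc k) = 1 := by
    rw [mul_zero, Circle.exp_zero, spincMk_one]
  have h1 := hasDerivAt_det_curve (contMDiff_u1Curve (k := k) s) h0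
  have h2 : (fun t : ℝ => (det (spincMk (1 : Spin k) (Circle.exp (s * t))) : ℂ)) =
      fun t : ℝ => Complex.exp ((2 * s * Complex.I) * (t : ℂ)) := by
    funext t
    rw [det_spincMk, Circle.coe_pow, Circle.coe_exp, ← Complex.exp_nat_mul]
    congr 1
    push_cast
    ring_nf
  have h3 : HasDerivAt (fun t : ℝ => Complex.exp ((2 * s * Complex.I) * (t : ℂ)))
      (2 * s * Complex.I) 0 := by
    have h4 := (((hasDerivAt_id (0 : ℝ)).ofReal_comp).const_mul (2 * s * Complex.I)).cexp
    simpa using h4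
  rw [h2] at h1
  exact h1.unique h3

theorem detStar_of_mem_spinLie {ζ : LieSpinc k} (hζ : ζ ∈ spinLie k) : detStar ζ = 0 := by
  obtain ⟨γ, hγ, h0, hA, rfl⟩ := hζ
  have h1 := hasDerivAt_det_curve hγ h0
  have h2 : (fun t => (det (γ t) : ℂ)) = fun _ => (1 : ℂ) := by
    funext t
    obtain ⟨A, hA⟩ := hA t
    rw [hA, det_spincMk]
    simp
  rw [h2] at h1
  exact h1.unique (hasDerivAt_const (0 : ℝ) (1 : ℂ))

/-- The function `t ↦ det(exp(tζ))` is multiplicative, so its derivative at any `s` is its value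
there times its derivative at 0, which is zero. -/
theorem det_expCurve_of_detStar {ζ : spincLie k} (hζ : detStar (k := k) ζ = 0) (t : ℝ) :
    det (expCurve ζ t) = 1 := by
  have h1 := hasDerivAt_det_curve (contMDiff_expCurve ζ) (expCurve_zero ζ)
  rw [velocity_expCurve, hζ] at h1
  have h2 : ∀ s : ℝ, HasDerivAt (fun t => (det (expCurve ζ t) : ℂ)) 0 s := by
    intro s
    have h3 : (fun t => (det (expCurve ζ t) : ℂ)) = fun t =>
        (det (expCurve ζ s) : ℂ) * (det (expCurve ζ (t - s)) : ℂ) := by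
      funext t
      rw [← Circle.coe_mul, ← det_mul, ← expCurve_add, add_sub_cancel]
    rw [h3]
    have h4 : HasDerivAt (fun t => (det (expCurve ζ (t - s)) : ℂ)) 0 s := by
      have h5 : HasDerivAt (fun t => (det (expCurve ζ t) : ℂ)) 0 (s - s) := by rwa [sub_self]
      exact h5.comp_sub_const s s
    simpa using h4.const_mul (det (expCurve ζ s) : ℂ)
  have h3 := is_const_of_deriv_eq_zero (fun s => (h2 s).differentiableAt)
    (fun s => (h2 s).deriv) t 0
  rw [expCurve_zero, det_one] at h3
  exact Circle.ext h3

theorem mem_spinLie_of_detStar {ζ : spincLie k} (hζ : detStar (k := k) ζ = 0) : ζ ∈ spinLie k := by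
  refine ⟨expCurve ζ, contMDiff_expCurve ζ, expCurve_zero ζ, fun t => ?_, velocity_expCurve ζ⟩
  -- The representative `[A, z]` of the element at time `t/2` has `z² = 1`. Its square is therefore
  -- `[A², 1]`, which lies in `Spin(k)` whatever the sign of `z`.
  have h1 : expCurve ζ t = expCurve ζ (t / 2) * expCurve ζ (t / 2) := by
    rw [← expCurve_add, add_halves]
  obtain ⟨A, z, hz⟩ := exists_spincMk (expCurve ζ (t / 2))
  have h2 := det_expCurve_of_detStar hζ (t / 2)
  rw [hz, det_spincMk, sq] at h2
  exact ⟨A * A, by rw [h1, hz, spincMk_mul, h2]⟩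

/-- `𝔰𝔭𝔦𝔫^c(k) = 𝔰𝔭𝔦𝔫(k) ⊕ 𝔲(1)`. -/
theorem exists_spinLie_add_u1Vec (ξ : LieSpinc k) : ∃ ζ ∈ spinLie k, ∃ s : ℝ,
    ξ = ζ + u1Vec k s ∧ detStar ξ = 2 * s * Complex.I := by
  -- As `det_* ξ` is imaginary and `det_*` doubles elements of `𝔲(1)`, the `𝔲(1)`-component has to
  -- be half the imaginary part.
  have hs : detStar ξ = 2 * ((detStar ξ).im / 2 : ℝ) * Complex.I := by
    have hre : (detStar ξ).re = 0 := detStar_re ξ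
    apply Complex.ext
    · simpa using hre
    · simp only [Complex.mul_im, Complex.mul_re, Complex.ofReal_re, Complex.ofReal_im, Complex.I_re,
        Complex.I_im, Complex.re_ofNat, Complex.im_ofNat]
      ring
  refine ⟨ξ - u1Vec k ((detStar ξ).im / 2), mem_spinLie_of_detStar ?_, _,
    (sub_add_cancel _ _).symm, hs⟩
  have h1 := detStar_add (ξ - u1Vec k ((detStar ξ).im / 2)) (u1Vec k ((detStar ξ).im / 2))
  rw [sub_add_cancel, detStar_u1Vec, ← hs] at h1
  exact left_eq_add.mp (h1.trans (add_comm _ _))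

end SpincSmooth

/-! ### The closed form `det_* ∘ θ^L` as a pullback from `ℂ` -/

section DetForm

variable {k : ℕ}

/-- Differentiate `det(h⁻¹x) = conj(det h) · det x` at `x = h`; the inverse of `det h` is its
conjugate. It follows that `det_* ∘ θ^L` is the pullback by `det` of `conj z dz`, so its smoothness
and its derivative are found in `ℂ`. -/
theorem mfderiv_det_eq (h : Spinc k) (w : TangentSpace 𝓘(ℝ, spincLie k) h) :
    detStar (maurerCartan h w) = (starRingEnd ℂ) (det h : ℂ) *
      (show ℂ from mfderiv 𝓘(ℝ, spincLie k) 𝓘(ℝ, ℂ) (fun x : Spinc k => (det x : ℂ)) h w) := by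
  have h1 : MDifferentiableAt 𝓘(ℝ, spincLie k) 𝓘(ℝ, spincLie k) (fun x : Spinc k => h⁻¹ * x) h :=
    (contMDiff_mul_left (a := h⁻¹) (n := ∞)).mdifferentiable (by simp) h
  have h2 : HasMFDerivAt 𝓘(ℝ, spincLie k) 𝓘(ℝ, ℂ) (fun x : Spinc k => (det x : ℂ)) (h⁻¹ * h)
      (mfderiv 𝓘(ℝ, spincLie k) 𝓘(ℝ, ℂ) (fun x : Spinc k => (det x : ℂ)) 1) := by
    rw [inv_mul_cancel]
    exact ((contMDiff_det k).mdifferentiable (by simp) 1).hasMFDerivAt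
  have h3 := h2.comp h h1.hasMFDerivAt
  have h4 : ((fun x : Spinc k => (det x : ℂ)) ∘ fun x : Spinc k => h⁻¹ * x) =
      fun x => (starRingEnd ℂ) (det h : ℂ) * (det x : ℂ) := by
    funext x
    rw [Function.comp_apply, det_mul, det_inv, Circle.coe_mul, Circle.coe_inv_eq_conj]
  have h5 : HasMFDerivAt 𝓘(ℝ, ℂ) 𝓘(ℝ, ℂ) (fun z : ℂ => (starRingEnd ℂ) (det h : ℂ) * z) (det h : ℂ)
      (ContinuousLinearMap.mul ℝ ℂ ((starRingEnd ℂ) (det h : ℂ)) : ℂ →L[ℝ] ℂ) :=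
    (ContinuousLinearMap.mul ℝ ℂ ((starRingEnd ℂ) (det h : ℂ))).hasMFDerivAt
  have h6 := h5.comp (f := fun x : Spinc k => (det x : ℂ)) h
    ((contMDiff_det k).mdifferentiable (by simp) h).hasMFDerivAt
  rw [h4] at h3
  exact congrArg (fun L : spincLie k →L[ℝ] ℂ => L w) (hasMFDerivAt_unique h3 h6)

/-- The form `conj z dz` on `ℂ`. -/
def conjForm : DForm 𝓘(ℝ, ℂ) ℂ 1 ℂ := fun z =>
  ContinuousAlternatingMap.ofSubsingleton ℝ ℂ ℂ (0 : Fin 1)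
    (ContinuousLinearMap.mul ℝ ℂ ((starRingEnd ℂ) z))

theorem contDiff_conjForm : ContDiff ℝ ∞ conjForm.onSpace := by
  have h1 : ContDiff ℝ ∞ fun z : ℂ => ContinuousLinearMap.mul ℝ ℂ ((starRingEnd ℂ) z) :=
    (ContinuousLinearMap.mul ℝ ℂ).contDiff.comp Complex.conjCLE.contDiff
  exact (ContinuousAlternatingMap.ofSubsingletonLIE (𝕜 := ℝ) (E := ℂ) (F := ℂ)
    (0 : Fin 1)).contDiff.comp h1

theorem DForm.inChart_space {F V : Type*} [NormedAddCommGroup F] [NormedSpace ℝ F]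
    [NormedAddCommGroup V] [NormedSpace ℝ V] {n : ℕ} (α : DForm 𝓘(ℝ, F) F n V) (x : F) :
    α.inChart x = α.onSpace := by
  funext y
  have h : mfderiv 𝓘(ℝ, F) 𝓘(ℝ, F) (extChartAt 𝓘(ℝ, F) x).symm y = ContinuousLinearMap.id ℝ F := by
    rw [extChartAt_model_space_eq_id]
    exact mfderiv_id
  exact α.compContinuousLinearMap_congr (F := F) (show (extChartAt 𝓘(ℝ, F) x).symm y = y by
    rw [extChartAt_model_space_eq_id]; rfl) h

theorem isSmooth_conjForm : conjForm.IsSmooth := fun x => by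
  rw [DForm.inChart_space]
  exact contDiff_conjForm.contDiffOn

theorem extD_conjForm (z : ℂ) (v : Fin 2 → ℂ) : conjForm.extD z v =
    (starRingEnd ℂ) (v 0) * v 1 - (starRingEnd ℂ) (v 1) * v 0 := by
  have h1 : conjForm.extD z = extDeriv conjForm.onSpace z := by
    have h : mfderiv 𝓘(ℝ, ℂ) 𝓘(ℝ, ℂ) (extChartAt 𝓘(ℝ, ℂ) z) z = ContinuousLinearMap.id ℝ ℂ := by
      rw [extChartAt_model_space_eq_id]
      exact mfderiv_id
    rw [DForm.extD, DForm.inChart_space]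
    exact DForm.compContinuousLinearMap_congr (J := 𝓘(ℝ, ℂ)) (N := ℂ) (F := ℂ)
      (extDeriv conjForm.onSpace) (by rw [extChartAt_model_space_eq_id]; rfl) h
  have h2 : ∀ a : ℂ, HasFDerivAt (fun w : ℂ => (starRingEnd ℂ) w * a)
      ((ContinuousLinearMap.mul ℝ ℂ).flip a ∘L (Complex.conjCLE : ℂ →L[ℝ] ℂ)) z := fun a =>
    (((ContinuousLinearMap.mul ℝ ℂ).flip a) ∘L (Complex.conjCLE : ℂ →L[ℝ] ℂ)).hasFDerivAt
  rw [h1]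
  refine (extDeriv_apply (contDiff_conjForm.differentiable (by simp) z) v).trans ?_
  rw [Fin.sum_univ_two]
  have h3 : ∀ w : Fin 1 → ℂ, (fun x => conjForm.onSpace x w) =
      fun x => (starRingEnd ℂ) x * w 0 := fun w => rfl
  rw [h3, h3, (h2 _).fderiv, (h2 _).fderiv]
  simp [Fin.removeNth, sub_eq_add_neg, mul_comm]

/-- The form `det_* ∘ θ^L`. -/
def detForm (k : ℕ) : DForm 𝓘(ℝ, spincLie k) (Spinc k) 1 ℂ :=
  conjForm.pullback 𝓘(ℝ, spincLie k) fun x : Spinc k => (det x : ℂ)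

theorem detForm_apply (h : Spinc k) (v : Fin 1 → TangentSpace 𝓘(ℝ, spincLie k) h) :
    detForm k h v = detStar (maurerCartan h (v 0)) :=
  (mfderiv_det_eq h (v 0)).symm

theorem isSmooth_detForm (k : ℕ) : (detForm k).IsSmooth :=
  isSmooth_conjForm.pullback (contMDiff_det k)

/-- Since `det_*` is imaginary, the derivative of `det` at `h` takes values in the real line `det(h)
· iℝ`, and the two-form `d(conj z) ∧ dz` vanishes on two vectors of one real line. -/
theorem extD_detForm (h : Spinc k) : (detForm k).extD h = 0 := by
  have h1 : ∀ w : TangentSpace 𝓘(ℝ, spincLie k) h, ∃ r : ℝ,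
      (show ℂ from mfderiv 𝓘(ℝ, spincLie k) 𝓘(ℝ, ℂ) (fun x : Spinc k => (det x : ℂ)) h w) =
        (det h : ℂ) * (r * Complex.I) := by
    intro w
    refine ⟨(detStar (maurerCartan h w)).im, ?_⟩
    have h2 : ((detStar (maurerCartan h w)).im : ℂ) * Complex.I = detStar (maurerCartan h w) := by
      have hre : (detStar (maurerCartan h w)).re = 0 := detStar_re _
      apply Complex.ext
      · simpa using hre.symm
      · simp
    rw [h2, mfderiv_det_eq, ← mul_assoc, Complex.mul_conj, Circle.normSq_coe, Complex.ofReal_one,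
      one_mul]
  rw [detForm, isSmooth_conjForm.extD_pullback (contMDiff_det k)]
  ext v
  obtain ⟨r, hr⟩ := h1 (v 0)
  obtain ⟨s, hs⟩ := h1 (v 1)
  refine (extD_conjForm _ _).trans ?_
  change (starRingEnd ℂ) (show ℂ from mfderiv 𝓘(ℝ, spincLie k) 𝓘(ℝ, ℂ) _ h (v 0)) *
    (show ℂ from mfderiv 𝓘(ℝ, spincLie k) 𝓘(ℝ, ℂ) _ h (v 1)) -
    (starRingEnd ℂ) (show ℂ from mfderiv 𝓘(ℝ, spincLie k) 𝓘(ℝ, ℂ) _ h (v 1)) *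
    (show ℂ from mfderiv 𝓘(ℝ, spincLie k) 𝓘(ℝ, ℂ) _ h (v 0)) = 0
  rw [hr, hs]
  simp only [map_mul, Complex.conj_ofReal, Complex.conj_I]
  ring

end DetForm

end

noncomputable section

/-! ### Orientations under linear maps and direct sums -/

section LinearOrientation

variable {V W : Type*} [AddCommGroup V] [Module ℝ V] [AddCommGroup W] [Module ℝ W] {m n k : ℕ}

/-- A map that takes one basis to a basis is an isomorphism, and it carries the orientation of the
first to that of the second. Testing on one positive basis is therefore enough. -/
theorem IsPositive.map {o : Orientation ℝ V (Fin k)} {o' : Orientation ℝ W (Fin k)}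
    (D : V →ₗ[ℝ] W) {w v : Fin k → V} (hw : IsPositive o w)
    (hDw : IsPositive o' fun i => D (w i)) (hv : IsPositive o v) :
    IsPositive o' fun i => D (v i) := by
  obtain ⟨b, rfl, hb⟩ := hw
  obtain ⟨c, hc, hc'⟩ := hDw
  obtain ⟨a, rfl, ha⟩ := hv
  let e : V ≃ₗ[ℝ] W := b.equiv c (Equiv.refl _)
  have he : ∀ x, e x = D x := by
    have : (e : V →ₗ[ℝ] W) = D := b.ext fun i => by
      change b.equiv c (Equiv.refl _) (b i) = _
      rw [Module.Basis.equiv_apply, hc]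
      rfl
    exact LinearMap.congr_fun this
  have hcb : b.map e = c := by
    ext i
    rw [Module.Basis.map_apply, he, hc]
  refine ⟨a.map e, ?_, ?_⟩
  · ext i
    rw [Module.Basis.map_apply, he]
  · rw [Module.Basis.orientation_map, ha, ← hb, ← Module.Basis.orientation_map, hcb, hc']

/-- The determinant of the image of a basis relative to that basis is `det D`. -/
theorem IsPositive.of_det_pos {o : Orientation ℝ V (Fin k)} {e : Fin k → V} (he : IsPositive o e)
    (D : V →ₗ[ℝ] V) (hD : 0 < LinearMap.det D) : IsPositive o fun i => D (e i) := by
  obtain ⟨b, rfl, hb⟩ := he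
  let f : V ≃ₗ[ℝ] V := LinearEquiv.ofIsUnitDet (f := D) (v := b) (v' := b) (by
    rw [LinearMap.det_toMatrix]; exact isUnit_iff_ne_zero.mpr hD.ne')
  refine ⟨b.map f, rfl, ?_⟩
  rw [← hb, eq_comm, Module.Basis.orientation_eq_iff_det_pos]
  have h1 : b.det (b.map f) = LinearMap.det D := by
    have := b.det_comp D b
    rw [Module.Basis.det_self, mul_one] at this
    exact this
  rw [h1]
  exact hD

/-- The basis of a product space obtained by concatenation. -/
def appendBasis (b : Module.Basis (Fin m) ℝ V) (c : Module.Basis (Fin n) ℝ W) :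
    Module.Basis (Fin (m + n)) ℝ (V × W) :=
  (b.prod c).reindex finSumFinEquiv

theorem coe_appendBasis (b : Module.Basis (Fin m) ℝ V) (c : Module.Basis (Fin n) ℝ W) :
    ⇑(appendBasis b c) = Fin.append (fun i => (b i, 0)) (fun i => (0, c i)) := by
  funext i
  refine Fin.addCases (fun i => ?_) (fun i => ?_) i <;> simp [appendBasis]

/-- The change of basis matrix is block diagonal. So the orientation of a concatenated basis depends
only on the orientations of its two parts. -/
theorem det_appendBasis (b b' : Module.Basis (Fin m) ℝ V) (c c' : Module.Basis (Fin n) ℝ W) :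
    (appendBasis b c).det (appendBasis b' c') = b.det b' * c.det c' := by
  have h : (appendBasis b c).toMatrix (appendBasis b' c') =
      (Matrix.fromBlocks (b.toMatrix b') 0 0 (c.toMatrix c')).submatrix
        finSumFinEquiv.symm finSumFinEquiv.symm := by
    ext i j
    refine Fin.addCases (fun i => ?_) (fun i => ?_) i <;>
    refine Fin.addCases (fun j => ?_) (fun j => ?_) j <;>
    simp [appendBasis, Module.Basis.toMatrix_apply]
  rw [Module.Basis.det_apply, h, Matrix.det_submatrix_equiv_self, Matrix.det_fromBlocks_zero₂₁,
    ← Module.Basis.det_apply, ← Module.Basis.det_apply]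

theorem orientation_appendBasis {b b' : Module.Basis (Fin m) ℝ V}
    {c c' : Module.Basis (Fin n) ℝ W} (hb : b.orientation = b'.orientation)
    (hc : c.orientation = c'.orientation) :
    (appendBasis b c).orientation = (appendBasis b' c').orientation := by
  rw [Module.Basis.orientation_eq_iff_det_pos] at hb hc ⊢
  rw [det_appendBasis]
  exact mul_pos hb hc

end LinearOrientation

/-! ### The product Riemannian metric -/

section ProductMetric

variable {E H M : Type*} [NormedAddCommGroup E] [NormedSpace ℝ E] [TopologicalSpace H]
  {I : ModelWithCorners ℝ E H} [TopologicalSpace M] [ChartedSpace H M] [IsManifold I ∞ M]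
  {E' H' N : Type*} [NormedAddCommGroup E'] [NormedSpace ℝ E'] [TopologicalSpace H']
  {J : ModelWithCorners ℝ E' H'} [TopologicalSpace N] [ChartedSpace H' N] [IsManifold J ∞ N]

/-- The space of continuous bilinear forms. -/
abbrev Bil (E : Type*) [NormedAddCommGroup E] [NormedSpace ℝ E] : Type _ := E →L[ℝ] E →L[ℝ] ℝ

/-- The pullback of a bilinear form by a linear map. -/
def pullBil (A : E' →L[ℝ] E) (L : Bil E) : Bil E' :=
  ((ContinuousLinearMap.compL ℝ E' E ℝ).flip A) ∘L (L ∘L A)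

theorem contDiff_pullBil (A : E' →L[ℝ] E) : ContDiff ℝ ∞ (pullBil A) :=
  contDiff_const.clm_comp (contDiff_id.clm_comp contDiff_const)

/-- A field of bilinear forms on the tangent spaces near a point, in the coordinates of the
tangent bundle at the point. -/
def bilCoord (I : ModelWithCorners ℝ E H) [IsManifold I ∞ M]
    (s : ∀ x : M, TangentSpace I x →L[ℝ] TangentSpace I x →L[ℝ] ℝ) (x₀ x : M) :
    Bil E :=
  pullBil (E := E) (E' := E) ((trivializationAt E (TangentSpace I) x₀).symmL ℝ x) (s x)

/-- The forms take values in a trivial line bundle, so the bundle coordinates of `s` near `x₀` are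
its pullback by the inverse of the tangent bundle trivialization alone. -/
theorem contMDiffAt_bil_iff (s : ∀ x : M, TangentSpace I x →L[ℝ] TangentSpace I x →L[ℝ] ℝ)
    (x₀ : M) : ContMDiffAt I (I.prod 𝓘(ℝ, Bil E)) ∞
      (fun x => (Bundle.TotalSpace.mk' (Bil E) x (s x) :
        Bundle.TotalSpace (Bil E)
          fun x : M => TangentSpace I x →L[ℝ] TangentSpace I x →L[ℝ] ℝ)) x₀ ↔
      ContMDiffAt I 𝓘(ℝ, Bil E) ∞ (bilCoord I s x₀) x₀ := by
  rw [contMDiffAt_hom_bundle]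
  have h : (fun x => ContinuousLinearMap.inCoordinates E (TangentSpace I) (E →L[ℝ] ℝ)
      (fun x : M => TangentSpace I x →L[ℝ] ℝ) x₀ x x₀ x (s x)) =ᶠ[𝓝 x₀] bilCoord I s x₀ := by
    have h1 := (trivializationAt E (TangentSpace I : M → Type _) x₀).open_baseSet.mem_nhds
      (FiberBundle.mem_baseSet_trivializationAt' x₀)
    filter_upwards [h1] with x hx
    ext v w
    refine (inCoordinates_apply_eq₂ (E₃ := Bundle.Trivial M ℝ) hx hx (Set.mem_univ _)).trans ?_
    simp only [Bundle.Trivial.fiberBundle_trivializationAt', Bundle.Trivial.linearMapAt_trivialization]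
    have h2 : ∀ u : E, (trivializationAt E (TangentSpace I) x₀).symm x u =
        (trivializationAt E (TangentSpace I) x₀).symmL ℝ x u := fun u =>
      (Bundle.Trivialization.symmL_apply (R := ℝ) _ hx u).symm
    exact congrArg₂ (fun a b : E => s x a b) (h2 v) (h2 w)
  exact ⟨fun hs => hs.2.congr_of_eventuallyEq h.symm,
    fun hs => ⟨contMDiffAt_id, hs.congr_of_eventuallyEq h⟩⟩

/-- The sum of two bilinear forms on the factors. -/
def sumBil (L : Bil E) (L' : Bil E') :
    Bil (E × E') :=
  pullBil (ContinuousLinearMap.fst ℝ E E') L + pullBil (ContinuousLinearMap.snd ℝ E E') L'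

theorem contDiff_sumBil : ContDiff ℝ ∞
    fun p : (Bil E) × (Bil E') => sumBil p.1 p.2 :=
  ((contDiff_pullBil _).comp contDiff_fst).add ((contDiff_pullBil _).comp contDiff_snd)

/-- The inverse trivializations are derivatives of inverse charts, and the charts of a product are
products of charts. With this, the coordinate expression of a sum of metrics is the sum of the
coordinate expressions. -/
theorem symmL_trivializationAt_prod [I.Boundaryless] [J.Boundaryless] {z₀ z : M × N}
    (h1 : z.1 ∈ (chartAt H z₀.1).source) (h2 : z.2 ∈ (chartAt H' z₀.2).source) (v : E × E') :
    (trivializationAt (E × E') (TangentSpace (I.prod J)) z₀).symmL ℝ z v =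
      ((trivializationAt E (TangentSpace I) z₀.1).symmL ℝ z.1 v.1,
        (trivializationAt E' (TangentSpace J) z₀.2).symmL ℝ z.2 v.2) := by
  have h3 : z ∈ (chartAt (ModelProd H H') z₀).source := ⟨h1, h2⟩
  have hI : MDifferentiableAt 𝓘(ℝ, E) I (extChartAt I z₀.1).symm (extChartAt I z₀.1 z.1) :=
    ((contMDiffOn_extChartAt_symm (n := ∞) z₀.1).contMDiffAt (extChartAt_target_mem_nhds'
      ((extChartAt I z₀.1).map_source (by rwa [extChartAt_source])))).mdifferentiableAt (by simp)
  have hJ : MDifferentiableAt 𝓘(ℝ, E') J (extChartAt J z₀.2).symm (extChartAt J z₀.2 z.2) :=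
    ((contMDiffOn_extChartAt_symm (n := ∞) z₀.2).contMDiffAt (extChartAt_target_mem_nhds'
      ((extChartAt J z₀.2).map_source (by rwa [extChartAt_source])))).mdifferentiableAt (by simp)
  rw [TangentBundle.symmL_trivializationAt h3, TangentBundle.symmL_trivializationAt h1,
    TangentBundle.symmL_trivializationAt h2, ModelWithCorners.range_eq_univ,
    ModelWithCorners.range_eq_univ, ModelWithCorners.range_eq_univ, mfderivWithin_univ,
    mfderivWithin_univ, mfderivWithin_univ]
  set w := extChartAt (I.prod J) z₀ z
  have hfst : MDifferentiableAt 𝓘(ℝ, E × E') 𝓘(ℝ, E) Prod.fst w :=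
    differentiableAt_fst.mdifferentiableAt
  have hsnd : MDifferentiableAt 𝓘(ℝ, E × E') 𝓘(ℝ, E') Prod.snd w :=
    differentiableAt_snd.mdifferentiableAt
  have h4 := (hI.hasMFDerivAt.comp w hfst.hasMFDerivAt).prodMk
    (hJ.hasMFDerivAt.comp w hsnd.hasMFDerivAt)
  have h5 : mfderiv 𝓘(ℝ, E × E') 𝓘(ℝ, E) Prod.fst w = ContinuousLinearMap.fst ℝ E E' := by
    rw [mfderiv_eq_fderiv]; exact fderiv_fst
  have h6 : mfderiv 𝓘(ℝ, E × E') 𝓘(ℝ, E') Prod.snd w = ContinuousLinearMap.snd ℝ E E' := by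
    rw [mfderiv_eq_fderiv]; exact fderiv_snd
  rw [h5, h6] at h4
  exact congrArg (fun L : E × E' →L[ℝ] E × E' => L v) h4.mfderiv

/-- The sum of two fields of bilinear forms on the factors of a product. -/
def sumBilField (s : ∀ x : M, TangentSpace I x →L[ℝ] TangentSpace I x →L[ℝ] ℝ)
    (s' : ∀ x : N, TangentSpace J x →L[ℝ] TangentSpace J x →L[ℝ] ℝ) (z : M × N) :
    TangentSpace (I.prod J) z →L[ℝ] TangentSpace (I.prod J) z →L[ℝ] ℝ :=
  sumBil (E := E) (E' := E') (s z.1) (s' z.2)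

theorem bilCoord_sumBilField [I.Boundaryless] [J.Boundaryless]
    (s : ∀ x : M, TangentSpace I x →L[ℝ] TangentSpace I x →L[ℝ] ℝ)
    (s' : ∀ x : N, TangentSpace J x →L[ℝ] TangentSpace J x →L[ℝ] ℝ) {z₀ z : M × N}
    (h1 : z.1 ∈ (chartAt H z₀.1).source) (h2 : z.2 ∈ (chartAt H' z₀.2).source) :
    bilCoord (I.prod J) (sumBilField s s') z₀ z =
      sumBil (bilCoord I s z₀.1 z.1) (bilCoord J s' z₀.2 z.2) := by
  refine ContinuousLinearMap.ext fun v => ContinuousLinearMap.ext fun w => ?_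
  have h3 : bilCoord (I.prod J) (sumBilField s s') z₀ z v w = sumBilField s s' z
      ((trivializationAt (E × E') (TangentSpace (I.prod J)) z₀).symmL ℝ z v)
      ((trivializationAt (E × E') (TangentSpace (I.prod J)) z₀).symmL ℝ z w) := rfl
  have h4 := congrArg₂ (fun a b : E × E' => sumBil (E := E) (E' := E') (s z.1) (s' z.2) a b)
    (symmL_trivializationAt_prod (I := I) (J := J) h1 h2 v) (symmL_trivializationAt_prod (I := I) (J := J) h1 h2 w)
  exact h3.trans h4

theorem contMDiffAt_sumBilField [I.Boundaryless] [J.Boundaryless]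
    {s : ∀ x : M, TangentSpace I x →L[ℝ] TangentSpace I x →L[ℝ] ℝ}
    {s' : ∀ x : N, TangentSpace J x →L[ℝ] TangentSpace J x →L[ℝ] ℝ} {z₀ : M × N}
    (hs : ContMDiffAt I 𝓘(ℝ, Bil E) ∞ (bilCoord I s z₀.1) z₀.1)
    (hs' : ContMDiffAt J 𝓘(ℝ, Bil E') ∞ (bilCoord J s' z₀.2) z₀.2) :
    ContMDiffAt (I.prod J) 𝓘(ℝ, Bil (E × E')) ∞
      (bilCoord (I.prod J) (sumBilField s s') z₀) z₀ := by
  have h1 : ContMDiffAt (I.prod J) 𝓘(ℝ, Bil E) ∞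
      (fun z : M × N => bilCoord I s z₀.1 z.1) z₀ :=
    ContMDiffAt.comp (x := z₀) (f := Prod.fst) (g := bilCoord I s z₀.1) hs contMDiffAt_fst
  have h2 : ContMDiffAt (I.prod J) 𝓘(ℝ, Bil E') ∞
      (fun z : M × N => bilCoord J s' z₀.2 z.2) z₀ :=
    ContMDiffAt.comp (x := z₀) (f := Prod.snd) (g := bilCoord J s' z₀.2) hs' contMDiffAt_snd
  have h3 : ContMDiffAt (I.prod J) 𝓘(ℝ, Bil E × Bil E') ∞
      (fun z : M × N => (bilCoord I s z₀.1 z.1, bilCoord J s' z₀.2 z.2)) z₀ := h1.prodMk_space h2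
  have h4 : ContMDiffAt (I.prod J) 𝓘(ℝ, Bil (E × E')) ∞
      (fun z : M × N => sumBil (bilCoord I s z₀.1 z.1) (bilCoord J s' z₀.2 z.2)) z₀ :=
    ContMDiffAt.comp (x := z₀) 
      (f := fun z : M × N => (bilCoord I s z₀.1 z.1, bilCoord J s' z₀.2 z.2))
      (g := fun p : Bil E × Bil E' => sumBil p.1 p.2)
      (contDiff_sumBil (E := E) (E' := E')).contMDiff.contMDiffAt h3
  have h5 : bilCoord (I.prod J) (sumBilField s s') z₀ =ᶠ[𝓝 z₀]
      (fun z : M × N => sumBil (bilCoord I s z₀.1 z.1) (bilCoord J s' z₀.2 z.2)) := by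
    have h6 : (chartAt H z₀.1).source ×ˢ (chartAt H' z₀.2).source ∈ 𝓝 z₀ :=
      prod_mem_nhds (chart_source_mem_nhds H z₀.1) (chart_source_mem_nhds H' z₀.2)
    filter_upwards [h6] with z hz
    exact bilCoord_sumBilField s s' hz.1 hz.2
  exact h4.congr_of_eventuallyEq h5

/-- The product metric. -/
def prodMetric [I.Boundaryless] [J.Boundaryless]
    (g : Bundle.ContMDiffRiemannianMetric I ∞ E (fun x : M => TangentSpace I x))
    (g' : Bundle.ContMDiffRiemannianMetric J ∞ E' (fun x : N => TangentSpace J x)) :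
    Bundle.ContMDiffRiemannianMetric (I.prod J) ∞ (E × E')
      (fun z : M × N => TangentSpace (I.prod J) z) where
  inner := sumBilField g.inner g'.inner
  symm z v w := by
    change g.inner z.1 v.1 w.1 + g'.inner z.2 v.2 w.2 = g.inner z.1 w.1 v.1 + g'.inner z.2 w.2 v.2
    exact congrArg₂ (· + ·) (g.symm z.1 v.1 w.1) (g'.symm z.2 v.2 w.2)
  pos z v hv := by
    change 0 < g.inner z.1 v.1 v.1 + g'.inner z.2 v.2 v.2
    have h1 : ∀ u : TangentSpace I z.1, 0 ≤ g.inner z.1 u u := fun u => by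
      by_cases hu : u = 0
      · rw [hu, map_zero]
      · exact (g.pos z.1 u hu).le
    have h2 : ∀ u : TangentSpace J z.2, 0 ≤ g'.inner z.2 u u := fun u => by
      by_cases hu : u = 0
      · rw [hu, map_zero]
      · exact (g'.pos z.2 u hu).le
    by_cases hu : v.1 = 0
    · refine add_pos_of_nonneg_of_pos (h1 _) (g'.pos z.2 v.2 fun h => hv (Prod.ext hu h))
    · exact add_pos_of_pos_of_nonneg (g.pos z.1 v.1 hu) (h2 _)
  isVonNBounded z := by
    have h1 : ∀ u : TangentSpace I z.1, 0 ≤ g.inner z.1 u u := fun u => by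
      by_cases hu : u = 0
      · rw [hu, map_zero]
      · exact (g.pos z.1 u hu).le
    have h2 : ∀ u : TangentSpace J z.2, 0 ≤ g'.inner z.2 u u := fun u => by
      by_cases hu : u = 0
      · rw [hu, map_zero]
      · exact (g'.pos z.2 u hu).le
    have b1 := (NormedSpace.isVonNBounded_iff ℝ (E := E)).mp (g.isVonNBounded z.1)
    have b2 := (NormedSpace.isVonNBounded_iff ℝ (E := E')).mp (g'.isVonNBounded z.2)
    -- Both metrics are nonnegative, so the unit ball of their sum lies in the product of their unit
    -- balls, which are bounded.
    refine (NormedSpace.isVonNBounded_iff ℝ (E := E × E')).mpr ((b1.prod b2).subset ?_)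
    intro v hv
    change g.inner z.1 v.1 v.1 + g'.inner z.2 v.2 v.2 < 1 at hv
    exact ⟨(le_add_of_nonneg_right (h2 _)).trans_lt hv, (le_add_of_nonneg_left (h1 _)).trans_lt hv⟩
  contMDiff z₀ := (contMDiffAt_bil_iff (I := I.prod J) _ z₀).mpr
    (contMDiffAt_sumBilField ((contMDiffAt_bil_iff _ _).mp (g.contMDiff z₀.1))
      ((contMDiffAt_bil_iff _ _).mp (g'.contMDiff z₀.2)))

end ProductMetric

end

noncomputable section

/-! ### The product orientation -/

section LinearOrientation

variable {V W : Type*} [AddCommGroup V] [Module ℝ V] [AddCommGroup W] [Module ℝ W] {m n : ℕ}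

/-- The product orientation. -/
def prodOrientation {o : Orientation ℝ V (Fin m)} {o' : Orientation ℝ W (Fin n)}
    (h : ∃ v, IsPositive o v) (h' : ∃ v, IsPositive o' v) : Orientation ℝ (V × W) (Fin (m + n)) :=
  (appendBasis h.choose_spec.choose h'.choose_spec.choose).orientation

/-- The product orientation is defined by means of chosen positive bases; the block determinant
shows that any other pair of positive bases defines the same one. -/
theorem IsPositive.append {o : Orientation ℝ V (Fin m)} {o' : Orientation ℝ W (Fin n)}
    (h : ∃ v, IsPositive o v) (h' : ∃ v, IsPositive o' v) {u : Fin m → V} {v : Fin n → W}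
    (hu : IsPositive o u) (hv : IsPositive o' v) :
    IsPositive (prodOrientation h h') (Fin.append (fun i => (u i, 0)) (fun i => (0, v i))) := by
  obtain ⟨b, rfl, hb⟩ := hu
  obtain ⟨c, rfl, hc⟩ := hv
  exact ⟨appendBasis b c, coe_appendBasis b c, orientation_appendBasis
    (hb.trans h.choose_spec.choose_spec.2.symm) (hc.trans h'.choose_spec.choose_spec.2.symm)⟩

end LinearOrientation

/-! ### The product of two oriented Riemannian manifolds with `G`-action -/

section ProductAction

variable {EG : Type*} [NormedAddCommGroup EG] [NormedSpace ℝ EG]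
  {G : Type*} [Group G] [TopologicalSpace G] [ChartedSpace EG G]
  {E H M : Type*} [NormedAddCommGroup E] [NormedSpace ℝ E] [TopologicalSpace H]
  {I : ModelWithCorners ℝ E H} [TopologicalSpace M] [ChartedSpace H M] [IsManifold I ∞ M]
  {E' H' N : Type*} [NormedAddCommGroup E'] [NormedSpace ℝ E'] [TopologicalSpace H']
  {J : ModelWithCorners ℝ E' H'} [TopologicalSpace N] [ChartedSpace H' N] [IsManifold J ∞ N]
  {m n : ℕ}

theorem OrientedRiemannianAction.exists_isPositive (B : OrientedRiemannianAction I M EG G m)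
    (x : M) : ∃ v, IsPositive (B.orientation x) v := by
  obtain ⟨U, hU, X, -, hX⟩ := B.exists_frame x
  exact ⟨_, hX x (mem_of_mem_nhds hU)⟩

theorem OrientedRiemannianAction.contMDiff_act_apply (B : OrientedRiemannianAction I M EG G m)
    (g : G) : ContMDiff I I ∞ (B.act g) :=
  B.contMDiff_act.comp (contMDiff_const.prodMk contMDiff_id)

theorem mfderiv_prodMap_apply {f : M → M} {g : N → N} {z : M × N}
    (hf : MDifferentiableAt I I f z.1) (hg : MDifferentiableAt J J g z.2)
    (v : TangentSpace (I.prod J) z) :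
    mfderiv (I.prod J) (I.prod J) (Prod.map f g) z v =
      (mfderiv I I f z.1 v.1, mfderiv J J g z.2 v.2) := by
  have h := mfderiv_prodMap (p := z) hf hg
  exact congrArg (fun L : E × E' →L[ℝ] E × E' => L v) h

/-- The product of two actions, where `g` acts on the second factor as `ε g`. -/
def prodPerm (BM : OrientedRiemannianAction I M EG G m) (BN : OrientedRiemannianAction J N EG G n)
    (ε : G →* G) : G →* Equiv.Perm (M × N) where
  toFun g := (BM.act g).prodCongr (BN.act (ε g))
  map_one' := by
    ext z <;> simp
  map_mul' g h := by
    ext z <;> simp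

/-- Each member of the frame is a smooth field on one factor paired with the zero section of the
other, carried through `TM × TN ≅ T(M × N)`. -/
theorem contMDiffOn_prodFrame {U : Set M} {U' : Set N} {X : Fin m → ∀ x : M, TangentSpace I x}
    {X' : Fin n → ∀ x : N, TangentSpace J x}
    (hX : ∀ i, ContMDiffOn I I.tangent ∞ (fun x => (⟨x, X i x⟩ : TangentBundle I M)) U)
    (hX' : ∀ i, ContMDiffOn J J.tangent ∞ (fun x => (⟨x, X' i x⟩ : TangentBundle J N)) U')
    (i : Fin (m + n)) :
    ContMDiffOn (I.prod J) (I.prod J).tangent ∞ (fun z : M × N =>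
      (⟨z, Fin.append (fun i => ((X i z.1, 0) : E × E')) (fun i => ((0, X' i z.2) : E × E')) i⟩ :
        TangentBundle (I.prod J) (M × N))) (U ×ˢ U') := by
  have h0 : ContMDiff I I.tangent ∞ (fun x => (⟨x, 0⟩ : TangentBundle I M)) :=
    Bundle.contMDiff_zeroSection ℝ (TangentSpace I)
  have h0' : ContMDiff J J.tangent ∞ (fun x => (⟨x, 0⟩ : TangentBundle J N)) :=
    Bundle.contMDiff_zeroSection ℝ (TangentSpace J)
  have h1 : ContMDiff (I.tangent.prod J.tangent) (I.prod J).tangent ∞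
    (equivTangentBundleProd I M J N).symm := contMDiff_equivTangentBundleProd_symm
  have hf : ContMDiffOn (I.prod J) I ∞ (Prod.fst : M × N → M) (U ×ˢ U') := contMDiffOn_fst
  have hs : ContMDiffOn (I.prod J) J ∞ (Prod.snd : M × N → N) (U ×ˢ U') := contMDiffOn_snd
  refine Fin.addCases (fun i => ?_) (fun i => ?_) i
  · have h2 := h1.comp_contMDiffOn (((hX i).comp hf fun z hz => hz.1).prodMk
      (h0'.comp_contMDiffOn hs))
    refine h2.congr fun z _ => ?_
    exact congrArg (fun e : E × E' => (⟨z, e⟩ : TangentBundle (I.prod J) (M × N)))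
      (Fin.append_left (fun i => (show E × E' from (X i z.1, 0)))
        (fun i => (show E × E' from (0, X' i z.2))) i)
  · have h2 := h1.comp_contMDiffOn ((h0.comp_contMDiffOn hf).prodMk
      ((hX' i).comp hs fun z hz => hz.2))
    refine h2.congr fun z _ => ?_
    exact congrArg (fun e : E × E' => (⟨z, e⟩ : TangentBundle (I.prod J) (M × N)))
      (Fin.append_right (fun i => (show E × E' from (X i z.1, 0)))
        (fun i => (show E × E' from (0, X' i z.2))) i)

/-- The product of two oriented Riemannian manifolds. -/
def OrientedRiemannianAction.prod [I.Boundaryless] [J.Boundaryless]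
    (BM : OrientedRiemannianAction I M EG G m) (BN : OrientedRiemannianAction J N EG G n)
    (ε : G →* G) (hε : ContMDiff 𝓘(ℝ, EG) 𝓘(ℝ, EG) ∞ ε) :
    OrientedRiemannianAction (I.prod J) (M × N) EG G (m + n) where
  act := prodPerm BM BN ε
  contMDiff_act := by
    have h1 : ContMDiff (𝓘(ℝ, EG).prod (I.prod J)) I ∞
        fun p : G × (M × N) => BM.act p.1 p.2.1 :=
      BM.contMDiff_act.comp (contMDiff_fst.prodMk (contMDiff_fst.comp contMDiff_snd))
    have h2 : ContMDiff (𝓘(ℝ, EG).prod (I.prod J)) J ∞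
        fun p : G × (M × N) => BN.act (ε p.1) p.2.2 :=
      BN.contMDiff_act.comp ((hε.comp contMDiff_fst).prodMk (contMDiff_snd.comp contMDiff_snd))
    exact h1.prodMk h2
  metric := prodMetric BM.metric BN.metric
  orientation z := prodOrientation (V := TangentSpace I z.1) (W := TangentSpace J z.2)
    (BM.exists_isPositive z.1) (BN.exists_isPositive z.2)
  exists_frame z₀ := by
    obtain ⟨U, hU, X, hX, hXp⟩ := BM.exists_frame z₀.1
    obtain ⟨U', hU', X', hX', hXp'⟩ := BN.exists_frame z₀.2
    exact ⟨U ×ˢ U', prod_mem_nhds hU hU', _, contMDiffOn_prodFrame hX hX', fun z hz =>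
      IsPositive.append (V := TangentSpace I z.1) (W := TangentSpace J z.2) _ _
        (hXp _ hz.1) (hXp' _ hz.2)⟩
  act_isometry g z u v := by
    have h := mfderiv_prodMap_apply (z := z)
      ((BM.contMDiff_act_apply g).mdifferentiableAt (by simp))
      ((BN.contMDiff_act_apply (ε g)).mdifferentiableAt (by simp))
    have h1 := BM.act_isometry g z.1 u.1 v.1
    have h2 := BN.act_isometry (ε g) z.2 u.2 v.2
    exact (congrArg₂ (fun a b : E × E' => (prodMetric BM.metric BN.metric).inner
      (prodPerm BM BN ε g z) a b) (h u) (h v)).trans (congrArg₂ (· + ·) h1 h2)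
  act_orientation g z v hv := by
    obtain ⟨b, hb⟩ := BM.exists_isPositive z.1
    obtain ⟨c, hc⟩ := BN.exists_isPositive z.2
    have h := mfderiv_prodMap_apply (z := z)
      ((BM.contMDiff_act_apply g).mdifferentiableAt (by simp))
      ((BN.contMDiff_act_apply (ε g)).mdifferentiableAt (by simp))
    -- It is enough to follow a single positive basis, and the one chosen is adapted to the two
    -- factors.
    refine IsPositive.map (V := TangentSpace I z.1 × TangentSpace J z.2)
      (W := TangentSpace I (BM.act g z.1) × TangentSpace J (BN.act (ε g) z.2))
      (mfderiv (I.prod J) (I.prod J) (prodPerm BM BN ε g) z).toLinearMap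
      (IsPositive.append _ _ hb hc) ?_ hv
    have h3 := IsPositive.append (BM.exists_isPositive _) (BN.exists_isPositive _)
      (BM.act_orientation g z.1 b hb) (BN.act_orientation (ε g) z.2 c hc)
    refine Eq.mpr (congrArg (IsPositive _) (funext fun i => ?_)) h3
    let L : E × E' →L[ℝ] E × E' := mfderiv (I.prod J) (I.prod J) (prodPerm BM BN ε g) z
    refine Fin.addCases (fun i => ?_) (fun i => ?_) i
    · refine (congrArg L (Fin.append_left _ _ i)).trans
        (Eq.trans ?_ (Fin.append_left (α := E × E') _ _ i).symm)
      exact (h (b i, 0)).trans (Prod.ext rfl (map_zero _))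
    · refine (congrArg L (Fin.append_right _ _ i)).trans
        (Eq.trans ?_ (Fin.append_right (α := E × E') _ _ i).symm)
      exact (h (0, c i)).trans (Prod.ext (map_zero _) rfl)

theorem isProduct_prod [I.Boundaryless] [J.Boundaryless]
    (BM : OrientedRiemannianAction I M EG G m) (BN : OrientedRiemannianAction J N EG G n)
    (ε : G →* G) (hε : ContMDiff 𝓘(ℝ, EG) 𝓘(ℝ, EG) ∞ ε) :
    IsProduct BM BN ε (BM.prod BN ε hε) where
  act_eq _ _ _ := rfl
  metric_eq _ _ _ _ _ _ := rfl
  orientation_eq x y _ _ hu hv :=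
    IsPositive.append (BM.exists_isPositive x) (BN.exists_isPositive y) hu hv

end ProductAction

end

noncomputable section

/-! ### Manifold structure from a cover by open subsets of a manifold -/

section Gluing

variable {E H K X : Type*} [NormedAddCommGroup E] [NormedSpace ℝ E] [TopologicalSpace H]
  (I : ModelWithCorners ℝ E H) [I.Boundaryless] [TopologicalSpace K] [ChartedSpace H K]
  [TopologicalSpace X] {ι : Type*}

/-- The chart at a point of a manifold without boundary, with values in the model vector space. -/
def vectorChartAt (y : K) : OpenPartialHomeomorph K E :=
  (chartAt H y).trans I.toHomeomorph.toOpenPartialHomeomorph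

theorem vectorChartAt_source (y : K) : (vectorChartAt I y).source = (chartAt H y).source := by
  simp [vectorChartAt]

theorem mem_vectorChartAt_source (y : K) : y ∈ (vectorChartAt I y).source := by
  rw [vectorChartAt_source]
  exact mem_chart_source H y

variable [IsManifold I ∞ K]

theorem contMDiffOn_vectorChartAt (y : K) :
    ContMDiffOn I 𝓘(ℝ, E) ∞ (vectorChartAt I y) (vectorChartAt I y).source := by
  rw [vectorChartAt_source]
  exact contMDiffOn_extChartAt

theorem contMDiffOn_vectorChartAt_symm (y : K) :
    ContMDiffOn 𝓘(ℝ, E) I ∞ (vectorChartAt I y).symm (vectorChartAt I y).target := by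
  have h : (vectorChartAt I y).target = (extChartAt I y).target := by
    ext v
    simp only [vectorChartAt, extChartAt, mfld_simps]
    simp [ModelWithCorners.toHomeomorph, I.range_eq_univ]
  rw [h]
  exact contMDiffOn_extChartAt_symm y

/-- The charted space structure given by a cover by open subsets of a manifold. -/
@[reducible]
def chartedSpaceOfCover (e : ι → OpenPartialHomeomorph X K) (hcov : ∀ x, ∃ i, x ∈ (e i).source) :
    ChartedSpace E X where
  atlas := {φ | ∃ i y, φ = (e i).trans (vectorChartAt I y)}
  chartAt x := (e (hcov x).choose).trans (vectorChartAt I (e (hcov x).choose x))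
  mem_chart_source x := by
    rw [OpenPartialHomeomorph.trans_source]
    exact ⟨(hcov x).choose_spec, mem_vectorChartAt_source I _⟩
  chart_mem_atlas x := ⟨_, _, rfl⟩

variable {I} {e : ι → OpenPartialHomeomorph X K} {hcov : ∀ x, ∃ i, x ∈ (e i).source}
  (htrans : ∀ i j, ContMDiffOn I I ∞ (e j ∘ (e i).symm) ((e i).symm.trans (e j)).source)

include htrans

/-- A change of charts is a transition map `e j ∘ (e i)⁻¹` of the cover, read in two charts of `K`.
-/
theorem isManifold_chartedSpaceOfCover :
    @IsManifold ℝ _ E _ _ E _ 𝓘(ℝ, E) ∞ X _ (chartedSpaceOfCover I e hcov) := by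
  let := chartedSpaceOfCover I e hcov
  refine isManifold_of_contDiffOn _ _ _ ?_
  rintro _ _ ⟨i, y, rfl⟩ ⟨j, z, rfl⟩
  rw [← contMDiffOn_iff_contDiffOn]
  set c := vectorChartAt I y
  set d := vectorChartAt I z
  set s := (((e i).trans c).symm.trans ((e j).trans d)).source
  have hs : ∀ v ∈ s, v ∈ c.target ∧ c.symm v ∈ ((e i).symm.trans (e j)).source ∧
      e j ((e i).symm (c.symm v)) ∈ d.source := by
    intro v hv
    simp only [s, mfld_simps] at hv ⊢
    tauto
  have h1 : ContMDiffOn 𝓘(ℝ, E) 𝓘(ℝ, E) ∞ (d ∘ ((e j ∘ (e i).symm) ∘ c.symm)) s :=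
    (contMDiffOn_vectorChartAt I z).comp ((htrans i j).comp
      ((contMDiffOn_vectorChartAt_symm I y).mono fun v hv => (hs v hv).1)
        fun v hv => (hs v hv).2.1) fun v hv => (hs v hv).2.2
  exact h1.mono fun v hv => hv.1

/-- The preferred chart at `x` comes from one chosen member `e j` of the cover. Near `x`, the map `e
i` is the transition from `e j` composed with the part of that chart that recovers `e j`. -/
theorem contMDiffOn_cover (i : ι) :
    letI := chartedSpaceOfCover I e hcov
    ContMDiffOn 𝓘(ℝ, E) I ∞ (e i) (e i).source := by
  let := chartedSpaceOfCover I e hcov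
  have := isManifold_chartedSpaceOfCover (hcov := hcov) htrans
  intro x hx
  let j := (hcov x).choose
  let c := vectorChartAt I (e j x)
  have hxj : x ∈ (e j).source := (hcov x).choose_spec
  have hxc : e j x ∈ c.source := mem_vectorChartAt_source I _
  have h1 : ContMDiffAt 𝓘(ℝ, E) 𝓘(ℝ, E) ∞ ((e j).trans c) x := by
    exact (contMDiffOn_chart (I := 𝓘(ℝ, E)) (x := x)).contMDiffAt (chart_source_mem_nhds E x)
  have h2 : ContMDiffAt 𝓘(ℝ, E) I ∞ c.symm (((e j).trans c) x) :=
    (contMDiffOn_vectorChartAt_symm I _).contMDiffAt (c.open_target.mem_nhds (c.map_source hxc))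
  have h3 : c.symm (((e j).trans c) x) = e j x := c.left_inv hxc
  have h4 : ContMDiffAt I I ∞ (e i ∘ (e j).symm) (c.symm (((e j).trans c) x)) := by
    rw [h3]
    refine (htrans j i).contMDiffAt (((e j).symm.trans (e i)).open_source.mem_nhds ?_)
    rw [OpenPartialHomeomorph.trans_source]
    refine ⟨(e j).map_source hxj, ?_⟩
    change (e j).symm (e j x) ∈ (e i).source
    rwa [(e j).left_inv hxj]
  refine ((h4.comp x (h2.comp x h1)).congr_of_eventuallyEq ?_).contMDiffWithinAt
  have h5 : ((e j).trans c).source ∈ 𝓝 x := by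
    refine ((e j).trans c).open_source.mem_nhds ?_
    rw [OpenPartialHomeomorph.trans_source]
    exact ⟨hxj, hxc⟩
  filter_upwards [h5] with x' hx'
  rw [OpenPartialHomeomorph.trans_source] at hx'
  change e i x' = e i ((e j).symm (c.symm (c (e j x'))))
  rw [c.left_inv hx'.2, (e j).left_inv hx'.1]

theorem contMDiffOn_cover_symm (i : ι) :
    letI := chartedSpaceOfCover I e hcov
    ContMDiffOn I 𝓘(ℝ, E) ∞ (e i).symm (e i).target := by
  let := chartedSpaceOfCover I e hcov
  have := isManifold_chartedSpaceOfCover (hcov := hcov) htrans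
  intro y hy
  set x := (e i).symm y with hx
  let j := (hcov x).choose
  let c := vectorChartAt I (e j x)
  have hxj : x ∈ (e j).source := (hcov x).choose_spec
  have hxc : e j x ∈ c.source := mem_vectorChartAt_source I _
  have hsrc : x ∈ ((e j).trans c).source := by
    rw [OpenPartialHomeomorph.trans_source]
    exact ⟨hxj, hxc⟩
  have hy' : y ∈ ((e i).symm.trans (e j)).source := by
    rw [OpenPartialHomeomorph.trans_source]
    exact ⟨hy, hxj⟩
  have h1 : ContMDiffAt I I ∞ (e j ∘ (e i).symm) y :=
    (htrans i j).contMDiffAt (((e i).symm.trans (e j)).open_source.mem_nhds hy')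
  have h2 : ContMDiffAt I 𝓘(ℝ, E) ∞ c ((e j ∘ (e i).symm) y) :=
    (contMDiffOn_vectorChartAt I _).contMDiffAt (c.open_source.mem_nhds hxc)
  have h3 : ContMDiffAt 𝓘(ℝ, E) 𝓘(ℝ, E) ∞ ((e j).trans c).symm (c ((e j ∘ (e i).symm) y)) :=
    (contMDiffOn_chart_symm (I := 𝓘(ℝ, E)) (x := x)).contMDiffAt
      (((e j).trans c).open_target.mem_nhds (((e j).trans c).map_source hsrc))
  refine ((h3.comp y (h2.comp y h1)).congr_of_eventuallyEq ?_).contMDiffWithinAt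
  have h5 : (e i).symm ⁻¹' ((e j).trans c).source ∈ 𝓝 y :=
    ((e i).continuousAt_symm hy).preimage_mem_nhds (((e j).trans c).open_source.mem_nhds hsrc)
  filter_upwards [h5] with y' hy''
  exact (((e j).trans c).left_inv hy'').symm

end Gluing

end

/-! ### Equivariant local trivializations -/

noncomputable section

/-- The unit group embeds in `A × Aᵐᵒᵖ` by `u ↦ (u, u⁻¹)`, a product of finite dimensional spaces.
-/
instance (k : ℕ) : SecondCountableTopology (Spinc k) := by
  have : SecondCountableTopology (CCliff k)ᵐᵒᵖ :=
    (MulOpposite.opHomeomorph (M := CCliff k)).symm.secondCountableTopology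
  have : SecondCountableTopology (CCliff k)ˣ :=
    Units.isEmbedding_embedProduct.secondCountableTopology
  exact TopologicalSpace.Subtype.secondCountableTopology _

section Gauges

variable {EG : Type*} [NormedAddCommGroup EG] [NormedSpace ℝ EG]
  {G : Type*} [Group G] [TopologicalSpace G] [ChartedSpace EG G]
  {E H M : Type*} [NormedAddCommGroup E] [NormedSpace ℝ E] [TopologicalSpace H]
  {I : ModelWithCorners ℝ E H} [TopologicalSpace M] [ChartedSpace H M] [IsManifold I ∞ M]
  {EP P : Type*} [NormedAddCommGroup EP] [NormedSpace ℝ EP]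
  [TopologicalSpace P] [ChartedSpace EP P]
  {k : ℕ} {B : OrientedRiemannianAction I M EG G k}

theorem SOF.ext_apply {f g : SOF B} (h : ∀ v, f.apply v = g.apply v) : f = g := by
  obtain ⟨x, F, hF, hF'⟩ := f
  obtain ⟨y, F', _, _⟩ := g
  -- The value at the zero vector already records the base point.
  obtain rfl : x = y := congrArg Bundle.TotalSpace.proj (h 0)
  obtain rfl : F = F' := LinearMap.ext fun v =>
    eq_of_heq (Bundle.TotalSpace.mk.inj (h v)).2
  rfl

namespace EquivariantSpincStructure

variable (S : EquivariantSpincStructure B EP P)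

theorem proj_ract (p : P) (x : Spinc k) : S.proj (S.ract p x) = S.proj p :=
  congrArg Bundle.TotalSpace.proj (S.toSOF_ract p x 0)

theorem contMDiff_proj : ContMDiff 𝓘(ℝ, EP) I ∞ S.proj :=
  (Bundle.contMDiff_proj (TangentSpace I : M → Type _)).comp (S.contMDiff_toSOF 0)

/-- An equivariant local trivialization. -/
structure Gauge where
  /-- the domain in the base -/
  dom : Set M
  isOpen_dom : IsOpen dom
  /-- the fibre coordinate -/
  coord : P → Spinc k
  /-- the inverse trivialization -/
  inv : M × Spinc k → P
  contMDiffOn_coord : ContMDiffOn 𝓘(ℝ, EP) 𝓘(ℝ, spincLie k) ∞ coord {p | S.proj p ∈ dom}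
  contMDiffOn_inv : ContMDiffOn (I.prod 𝓘(ℝ, spincLie k)) 𝓘(ℝ, EP) ∞ inv (dom ×ˢ Set.univ)
  inv_coord : ∀ p, S.proj p ∈ dom → inv (S.proj p, coord p) = p
  proj_inv : ∀ x ∈ dom, ∀ h, S.proj (inv (x, h)) = x
  coord_inv : ∀ x ∈ dom, ∀ h, coord (inv (x, h)) = h
  coord_ract : ∀ p, S.proj p ∈ dom → ∀ h, coord (S.ract p h) = coord p * h

theorem exists_gauge (x : M) : ∃ a : S.Gauge, x ∈ a.dom := by
  obtain ⟨U, hU, hx, τ, σ, h1, h2, h3, h4, h5⟩ := S.locallyTrivial x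
  exact ⟨⟨U, hU, τ, σ, h1, h2, h3, fun x hx h => (h4 x hx h).1, fun x hx h => (h4 x hx h).2, h5⟩,
    hx⟩

variable {S}

/-- The local section of a gauge. -/
def Gauge.sec (a : S.Gauge) (x : M) : P := a.inv (x, 1)

theorem Gauge.contMDiffOn_sec (a : S.Gauge) : ContMDiffOn I 𝓘(ℝ, EP) ∞ a.sec a.dom :=
  a.contMDiffOn_inv.comp (contMDiffOn_id.prodMk contMDiffOn_const) fun _ hx => ⟨hx, trivial⟩

theorem Gauge.proj_sec (a : S.Gauge) {x : M} (hx : x ∈ a.dom) : S.proj (a.sec x) = x :=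
  a.proj_inv x hx 1

theorem Gauge.coord_sec (a : S.Gauge) {x : M} (hx : x ∈ a.dom) : a.coord (a.sec x) = 1 :=
  a.coord_inv x hx 1

/-- The two points have the same base point and the same fibre coordinate. -/
theorem Gauge.ract_sec (a : S.Gauge) {p : P} (hp : S.proj p ∈ a.dom) :
    S.ract (a.sec (S.proj p)) (a.coord p) = p := by
  have h1 : S.proj (S.ract (a.sec (S.proj p)) (a.coord p)) = S.proj p := by
    rw [proj_ract, a.proj_sec hp]
  have h2 : a.coord (S.ract (a.sec (S.proj p)) (a.coord p)) = a.coord p := by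
    rw [a.coord_ract _ (by rwa [a.proj_sec hp]), a.coord_sec hp, one_mul]
  rw [← a.inv_coord (S.ract (a.sec (S.proj p)) (a.coord p)) (by rwa [h1]), h1, h2,
    a.inv_coord p hp]

end EquivariantSpincStructure

end Gauges

/-! ### Topology and trivializations of `P_{M×N}` -/

section Quotient

variable {EG : Type*} [NormedAddCommGroup EG] [NormedSpace ℝ EG]
  {G : Type*} [Group G] [TopologicalSpace G] [ChartedSpace EG G]
  {E H M : Type*} [NormedAddCommGroup E] [NormedSpace ℝ E] [TopologicalSpace H]
  {I : ModelWithCorners ℝ E H} [TopologicalSpace M] [ChartedSpace H M] [IsManifold I ∞ M]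
  {E' H' N : Type*} [NormedAddCommGroup E'] [NormedSpace ℝ E'] [TopologicalSpace H']
  {J : ModelWithCorners ℝ E' H'} [TopologicalSpace N] [ChartedSpace H' N] [IsManifold J ∞ N]
  {EP P : Type*} [NormedAddCommGroup EP] [NormedSpace ℝ EP]
  [TopologicalSpace P] [ChartedSpace EP P]
  {EQ Q : Type*} [NormedAddCommGroup EQ] [NormedSpace ℝ EQ]
  [TopologicalSpace Q] [ChartedSpace EQ Q]
  {m n : ℕ}
  {BM : OrientedRiemannianAction I M EG G m} {BN : OrientedRiemannianAction J N EG G n}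
  {S : EquivariantSpincStructure BM EP P} {T : EquivariantSpincStructure BN EQ Q}

variable (S T) in
/-- The action of `Spin^c(m) × Spin^c(n)` on `P_M × P_N × Spin^c(m+n)`. -/
def torsorAct (z : P × Q × Spinc (m + n)) (a : Spinc m) (b : Spinc n) : P × Q × Spinc (m + n) :=
  (S.ract z.1 a, T.ract z.2.1 b, (spincMul a b)⁻¹ * z.2.2)

theorem prodMk_torsorAct (z : P × Q × Spinc (m + n)) (a : Spinc m) (b : Spinc n) :
    prodMk S T (torsorAct S T z a b) = prodMk S T z :=
  (Quot.sound ⟨a, b, rfl⟩).symm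

theorem torsorAct_mul (z : P × Q × Spinc (m + n)) (a a' : Spinc m) (b b' : Spinc n) :
    torsorAct S T z (a * a') (b * b') = torsorAct S T (torsorAct S T z a b) a' b' := by
  simp only [torsorAct, S.ract_mul, T.ract_mul, spincMul_mul, mul_inv_rev, mul_assoc]

theorem torsorAct_one (z : P × Q × Spinc (m + n)) : torsorAct S T z 1 1 = z := by
  simp only [torsorAct, S.ract_one, T.ract_one, spincMul_one, inv_one, one_mul]

/-- The relation comes from a group action, so it is already an equivalence relation and passing to
the generated one adds nothing. -/
theorem prodMk_eq_iff {z w : P × Q × Spinc (m + n)} :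
    prodMk S T z = prodMk S T w ↔ ∃ a b, w = torsorAct S T z a b := by
  constructor
  · intro h
    have h1 := Quot.eqvGen_exact h
    clear h
    induction h1 with
    | rel z w h => exact h
    | refl z => exact ⟨1, 1, (torsorAct_one z).symm⟩
    | symm z w h ih =>
      obtain ⟨a, b, rfl⟩ := ih
      exact ⟨a⁻¹, b⁻¹, by rw [← torsorAct_mul, mul_inv_cancel, mul_inv_cancel, torsorAct_one]⟩
    | trans u v w h h' ih ih' =>
      obtain ⟨a, b, rfl⟩ := ih
      obtain ⟨a', b', rfl⟩ := ih'
      exact ⟨a * a', b * b', by rw [torsorAct_mul]⟩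
  · rintro ⟨a, b, rfl⟩
    exact (prodMk_torsorAct z a b).symm

theorem isQuotientMap_prodMk : Topology.IsQuotientMap (prodMk S T) := isQuotientMap_quot_mk

theorem contMDiff_torsorAct : ContMDiff
    ((𝓘(ℝ, EP).prod (𝓘(ℝ, EQ).prod 𝓘(ℝ, spincLie (m + n)))).prod
      (𝓘(ℝ, spincLie m).prod 𝓘(ℝ, spincLie n)))
    (𝓘(ℝ, EP).prod (𝓘(ℝ, EQ).prod 𝓘(ℝ, spincLie (m + n)))) ∞
    (fun w : (P × Q × Spinc (m + n)) × Spinc m × Spinc n => torsorAct S T w.1 w.2.1 w.2.2) := by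
  have h1 : ContMDiff ((𝓘(ℝ, EP).prod (𝓘(ℝ, EQ).prod 𝓘(ℝ, spincLie (m + n)))).prod
      (𝓘(ℝ, spincLie m).prod 𝓘(ℝ, spincLie n))) 𝓘(ℝ, EP) ∞
      (fun w : (P × Q × Spinc (m + n)) × Spinc m × Spinc n => S.ract w.1.1 w.2.1) :=
    S.contMDiff_ract.comp ((contMDiff_fst.comp contMDiff_fst).prodMk
      (contMDiff_fst.comp contMDiff_snd))
  have h2 : ContMDiff ((𝓘(ℝ, EP).prod (𝓘(ℝ, EQ).prod 𝓘(ℝ, spincLie (m + n)))).prod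
      (𝓘(ℝ, spincLie m).prod 𝓘(ℝ, spincLie n))) 𝓘(ℝ, EQ) ∞
      (fun w : (P × Q × Spinc (m + n)) × Spinc m × Spinc n => T.ract w.1.2.1 w.2.2) :=
    T.contMDiff_ract.comp ((contMDiff_fst.comp (contMDiff_snd.comp contMDiff_fst)).prodMk
      (contMDiff_snd.comp contMDiff_snd))
  have h3 : ContMDiff ((𝓘(ℝ, EP).prod (𝓘(ℝ, EQ).prod 𝓘(ℝ, spincLie (m + n)))).prod
      (𝓘(ℝ, spincLie m).prod 𝓘(ℝ, spincLie n))) 𝓘(ℝ, spincLie (m + n)) ∞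
      (fun w : (P × Q × Spinc (m + n)) × Spinc m × Spinc n =>
        (spincMul w.2.1 w.2.2)⁻¹ * w.1.2.2) :=
    (contMDiff_spincMul.comp contMDiff_snd).inv.mul
      (contMDiff_snd.comp (contMDiff_snd.comp contMDiff_fst))
  exact h1.prodMk (h2.prodMk h3)

theorem continuous_torsorAct (a : Spinc m) (b : Spinc n) :
    Continuous fun z => torsorAct S T z a b :=
  (contMDiff_torsorAct (S := S) (T := T)).continuous.comp
    (by fun_prop : Continuous fun z : P × Q × Spinc (m + n) => (z, a, b))

/-- The saturation of an open set is a union of preimages of it under the homeomorphisms of the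
group action, hence open. -/
theorem isOpenMap_prodMk : IsOpenMap (prodMk S T) := by
  intro V hV
  rw [← isQuotientMap_prodMk.isOpen_preimage]
  have h : prodMk S T ⁻¹' (prodMk S T '' V) = ⋃ a, ⋃ b, (fun z => torsorAct S T z a b) ⁻¹' V := by
    ext z
    simp only [Set.mem_preimage, Set.mem_image, Set.mem_iUnion]
    constructor
    · rintro ⟨w, hw, h⟩
      obtain ⟨a, b, rfl⟩ := prodMk_eq_iff.mp h.symm
      exact ⟨a, b, hw⟩
    · rintro ⟨a, b, h⟩
      exact ⟨_, h, prodMk_torsorAct z a b⟩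
  rw [h]
  exact isOpen_iUnion fun a => isOpen_iUnion fun b => hV.preimage (continuous_torsorAct a b)

theorem secondCountableTopology_prodBundle [SecondCountableTopology P]
    [SecondCountableTopology Q] : SecondCountableTopology (ProdBundle S T) :=
  isQuotientMap_prodMk.secondCountableTopology isOpenMap_prodMk

variable (S T) in
/-- The projection of the product bundle to the base. -/
def prodProj : ProdBundle S T → M × N :=
  Quot.lift (fun z => (S.proj z.1, T.proj z.2.1)) (by
    rintro z _ ⟨a, b, rfl⟩
    simp only [S.proj_ract, T.proj_ract])

theorem continuous_prodProj : Continuous (prodProj S T) :=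
  isQuotientMap_prodMk.continuous_iff.mpr
    ((S.contMDiff_proj.continuous.comp continuous_fst).prodMk
      (T.contMDiff_proj.continuous.comp (continuous_fst.comp continuous_snd)))

variable (a : S.Gauge) (b : T.Gauge)

/-- The trivialization of the pullback of the product bundle to `P_M × P_N × Spin^c(m+n)`. -/
def gaugeMap (z : P × Q × Spinc (m + n)) : (M × N) × Spinc (m + n) :=
  ((S.proj z.1, T.proj z.2.1), spincMul (a.coord z.1) (b.coord z.2.1) * z.2.2)

/-- The domain of a trivialization. -/
def gaugeDom : Set (P × Q × Spinc (m + n)) := {z | S.proj z.1 ∈ a.dom ∧ T.proj z.2.1 ∈ b.dom}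

/-- The local section of the projection to the product bundle. -/
def gaugeSec (w : (M × N) × Spinc (m + n)) : P × Q × Spinc (m + n) :=
  (a.sec w.1.1, b.sec w.1.2, w.2)

theorem isOpen_gaugeDom : IsOpen (gaugeDom a b) :=
  (a.isOpen_dom.preimage (S.contMDiff_proj.continuous.comp continuous_fst)).inter
    (b.isOpen_dom.preimage (T.contMDiff_proj.continuous.comp
      (continuous_fst.comp continuous_snd)))

theorem contMDiffOn_gaugeMap :
    ContMDiffOn (𝓘(ℝ, EP).prod (𝓘(ℝ, EQ).prod 𝓘(ℝ, spincLie (m + n))))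
      ((I.prod J).prod 𝓘(ℝ, spincLie (m + n))) ∞ (gaugeMap a b) (gaugeDom a b) := by
  have hq : ContMDiff (𝓘(ℝ, EP).prod (𝓘(ℝ, EQ).prod 𝓘(ℝ, spincLie (m + n)))) 𝓘(ℝ, EQ) ∞
      (fun z : P × Q × Spinc (m + n) => z.2.1) := contMDiff_fst.comp contMDiff_snd
  have hh : ContMDiff (𝓘(ℝ, EP).prod (𝓘(ℝ, EQ).prod 𝓘(ℝ, spincLie (m + n))))
      𝓘(ℝ, spincLie (m + n)) ∞
      (fun z : P × Q × Spinc (m + n) => z.2.2) := contMDiff_snd.comp contMDiff_snd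
  have h1 := a.contMDiffOn_coord.comp (contMDiff_fst (I := 𝓘(ℝ, EP))
    (J := 𝓘(ℝ, EQ).prod 𝓘(ℝ, spincLie (m + n)))).contMDiffOn
      (fun z (hz : z ∈ gaugeDom a b) => hz.1)
  have h2 := b.contMDiffOn_coord.comp hq.contMDiffOn (fun z (hz : z ∈ gaugeDom a b) => hz.2)
  have h3 := (contMDiff_spincMul (m := m) (n := n)).comp_contMDiffOn (h1.prodMk h2)
  exact ((S.contMDiff_proj.comp contMDiff_fst).contMDiffOn.prodMk
    (T.contMDiff_proj.comp hq).contMDiffOn).prodMk (h3.mul hh.contMDiffOn)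

theorem contMDiffOn_gaugeSec :
    ContMDiffOn ((I.prod J).prod 𝓘(ℝ, spincLie (m + n)))
      (𝓘(ℝ, EP).prod (𝓘(ℝ, EQ).prod 𝓘(ℝ, spincLie (m + n)))) ∞ (gaugeSec a b)
      ((a.dom ×ˢ b.dom) ×ˢ Set.univ) := by
  have h1 : ContMDiff ((I.prod J).prod 𝓘(ℝ, spincLie (m + n))) I ∞
      (fun w : (M × N) × Spinc (m + n) => w.1.1) := contMDiff_fst.comp contMDiff_fst
  have h2 : ContMDiff ((I.prod J).prod 𝓘(ℝ, spincLie (m + n))) J ∞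
      (fun w : (M × N) × Spinc (m + n) => w.1.2) := contMDiff_snd.comp contMDiff_fst
  exact (a.contMDiffOn_sec.comp h1.contMDiffOn fun w hw => hw.1.1).prodMk
    ((b.contMDiffOn_sec.comp h2.contMDiffOn fun w hw => hw.1.2).prodMk contMDiffOn_snd)

theorem gaugeSec_mem {w : (M × N) × Spinc (m + n)} (hw : w.1 ∈ a.dom ×ˢ b.dom) :
    gaugeSec a b w ∈ gaugeDom a b := by
  refine ⟨?_, ?_⟩
  · change S.proj (a.sec w.1.1) ∈ _
    rw [a.proj_sec hw.1]
    exact hw.1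
  · change T.proj (b.sec w.1.2) ∈ _
    rw [b.proj_sec hw.2]
    exact hw.2

theorem gaugeMap_gaugeSec {w : (M × N) × Spinc (m + n)} (hw : w.1 ∈ a.dom ×ˢ b.dom) :
    gaugeMap a b (gaugeSec a b w) = w := by
  simp only [gaugeMap, gaugeSec, a.proj_sec hw.1, b.proj_sec hw.2, a.coord_sec hw.1,
    b.coord_sec hw.2, spincMul_one, one_mul]

/-- A point `p` is the section over its base point moved by its fibre coordinate, and likewise for
`q`. In the third component, the inverse in the action removes the factor that `gaugeMap` has put
there. -/
theorem torsorAct_gaugeSec {z : P × Q × Spinc (m + n)} (hz : z ∈ gaugeDom a b) :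
    torsorAct S T (gaugeSec a b (gaugeMap a b z)) (a.coord z.1) (b.coord z.2.1) = z := by
  simp only [torsorAct, gaugeMap, gaugeSec, a.ract_sec hz.1, b.ract_sec hz.2,
    inv_mul_cancel_left]

theorem prodMk_gaugeSec {z : P × Q × Spinc (m + n)} (hz : z ∈ gaugeDom a b) :
    prodMk S T (gaugeSec a b (gaugeMap a b z)) = prodMk S T z := by
  conv_rhs => rw [← torsorAct_gaugeSec a b hz]
  exact (prodMk_torsorAct _ _ _).symm

open Classical in
/-- The trivialization as a map of the product bundle, extended by a constant outside its
domain. -/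
def trivFun : ProdBundle S T → (M × N) × Spinc (m + n) :=
  Quot.lift (fun z => if z ∈ gaugeDom a b then gaugeMap a b z else
      ((S.proj z.1, T.proj z.2.1), 1)) (by
    rintro z _ ⟨x, y, rfl⟩
    -- The domain is a condition on the base points only, so it is saturated. Inside it the
    -- coordinates of `p` and `q` gain the factors `x` and `y`, and these cancel against the inverse
    -- in the third component.
    have h1 : (S.ract z.1 x, T.ract z.2.1 y, (spincMul x y)⁻¹ * z.2.2) ∈ gaugeDom a b ↔
        z ∈ gaugeDom a b := by
      simp only [gaugeDom, Set.mem_ofPred_eq, S.proj_ract, T.proj_ract]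
    simp only [h1]
    split_ifs with h
    · simp only [gaugeMap, S.proj_ract, T.proj_ract, a.coord_ract _ h.1, b.coord_ract _ h.2,
        spincMul_mul]
      rw [mul_assoc, mul_inv_cancel_left]
    · simp only [S.proj_ract, T.proj_ract])

theorem trivFun_prodMk {z : P × Q × Spinc (m + n)} (hz : z ∈ gaugeDom a b) :
    trivFun a b (prodMk S T z) = gaugeMap a b z :=
  if_pos hz

/-- The trivialization of the product bundle given by two gauges. -/
def prodTriv : OpenPartialHomeomorph (ProdBundle S T) ((M × N) × Spinc (m + n)) where
  toFun := trivFun a b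
  invFun w := prodMk S T (gaugeSec a b w)
  source := prodProj S T ⁻¹' (a.dom ×ˢ b.dom)
  target := (a.dom ×ˢ b.dom) ×ˢ Set.univ
  map_source' := by
    rintro ⟨z⟩ hz
    have hz' : z ∈ gaugeDom a b := hz
    change trivFun a b (prodMk S T z) ∈ _
    rw [trivFun_prodMk a b hz']
    exact ⟨hz, trivial⟩
  map_target' w hw := gaugeSec_mem a b hw.1
  left_inv' := by
    rintro ⟨z⟩ hz
    have hz' : z ∈ gaugeDom a b := hz
    change prodMk S T (gaugeSec a b (trivFun a b (prodMk S T z))) = prodMk S T z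
    rw [trivFun_prodMk a b hz', prodMk_gaugeSec a b hz']
  right_inv' w hw := by
    rw [trivFun_prodMk a b (gaugeSec_mem a b hw.1), gaugeMap_gaugeSec a b hw.1]
  open_source := (a.isOpen_dom.prod b.isOpen_dom).preimage continuous_prodProj
  open_target := (a.isOpen_dom.prod b.isOpen_dom).prod isOpen_univ
  continuousOn_toFun := by
    -- Continuity on an open subset of the quotient may be tested on its preimage upstairs, where
    -- the map is `gaugeMap`.
    rw [isQuotientMap_prodMk.continuousOn_isOpen_iff
      ((a.isOpen_dom.prod b.isOpen_dom).preimage continuous_prodProj)]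
    exact (contMDiffOn_gaugeMap a b).continuousOn.congr fun z hz => trivFun_prodMk a b hz
  continuousOn_invFun := isQuotientMap_prodMk.continuous.comp_continuousOn
    (contMDiffOn_gaugeSec a b).continuousOn

theorem prodTriv_prodMk {z : P × Q × Spinc (m + n)} (hz : z ∈ gaugeDom a b) :
    prodTriv a b (prodMk S T z) = gaugeMap a b z :=
  trivFun_prodMk a b hz

theorem exists_mem_prodTriv_source (r : ProdBundle S T) :
    ∃ ab : S.Gauge × T.Gauge, r ∈ (prodTriv ab.1 ab.2).source := by
  obtain ⟨a, ha⟩ := S.exists_gauge (prodProj S T r).1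
  obtain ⟨b, hb⟩ := T.exists_gauge (prodProj S T r).2
  exact ⟨(a, b), ha, hb⟩

/-- Points over different base points are separated in `M × N`; points over the same base point lie
in a common trivialization, with values in a Hausdorff space. -/
theorem t2Space_prodBundle [T2Space M] [T2Space N] : T2Space (ProdBundle S T) := by
  refine ⟨fun r r' hr => ?_⟩
  by_cases h : prodProj S T r = prodProj S T r'
  · obtain ⟨⟨a, b⟩, hab⟩ := exists_mem_prodTriv_source r
    have hab' : r' ∈ (prodTriv a b).source := by
      change prodProj S T r' ∈ a.dom ×ˢ b.dom
      rw [← h]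
      exact hab
    obtain ⟨u, v, hu, hv, hru, hrv, huv⟩ :=
      t2_separation fun h' => hr ((prodTriv a b).injOn hab hab' h')
    exact ⟨_, _, (prodTriv a b).isOpen_inter_preimage hu, (prodTriv a b).isOpen_inter_preimage hv,
      ⟨hab, hru⟩, ⟨hab', hrv⟩, Set.disjoint_left.mpr fun x hx hx' =>
        Set.disjoint_left.mp huv hx.2 hx'.2⟩
  · obtain ⟨u, v, hu, hv, hru, hrv, huv⟩ := t2_separation h
    exact ⟨_, _, hu.preimage continuous_prodProj, hv.preimage continuous_prodProj, hru, hrv,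
      huv.preimage _⟩

/-- A transition map is the section of the first pair of gauges followed by `gaugeMap` of the
second. Both are smooth maps that do not involve the quotient. -/
theorem contMDiffOn_prodTriv_trans (ab cd : S.Gauge × T.Gauge) :
    ContMDiffOn ((I.prod J).prod 𝓘(ℝ, spincLie (m + n)))
      ((I.prod J).prod 𝓘(ℝ, spincLie (m + n))) ∞
      (prodTriv cd.1 cd.2 ∘ (prodTriv ab.1 ab.2).symm)
      ((prodTriv ab.1 ab.2).symm.trans (prodTriv cd.1 cd.2)).source := by
  refine ((contMDiffOn_gaugeMap cd.1 cd.2).comp ((contMDiffOn_gaugeSec ab.1 ab.2).mono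
    fun w hw => ?_) fun w hw => ?_).congr fun w hw => ?_
  all_goals rw [OpenPartialHomeomorph.trans_source] at hw
  · exact hw.1
  · exact hw.2
  · exact prodTriv_prodMk cd.1 cd.2 hw.2

end Quotient

end

noncomputable section

/-! ### The smooth structure of `P_{M×N}` and the submersion onto it -/

section QuotientManifold

variable {EG : Type*} [NormedAddCommGroup EG] [NormedSpace ℝ EG]
  {G : Type*} [Group G] [TopologicalSpace G] [ChartedSpace EG G]
  {E H M : Type*} [NormedAddCommGroup E] [NormedSpace ℝ E] [TopologicalSpace H]
  {I : ModelWithCorners ℝ E H} [TopologicalSpace M] [ChartedSpace H M] [IsManifold I ∞ M]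
  {E' H' N : Type*} [NormedAddCommGroup E'] [NormedSpace ℝ E'] [TopologicalSpace H']
  {J : ModelWithCorners ℝ E' H'} [TopologicalSpace N] [ChartedSpace H' N] [IsManifold J ∞ N]
  {EP P : Type*} [NormedAddCommGroup EP] [NormedSpace ℝ EP]
  [TopologicalSpace P] [ChartedSpace EP P]
  {EQ Q : Type*} [NormedAddCommGroup EQ] [NormedSpace ℝ EQ]
  [TopologicalSpace Q] [ChartedSpace EQ Q]
  {m n : ℕ}
  {BM : OrientedRiemannianAction I M EG G m} {BN : OrientedRiemannianAction J N EG G n}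
  {S : EquivariantSpincStructure BM EP P} {T : EquivariantSpincStructure BN EQ Q}
  [I.Boundaryless] [J.Boundaryless]

instance : ChartedSpace ((E × E') × spincLie (m + n)) (ProdBundle S T) :=
  chartedSpaceOfCover ((I.prod J).prod 𝓘(ℝ, spincLie (m + n)))
    (fun ab : S.Gauge × T.Gauge => prodTriv ab.1 ab.2) exists_mem_prodTriv_source

instance : IsManifold 𝓘(ℝ, (E × E') × spincLie (m + n)) ∞ (ProdBundle S T) :=
  isManifold_chartedSpaceOfCover contMDiffOn_prodTriv_trans

theorem contMDiffOn_prodTriv (a : S.Gauge) (b : T.Gauge) :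
    ContMDiffOn 𝓘(ℝ, (E × E') × spincLie (m + n)) ((I.prod J).prod 𝓘(ℝ, spincLie (m + n))) ∞
      (prodTriv a b) (prodTriv a b).source :=
  contMDiffOn_cover (e := fun ab : S.Gauge × T.Gauge => prodTriv ab.1 ab.2)
    contMDiffOn_prodTriv_trans (a, b)

theorem contMDiffOn_prodTriv_symm (a : S.Gauge) (b : T.Gauge) :
    ContMDiffOn ((I.prod J).prod 𝓘(ℝ, spincLie (m + n))) 𝓘(ℝ, (E × E') × spincLie (m + n)) ∞
      (prodTriv a b).symm (prodTriv a b).target :=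
  contMDiffOn_cover_symm (e := fun ab : S.Gauge × T.Gauge => prodTriv ab.1 ab.2)
    contMDiffOn_prodTriv_trans (a, b)

/-- Locally the quotient map is `gaugeMap` followed by an inverse trivialization. -/
theorem contMDiff_prodMk :
    ContMDiff (𝓘(ℝ, EP).prod (𝓘(ℝ, EQ).prod 𝓘(ℝ, spincLie (m + n))))
      𝓘(ℝ, (E × E') × spincLie (m + n)) ∞ (prodMk S T) := by
  intro z
  obtain ⟨⟨a, b⟩, hab⟩ := exists_mem_prodTriv_source (prodMk S T z)
  have h1 := (contMDiffOn_prodTriv_symm a b).comp (contMDiffOn_gaugeMap a b) fun w hw =>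
    ⟨hw, trivial⟩
  refine (h1.contMDiffAt ((isOpen_gaugeDom a b).mem_nhds hab)).congr_of_eventuallyEq ?_
  filter_upwards [(isOpen_gaugeDom a b).mem_nhds hab] with w hw
  exact (prodMk_gaugeSec a b hw).symm

/-- The local section of the projection to the product bundle that is given by two gauges. -/
def prodSec (a : S.Gauge) (b : T.Gauge) (r : ProdBundle S T) : P × Q × Spinc (m + n) :=
  gaugeSec a b (prodTriv a b r)

theorem contMDiffOn_prodSec (a : S.Gauge) (b : T.Gauge) :
    ContMDiffOn 𝓘(ℝ, (E × E') × spincLie (m + n))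
      (𝓘(ℝ, EP).prod (𝓘(ℝ, EQ).prod 𝓘(ℝ, spincLie (m + n)))) ∞ (prodSec a b)
      (prodTriv a b).source :=
  (contMDiffOn_gaugeSec a b).comp (contMDiffOn_prodTriv a b) fun _ hr =>
    (prodTriv a b).map_source hr

theorem prodMk_prodSec {a : S.Gauge} {b : T.Gauge} {r : ProdBundle S T}
    (hr : r ∈ (prodTriv a b).source) : prodMk S T (prodSec a b r) = r :=
  (prodTriv a b).left_inv hr

theorem torsorAct_prodSec {a : S.Gauge} {b : T.Gauge} {z : P × Q × Spinc (m + n)}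
    (hz : z ∈ gaugeDom a b) :
    torsorAct S T (prodSec a b (prodMk S T z)) (a.coord z.1) (b.coord z.2.1) = z := by
  rw [prodSec, prodTriv_prodMk a b hz, torsorAct_gaugeSec a b hz]

/-- Through each point of `P_M × P_N × Spin^c(m+n)` there is a smooth local section. -/
theorem exists_section (z : P × Q × Spinc (m + n)) :
    ∃ s : ProdBundle S T → P × Q × Spinc (m + n), s (prodMk S T z) = z ∧
      ∃ U : Set (ProdBundle S T), IsOpen U ∧ prodMk S T z ∈ U ∧
      ContMDiffOn 𝓘(ℝ, (E × E') × spincLie (m + n))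
        (𝓘(ℝ, EP).prod (𝓘(ℝ, EQ).prod 𝓘(ℝ, spincLie (m + n)))) ∞ s U ∧
      ∀ r ∈ U, prodMk S T (s r) = r := by
  obtain ⟨⟨a, b⟩, hab⟩ := exists_mem_prodTriv_source (prodMk S T z)
  -- The section of the gauges meets the orbit of `z`, though perhaps not at `z`. Translating it by
  -- a constant group element makes it pass through `z`.
  refine ⟨fun r => torsorAct S T (prodSec a b r) (a.coord z.1) (b.coord z.2.1),
    torsorAct_prodSec hab, (prodTriv a b).source, (prodTriv a b).open_source, hab, ?_,
    fun r hr => ?_⟩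
  · exact (contMDiff_torsorAct (S := S) (T := T)).comp_contMDiffOn
      ((contMDiffOn_prodSec a b).prodMk (contMDiffOn_const (c := (a.coord z.1, b.coord z.2.1))))
  · rw [prodMk_torsorAct, prodMk_prodSec hr]

/-- The derivative of a local section through `z` is a right inverse of the derivative of the
quotient map. -/
theorem surjective_mfderiv_prodMk (z : P × Q × Spinc (m + n)) :
    Function.Surjective (mfderiv (𝓘(ℝ, EP).prod (𝓘(ℝ, EQ).prod 𝓘(ℝ, spincLie (m + n))))
      𝓘(ℝ, (E × E') × spincLie (m + n)) (prodMk S T) z) := by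
  obtain ⟨s, hs, U, hU, hzU, hsU, hq⟩ := exists_section (S := S) (T := T) z
  have h1 : MDifferentiableAt 𝓘(ℝ, (E × E') × spincLie (m + n))
      (𝓘(ℝ, EP).prod (𝓘(ℝ, EQ).prod 𝓘(ℝ, spincLie (m + n)))) s (prodMk S T z) :=
    (hsU.contMDiffAt (hU.mem_nhds hzU)).mdifferentiableAt (by simp)
  have h2 : HasMFDerivAt (𝓘(ℝ, EP).prod (𝓘(ℝ, EQ).prod 𝓘(ℝ, spincLie (m + n))))
      𝓘(ℝ, (E × E') × spincLie (m + n)) (prodMk S T) (s (prodMk S T z))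
      (mfderiv (𝓘(ℝ, EP).prod (𝓘(ℝ, EQ).prod 𝓘(ℝ, spincLie (m + n))))
        𝓘(ℝ, (E × E') × spincLie (m + n)) (prodMk S T) z) := by
    rw [hs]
    exact (contMDiff_prodMk.mdifferentiable (by simp) z).hasMFDerivAt
  have h3 := (h2.comp _ h1.hasMFDerivAt).congr_of_eventuallyEq (f₁ := id) (by
    filter_upwards [hU.mem_nhds hzU] with r hr
    exact (hq r hr).symm)
  have h4 := hasMFDerivAt_unique h3 (hasMFDerivAt_id (prodMk S T z))
  intro v
  refine ⟨mfderiv 𝓘(ℝ, (E × E') × spincLie (m + n))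
      (𝓘(ℝ, EP).prod (𝓘(ℝ, EQ).prod 𝓘(ℝ, spincLie (m + n)))) s (prodMk S T z) v, ?_⟩
  exact congrArg (fun L : (E × E') × spincLie (m + n) →L[ℝ] (E × E') × spincLie (m + n) => L v) h4

variable {EX HX X : Type*} [NormedAddCommGroup EX] [NormedSpace ℝ EX] [TopologicalSpace HX]
  {IX : ModelWithCorners ℝ EX HX} [TopologicalSpace X] [ChartedSpace HX X]
  {EY HY Y : Type*} [NormedAddCommGroup EY] [NormedSpace ℝ EY] [TopologicalSpace HY]
  {IY : ModelWithCorners ℝ EY HY} [TopologicalSpace Y] [ChartedSpace HY Y]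

/-- Locally `f` is the composite of its lift with a smooth section of the quotient map. -/
theorem contMDiff_of_comp_prodMk {f : ProdBundle S T → X}
    (hf : ContMDiff (𝓘(ℝ, EP).prod (𝓘(ℝ, EQ).prod 𝓘(ℝ, spincLie (m + n)))) IX ∞
      (fun z => f (prodMk S T z))) :
    ContMDiff 𝓘(ℝ, (E × E') × spincLie (m + n)) IX ∞ f := by
  intro r
  obtain ⟨⟨a, b⟩, hab⟩ := exists_mem_prodTriv_source r
  have h1 := (hf.comp_contMDiffOn (contMDiffOn_prodSec a b)).contMDiffAt
    ((prodTriv a b).open_source.mem_nhds hab)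
  refine h1.congr_of_eventuallyEq ?_
  filter_upwards [(prodTriv a b).open_source.mem_nhds hab] with r' hr'
  exact congrArg f (prodMk_prodSec hr').symm

/-- The descent of smoothness with a parameter, as needed for the two group actions on the quotient.
-/
theorem contMDiff_uncurry_of_comp_prodMk {f : Y → ProdBundle S T → X}
    (hf : ContMDiff (IY.prod (𝓘(ℝ, EP).prod (𝓘(ℝ, EQ).prod 𝓘(ℝ, spincLie (m + n))))) IX ∞
      (fun z : Y × P × Q × Spinc (m + n) => f z.1 (prodMk S T z.2))) :
    ContMDiff (IY.prod 𝓘(ℝ, (E × E') × spincLie (m + n))) IX ∞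
      (fun z : Y × ProdBundle S T => f z.1 z.2) := by
  rintro ⟨y, r⟩
  obtain ⟨⟨a, b⟩, hab⟩ := exists_mem_prodTriv_source r
  have h0 : IsOpen ((Set.univ : Set Y) ×ˢ (prodTriv a b).source) :=
    isOpen_univ.prod (prodTriv a b).open_source
  have h2 : ContMDiffOn (IY.prod 𝓘(ℝ, (E × E') × spincLie (m + n)))
      (𝓘(ℝ, EP).prod (𝓘(ℝ, EQ).prod 𝓘(ℝ, spincLie (m + n)))) ∞
      (fun z : Y × ProdBundle S T => prodSec a b z.2) (Set.univ ×ˢ (prodTriv a b).source) :=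
    (contMDiffOn_prodSec a b).comp contMDiffOn_snd fun z hz => hz.2
  have h1 := (hf.comp_contMDiffOn (contMDiffOn_fst.prodMk h2)).contMDiffAt
    (h0.mem_nhds (x := (y, r)) ⟨trivial, hab⟩)
  refine h1.congr_of_eventuallyEq ?_
  filter_upwards [h0.mem_nhds (x := (y, r)) ⟨trivial, hab⟩] with z hz
  exact congrArg (f z.1) (prodMk_prodSec hz.2).symm

end QuotientManifold

end

/-! ### Frames of the product -/

noncomputable section

/-- The projection `ℝ^(m+n) → ℝ^m` as a linear map. -/
def fstLin (m n : ℕ) : Vec (m + n) →ₗ[ℝ] Vec m where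
  toFun := fstVec
  map_add' _ _ := rfl
  map_smul' _ _ := rfl

/-- The projection `ℝ^(m+n) → ℝ^n` as a linear map. -/
def sndLin (m n : ℕ) : Vec (m + n) →ₗ[ℝ] Vec n where
  toFun := sndVec
  map_add' _ _ := rfl
  map_smul' _ _ := rfl

theorem fstVec_single_castAdd {m n : ℕ} (i : Fin m) :
    fstVec (EuclideanSpace.single (Fin.castAdd n i) (1 : ℝ)) = EuclideanSpace.single i 1 := by
  ext j
  simp [fstVec]

theorem sndVec_single_castAdd {m n : ℕ} (i : Fin m) :
    sndVec (EuclideanSpace.single (Fin.castAdd n i) (1 : ℝ)) = 0 := by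
  ext j
  have h : Fin.natAdd m j ≠ Fin.castAdd n i := fun h => by
    have := congrArg Fin.val h
    simp at this
    omega
  simp [sndVec, h]

theorem fstVec_single_natAdd {m n : ℕ} (i : Fin n) :
    fstVec (EuclideanSpace.single (Fin.natAdd m i) (1 : ℝ)) = 0 := by
  ext j
  have h : Fin.castAdd n j ≠ Fin.natAdd m i := fun h => by
    have := congrArg Fin.val h
    simp at this
    omega
  simp [fstVec, h]

theorem sndVec_single_natAdd {m n : ℕ} (i : Fin n) :
    sndVec (EuclideanSpace.single (Fin.natAdd m i) (1 : ℝ)) = EuclideanSpace.single i 1 := by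
  ext j
  simp [sndVec]

section SmoothFrames

variable {EG : Type*} [NormedAddCommGroup EG] [NormedSpace ℝ EG]
  {G : Type*} [Group G] [TopologicalSpace G] [ChartedSpace EG G]
  {E H M : Type*} [NormedAddCommGroup E] [NormedSpace ℝ E] [TopologicalSpace H]
  {I : ModelWithCorners ℝ E H} [TopologicalSpace M] [ChartedSpace H M] [IsManifold I ∞ M]
  {EP P : Type*} [NormedAddCommGroup EP] [NormedSpace ℝ EP]
  [TopologicalSpace P] [ChartedSpace EP P]
  {k : ℕ} {B : OrientedRiemannianAction I M EG G k} (S : EquivariantSpincStructure B EP P)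
  {EX HX X : Type*} [NormedAddCommGroup EX] [NormedSpace ℝ EX] [TopologicalSpace HX]
  {IX : ModelWithCorners ℝ EX HX} [TopologicalSpace X] [ChartedSpace HX X]

/-- Smoothness of the map to frames is given only for the evaluation at fixed vectors. Frames are
linear, so in a trivialization a variable `w` is handled by expanding it in the standard basis. -/
theorem EquivariantSpincStructure.contMDiff_toSOF_apply {f : X → P} {w : X → Vec k}
    (hf : ContMDiff IX 𝓘(ℝ, EP) ∞ f) (hw : ContMDiff IX 𝓘(ℝ, Vec k) ∞ w) :
    ContMDiff IX I.tangent ∞ fun x => (S.toSOF (f x)).apply (w x) := by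
  intro x₀
  rw [Bundle.contMDiffAt_totalSpace]
  refine ⟨(S.contMDiff_proj.comp hf) x₀, ?_⟩
  let t := trivializationAt E (TangentSpace I : M → Type _) (S.proj (f x₀))
  have h1 : ∀ i, ContMDiffAt IX 𝓘(ℝ, E) ∞ (fun x =>
      (t ((S.toSOF (f x)).apply (EuclideanSpace.single i 1))).2) x₀ := fun i =>
    (Bundle.contMDiffAt_totalSpace.mp (((S.contMDiff_toSOF (EuclideanSpace.single i 1)).comp hf)
      x₀)).2
  have h2 : ∀ i, ContMDiffAt IX 𝓘(ℝ, ℝ) ∞ (fun x => w x i) x₀ := fun i =>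
    (((EuclideanSpace.proj i : Vec k →L[ℝ] ℝ).contDiff).contMDiff.comp hw) x₀
  have h3 : ContMDiffAt IX 𝓘(ℝ, E) ∞ (fun x => ∑ i, w x i •
      (t ((S.toSOF (f x)).apply (EuclideanSpace.single i 1))).2) x₀ :=
    ContMDiffAt.sum fun i _ => (h2 i).smul (h1 i)
  refine h3.congr_of_eventuallyEq ?_
  have h4 : {x | S.proj (f x) ∈ t.baseSet} ∈ 𝓝 x₀ :=
    (S.contMDiff_proj.comp hf).continuous.continuousAt.preimage_mem_nhds
      (t.open_baseSet.mem_nhds (FiberBundle.mem_baseSet_trivializationAt' _))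
  filter_upwards [h4] with x hx
  have h5 : ∀ v : Vec k, (t ((S.toSOF (f x)).apply v)).2 =
      t.linearMapAt ℝ (S.proj (f x)) ((S.toSOF (f x)).frame v) := fun v => by
    rw [t.coe_linearMapAt_of_mem (R := ℝ) hx]
    rfl
  change (t ((S.toSOF (f x)).apply (w x))).2 = _
  simp only [h5]
  have h6 : w x = ∑ i, w x i • EuclideanSpace.single i (1 : ℝ) := by
    ext j
    simp [Finset.sum_apply, Pi.single_apply]
  conv_lhs => rw [h6]
  have h7 := map_sum ((t.linearMapAt ℝ (S.proj (f x))).comp (S.toSOF (f x)).frame)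
    (fun i => w x i • EuclideanSpace.single i (1 : ℝ)) Finset.univ
  exact h7.trans (Finset.sum_congr rfl fun i _ => map_smul _ _ _)

end SmoothFrames

section ProductFrames

variable {EG : Type*} [NormedAddCommGroup EG] [NormedSpace ℝ EG]
  {G : Type*} [Group G] [TopologicalSpace G] [ChartedSpace EG G]
  {E H M : Type*} [NormedAddCommGroup E] [NormedSpace ℝ E] [TopologicalSpace H]
  {I : ModelWithCorners ℝ E H} [TopologicalSpace M] [ChartedSpace H M] [IsManifold I ∞ M]
  {E' H' N : Type*} [NormedAddCommGroup E'] [NormedSpace ℝ E'] [TopologicalSpace H']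
  {J : ModelWithCorners ℝ E' H'} [TopologicalSpace N] [ChartedSpace H' N] [IsManifold J ∞ N]
  {EP P : Type*} [NormedAddCommGroup EP] [NormedSpace ℝ EP]
  [TopologicalSpace P] [ChartedSpace EP P]
  {EQ Q : Type*} [NormedAddCommGroup EQ] [NormedSpace ℝ EQ]
  [TopologicalSpace Q] [ChartedSpace EQ Q]
  {m n : ℕ}
  {BM : OrientedRiemannianAction I M EG G m} {BN : OrientedRiemannianAction J N EG G n}
  {S : EquivariantSpincStructure BM EP P} {T : EquivariantSpincStructure BN EQ Q}
  [I.Boundaryless] [J.Boundaryless] {ε : G →* G} {hε : ContMDiff 𝓘(ℝ, EG) 𝓘(ℝ, EG) ∞ ε}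

/-- The rotation by `h` has determinant 1, so it keeps the standard basis positive, and `F ⊕ F'`
takes the standard basis to the concatenation of two positive bases. -/
theorem isPositive_prod_frame {x : M} {y : N} (F : Vec m →ₗ[ℝ] TangentSpace I x)
    (F' : Vec n →ₗ[ℝ] TangentSpace J y)
    (hF : IsPositive (BM.orientation x) fun i => F (EuclideanSpace.single i 1))
    (hF' : IsPositive (BN.orientation y) fun i => F' (EuclideanSpace.single i 1))
    (h : Spinc (m + n)) :
    IsPositive ((BM.prod BN ε hε).orientation (x, y)) fun i =>
      ((F ∘ₗ fstLin m n).prod (F' ∘ₗ sndLin m n)) (rotLin h (EuclideanSpace.single i 1)) := by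
  have h0 : IsPositive (EuclideanSpace.basisFun (Fin (m + n)) ℝ).toBasis.orientation
      fun i => EuclideanSpace.single i (1 : ℝ) := ⟨_, by ext1 i; simp, rfl⟩
  refine IsPositive.map (W := TangentSpace I x × TangentSpace J y) _ h0 ?_
    (h0.of_det_pos (rotLin h) (by rw [det_rotLin]; exact one_pos))
  have h1 := IsPositive.append (BM.exists_isPositive x) (BN.exists_isPositive y) hF hF'
  refine Eq.mpr (congrArg (IsPositive _) (funext fun i => ?_)) h1
  refine Fin.addCases (fun i => ?_) (fun i => ?_) i
  · rw [Fin.append_left]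
    exact Prod.ext (congrArg F (fstVec_single_castAdd i))
      ((congrArg F' (sndVec_single_castAdd i)).trans (map_zero _))
  · rw [Fin.append_right]
    exact Prod.ext ((congrArg F (fstVec_single_natAdd i)).trans (map_zero _))
      (congrArg F' (sndVec_single_natAdd i))

variable (S T hε) in
/-- The frame of the product that is given by two points and a rotation. -/
def prodFrame (z : P × Q × Spinc (m + n)) : SOF (BM.prod BN ε hε) where
  base := (S.proj z.1, T.proj z.2.1)
  frame := (((S.toSOF z.1).frame ∘ₗ fstLin m n).prod ((T.toSOF z.2.1).frame ∘ₗ sndLin m n)) ∘ₗ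
    rotLin z.2.2
  isometry u v := by
    rw [← inner_rot z.2.2, ← inner_fstVec_add_inner_sndVec]
    exact congrArg₂ (· + ·) ((S.toSOF z.1).isometry _ _) ((T.toSOF z.2.1).isometry _ _)
  positive := isPositive_prod_frame _ _ (S.toSOF z.1).positive (T.toSOF z.2.1).positive z.2.2

theorem prodFrame_apply (z : P × Q × Spinc (m + n)) (v : Vec (m + n)) :
    (prodFrame S T hε z).apply v = (equivTangentBundleProd I M J N).symm
      ((S.toSOF z.1).apply (fstVec (rot z.2.2 v)), (T.toSOF z.2.1).apply (sndVec (rot z.2.2 v))) :=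
  rfl

/-- The factor `(ab)⁻¹` in the third component undoes the block rotation that the frames of `p` and
`q` have acquired. -/
theorem prodFrame_torsorAct (z : P × Q × Spinc (m + n)) (a : Spinc m) (b : Spinc n) :
    prodFrame S T hε (torsorAct S T z a b) = prodFrame S T hε z := by
  refine SOF.ext_apply fun v => ?_
  rw [prodFrame_apply, prodFrame_apply]
  simp only [torsorAct, S.toSOF_ract, T.toSOF_ract]
  rw [← fstVec_rot_spincMul a b, ← sndVec_rot_spincMul a b, ← rot_mul, mul_inv_cancel_left]

theorem contMDiff_prodFrame (v : Vec (m + n)) :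
    ContMDiff (𝓘(ℝ, EP).prod (𝓘(ℝ, EQ).prod 𝓘(ℝ, spincLie (m + n)))) (I.prod J).tangent ∞
      fun z => (prodFrame S T hε z).apply v := by
  have hp : ContMDiff (𝓘(ℝ, EP).prod (𝓘(ℝ, EQ).prod 𝓘(ℝ, spincLie (m + n)))) 𝓘(ℝ, EP) ∞
      (fun z : P × Q × Spinc (m + n) => z.1) := contMDiff_fst
  have hq : ContMDiff (𝓘(ℝ, EP).prod (𝓘(ℝ, EQ).prod 𝓘(ℝ, spincLie (m + n)))) 𝓘(ℝ, EQ) ∞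
      (fun z : P × Q × Spinc (m + n) => z.2.1) := contMDiff_fst.comp contMDiff_snd
  have hr : ContMDiff (𝓘(ℝ, EP).prod (𝓘(ℝ, EQ).prod 𝓘(ℝ, spincLie (m + n)))) 𝓘(ℝ, Vec (m + n)) ∞
      (fun z : P × Q × Spinc (m + n) => rot z.2.2 v) :=
    (contMDiff_rot v).comp (contMDiff_snd.comp contMDiff_snd)
  have h1 : ContDiff ℝ ∞ (fstVec : Vec (m + n) → Vec m) :=
    (LinearMap.toContinuousLinearMap (fstLin m n)).contDiff
  have h2 : ContDiff ℝ ∞ (sndVec : Vec (m + n) → Vec n) :=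
    (LinearMap.toContinuousLinearMap (sndLin m n)).contDiff
  have h3 : ContMDiff (I.tangent.prod J.tangent) (I.prod J).tangent ∞
    (equivTangentBundleProd I M J N).symm := contMDiff_equivTangentBundleProd_symm
  exact h3.comp ((S.contMDiff_toSOF_apply hp (h1.contMDiff.comp hr)).prodMk
    (T.contMDiff_toSOF_apply hq (h2.contMDiff.comp hr)))

end ProductFrames

/-! ### The equivariant spin^c structure on the product -/

section ProductStructure

variable {EG : Type*} [NormedAddCommGroup EG] [NormedSpace ℝ EG]
  {G : Type*} [Group G] [TopologicalSpace G] [ChartedSpace EG G]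
  {E H M : Type*} [NormedAddCommGroup E] [NormedSpace ℝ E] [TopologicalSpace H]
  {I : ModelWithCorners ℝ E H} [TopologicalSpace M] [ChartedSpace H M] [IsManifold I ∞ M]
  {E' H' N : Type*} [NormedAddCommGroup E'] [NormedSpace ℝ E'] [TopologicalSpace H']
  {J : ModelWithCorners ℝ E' H'} [TopologicalSpace N] [ChartedSpace H' N] [IsManifold J ∞ N]
  {EP P : Type*} [NormedAddCommGroup EP] [NormedSpace ℝ EP]
  [TopologicalSpace P] [ChartedSpace EP P]
  {EQ Q : Type*} [NormedAddCommGroup EQ] [NormedSpace ℝ EQ]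
  [TopologicalSpace Q] [ChartedSpace EQ Q]
  {m n : ℕ}
  {BM : OrientedRiemannianAction I M EG G m} {BN : OrientedRiemannianAction J N EG G n}
  (S : EquivariantSpincStructure BM EP P) (T : EquivariantSpincStructure BN EQ Q)
  [I.Boundaryless] [J.Boundaryless] (ε : G →* G) (hε : ContMDiff 𝓘(ℝ, EG) 𝓘(ℝ, EG) ∞ ε)

/-- The right action of `Spin^c(m+n)` on the product bundle. -/
def prodRact (r : ProdBundle S T) (x : Spinc (m + n)) : ProdBundle S T :=
  Quot.map (fun z => (z.1, z.2.1, z.2.2 * x)) (by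
    rintro z _ ⟨a, b, rfl⟩
    exact ⟨a, b, by rw [mul_assoc]⟩) r

/-- The map of the product bundle given by the actions of an element of the group. -/
def prodActFun (g : G) : ProdBundle S T → ProdBundle S T :=
  Quot.map (fun z => (S.act g z.1, T.act (ε g) z.2.1, z.2.2)) (by
    rintro z _ ⟨a, b, rfl⟩
    exact ⟨a, b, by simp only [S.act_ract, T.act_ract]⟩)

theorem prodActFun_mul (g h : G) (r : ProdBundle S T) :
    prodActFun S T ε (g * h) r = prodActFun S T ε g (prodActFun S T ε h r) := by
  obtain ⟨z⟩ := r
  refine congrArg (prodMk S T) ?_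
  simp

theorem prodActFun_one (r : ProdBundle S T) : prodActFun S T ε 1 r = r := by
  obtain ⟨z⟩ := r
  refine congrArg (prodMk S T) ?_
  simp

/-- The action of `G` on the product bundle. -/
def prodAct : G →* Equiv.Perm (ProdBundle S T) where
  toFun g := ⟨prodActFun S T ε g, prodActFun S T ε g⁻¹, fun r => by
    rw [← prodActFun_mul, inv_mul_cancel, prodActFun_one], fun r => by
    rw [← prodActFun_mul, mul_inv_cancel, prodActFun_one]⟩
  map_one' := Equiv.ext (prodActFun_one S T ε)
  map_mul' g h := Equiv.ext (prodActFun_mul S T ε g h)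

/-- The map of the product bundle to the bundle of frames. -/
def prodToSOF : ProdBundle S T → SOF (BM.prod BN ε hε) :=
  Quot.lift (prodFrame S T hε) (by
    rintro z _ ⟨a, b, rfl⟩
    exact (prodFrame_torsorAct z a b).symm)

theorem prodToSOF_base (r : ProdBundle S T) : (prodToSOF S T ε hε r).base = prodProj S T r := by
  obtain ⟨z⟩ := r
  rfl

/-- The spin^c structure of the product. -/
def prodSpinc : EquivariantSpincStructure (BM.prod BN ε hε) ((E × E') × spincLie (m + n))
    (ProdBundle S T) where
  ract := prodRact S T
  ract_one r := by
    obtain ⟨z⟩ := r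
    refine congrArg (prodMk S T) ?_
    simp
  ract_mul r x y := by
    obtain ⟨z⟩ := r
    refine congrArg (prodMk S T) ?_
    simp [mul_assoc]
  contMDiff_ract := by
    have h1 : ContMDiff ((𝓘(ℝ, spincLie (m + n))).prod
        (𝓘(ℝ, EP).prod (𝓘(ℝ, EQ).prod 𝓘(ℝ, spincLie (m + n)))))
        (𝓘(ℝ, EP).prod (𝓘(ℝ, EQ).prod 𝓘(ℝ, spincLie (m + n)))) ∞
        (fun w : Spinc (m + n) × P × Q × Spinc (m + n) =>
          (w.2.1, w.2.2.1, w.2.2.2 * w.1)) :=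
      (contMDiff_fst.comp contMDiff_snd).prodMk
        ((contMDiff_fst.comp (contMDiff_snd.comp contMDiff_snd)).prodMk
          ((contMDiff_snd.comp (contMDiff_snd.comp contMDiff_snd)).mul contMDiff_fst))
    -- The group element plays the role of the parameter, which comes first; the two factors are
    -- exchanged afterwards.
    have h2 := contMDiff_uncurry_of_comp_prodMk (f := fun x r => prodRact S T r x)
      (contMDiff_prodMk.comp h1)
    exact h2.comp (contMDiff_snd.prodMk contMDiff_fst)
  toSOF := prodToSOF S T ε hε
  contMDiff_toSOF v := contMDiff_of_comp_prodMk (contMDiff_prodFrame v)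
  toSOF_ract r x v := by
    obtain ⟨z⟩ := r
    change (prodFrame S T hε (z.1, z.2.1, z.2.2 * x)).apply v =
      (prodFrame S T hε z).apply (rot x v)
    rw [prodFrame_apply, prodFrame_apply, rot_mul]
  act := prodAct S T ε
  contMDiff_act := by
    have h1 : ContMDiff (𝓘(ℝ, EG).prod (𝓘(ℝ, EP).prod (𝓘(ℝ, EQ).prod 𝓘(ℝ, spincLie (m + n)))))
        𝓘(ℝ, EP) ∞ (fun w : G × P × Q × Spinc (m + n) => S.act w.1 w.2.1) :=
      S.contMDiff_act.comp (contMDiff_fst.prodMk (contMDiff_fst.comp contMDiff_snd))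
    have h2 : ContMDiff (𝓘(ℝ, EG).prod (𝓘(ℝ, EP).prod (𝓘(ℝ, EQ).prod 𝓘(ℝ, spincLie (m + n)))))
        𝓘(ℝ, EQ) ∞ (fun w : G × P × Q × Spinc (m + n) => T.act (ε w.1) w.2.2.1) :=
      T.contMDiff_act.comp ((hε.comp contMDiff_fst).prodMk
        (contMDiff_fst.comp (contMDiff_snd.comp contMDiff_snd)))
    exact contMDiff_uncurry_of_comp_prodMk (f := fun g r => prodAct S T ε g r)
      (contMDiff_prodMk.comp (h1.prodMk (h2.prodMk
        (contMDiff_snd.comp (contMDiff_snd.comp contMDiff_snd)))))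
  act_ract g r x := by
    obtain ⟨z⟩ := r
    rfl
  toSOF_act g r v := by
    obtain ⟨z⟩ := r
    change (prodFrame S T hε (S.act g z.1, T.act (ε g) z.2.1, z.2.2)).apply v =
      tangentMap (I.prod J) (I.prod J) (prodPerm BM BN ε g) ((prodFrame S T hε z).apply v)
    rw [prodFrame_apply]
    simp only [S.toSOF_act, T.toSOF_act]
    have h := mfderiv_prodMap_apply (z := (S.proj z.1, T.proj z.2.1))
      ((BM.contMDiff_act_apply g).mdifferentiableAt (by simp))
      ((BN.contMDiff_act_apply (ε g)).mdifferentiableAt (by simp))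
      ((prodFrame S T hε z).frame v)
    exact (congrArg (fun w : E × E' =>
      (⟨prodPerm BM BN ε g (S.proj z.1, T.proj z.2.1), w⟩ : TangentBundle (I.prod J) (M × N)))
        h).symm
  locallyTrivial x₀ := by
    obtain ⟨a, ha⟩ := S.exists_gauge x₀.1
    obtain ⟨b, hb⟩ := T.exists_gauge x₀.2
    -- The trivialization covers the identity of the base, so the inverse laws of `prodTriv` give
    -- those required of a local trivialization.
    have hfst : ∀ r ∈ (prodTriv a b).source, (prodTriv a b r).1 = prodProj S T r := by
      rintro ⟨z⟩ hz
      exact congrArg Prod.fst (prodTriv_prodMk a b hz)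
    refine ⟨a.dom ×ˢ b.dom, a.isOpen_dom.prod b.isOpen_dom, ⟨ha, hb⟩,
      fun r => (prodTriv a b r).2, (prodTriv a b).symm, ?_, contMDiffOn_prodTriv_symm a b, ?_, ?_,
      ?_⟩ <;> simp only [prodToSOF_base]
    · exact contMDiff_snd.comp_contMDiffOn (contMDiffOn_prodTriv a b)
    · intro r hr
      rw [← hfst r hr]
      exact (prodTriv a b).left_inv hr
    · intro x hx h
      have h1 : (x, h) ∈ (prodTriv a b).target := ⟨hx, trivial⟩
      rw [← hfst _ ((prodTriv a b).map_target h1), (prodTriv a b).right_inv h1]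
      exact ⟨rfl, rfl⟩
    · rintro ⟨z⟩ hz h
      have hz' : z ∈ gaugeDom a b := hz
      change (prodTriv a b (prodMk S T (z.1, z.2.1, z.2.2 * h))).2 =
        (prodTriv a b (prodMk S T z)).2 * h
      rw [prodTriv_prodMk a b hz', prodTriv_prodMk a b (z := (z.1, z.2.1, z.2.2 * h)) hz']
      exact (mul_assoc _ _ _).symm

theorem isProductSpinc_prodSpinc : IsProductSpinc S T ε (prodSpinc S T ε hε) where
  ract_eq _ _ _ _ := rfl
  act_eq _ _ _ _ := rfl
  toSOF_eq _ _ _ _ := rfl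

end ProductStructure

end

/-! ### One-forms, and `det_* ∘ θ^L` as a logarithmic derivative -/

noncomputable section

theorem oneForm_apply {E V : Type*} [NormedAddCommGroup E] [NormedSpace ℝ E]
    [NormedAddCommGroup V] [NormedSpace ℝ V] (α : E [⋀^Fin 1]→L[ℝ] V) (v : Fin 1 → E) :
    α v = α ![v 0] := by
  congr 1
  funext i
  rw [Subsingleton.elim i 0]
  rfl

theorem oneForm_add {E V : Type*} [NormedAddCommGroup E] [NormedSpace ℝ E]
    [NormedAddCommGroup V] [NormedSpace ℝ V] (α : E [⋀^Fin 1]→L[ℝ] V) (v w : E) :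
    α ![v + w] = α ![v] + α ![w] := by
  have h := α.map_update_add ![0] 0 v w
  have hu : ∀ u : E, Function.update ![(0 : E)] (0 : Fin 1) u = ![u] := fun u => by
    funext i
    rw [Subsingleton.elim i 0]
    simp
  rwa [hu, hu, hu] at h

section DetPullback

variable {EX HX X : Type*} [NormedAddCommGroup EX] [NormedSpace ℝ EX] [TopologicalSpace HX]
  {IX : ModelWithCorners ℝ EX HX} [TopologicalSpace X] [ChartedSpace HX X] {k l : ℕ}

/-- The form comes from `ℂ` by `det`, so its pullback depends on `f` only through the function `det
∘ f`. -/
theorem detForm_pullback {f : X → Spinc k} {x : X}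
    (hf : MDifferentiableAt IX 𝓘(ℝ, spincLie k) f x) :
    (detForm k).pullback IX f x = conjForm.pullback IX (fun x => (det (f x) : ℂ)) x :=
  conjForm.pullback_pullback ((contMDiff_det k).mdifferentiable (by simp) (f x)) hf

/-- This is the product rule for `det f · det g`, multiplied by the conjugate of that product; `conj
z · z = 1` removes the extra factor from each term. -/
theorem detForm_pullback_mul {f g : X → Spinc k} {x : X}
    (hf : MDifferentiableAt IX 𝓘(ℝ, spincLie k) f x)
    (hg : MDifferentiableAt IX 𝓘(ℝ, spincLie k) g x) :
    (detForm k).pullback IX (fun x => f x * g x) x =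
      (detForm k).pullback IX f x + (detForm k).pullback IX g x := by
  have hfg : MDifferentiableAt IX 𝓘(ℝ, spincLie k) (fun x => f x * g x) x :=
    ((contMDiff_mul 𝓘(ℝ, spincLie k) ∞).mdifferentiable (by simp) (f x, g x)).comp x
      (hf.prodMk hg)
  rw [detForm_pullback hf, detForm_pullback hg, detForm_pullback hfg]
  have hf' : MDifferentiableAt IX 𝓘(ℝ, ℂ) (fun x => (det (f x) : ℂ)) x :=
    ((contMDiff_det k).mdifferentiable (by simp) (f x)).comp x hf
  have hg' : MDifferentiableAt IX 𝓘(ℝ, ℂ) (fun x => (det (g x) : ℂ)) x :=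
    ((contMDiff_det k).mdifferentiable (by simp) (g x)).comp x hg
  have h1 := hf'.hasMFDerivAt.mul hg'.hasMFDerivAt
  have h2 : (fun x => (det (f x * g x) : ℂ)) =
      (fun x => (det (f x) : ℂ)) * fun x => (det (g x) : ℂ) := by
    funext x
    rw [det_mul]
    rfl
  have h3 : ∀ z : Circle, (starRingEnd ℂ) (z : ℂ) * z = 1 := fun z => by
    rw [mul_comm, Complex.mul_conj, Circle.normSq_coe, Complex.ofReal_one]
  refine ContinuousAlternatingMap.ext fun v => ?_
  have h4 := congrArg (fun L : EX →L[ℝ] ℂ => L (v 0)) h1.mfderiv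
  rw [← h2] at h4
  have hmul : det (f x * g x) = det (f x) * det (g x) := det_mul _ _
  change (starRingEnd ℂ) (det (f x * g x) : ℂ) *
      (show ℂ from mfderiv IX 𝓘(ℝ, ℂ) (fun x => (det (f x * g x) : ℂ)) x (v 0)) =
    (starRingEnd ℂ) (det (f x) : ℂ) *
      (show ℂ from mfderiv IX 𝓘(ℝ, ℂ) (fun x => (det (f x) : ℂ)) x (v 0)) +
    (starRingEnd ℂ) (det (g x) : ℂ) *
      (show ℂ from mfderiv IX 𝓘(ℝ, ℂ) (fun x => (det (g x) : ℂ)) x (v 0))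
  change (show ℂ from mfderiv IX 𝓘(ℝ, ℂ) (fun x => (det (f x * g x) : ℂ)) x (v 0)) =
    (det (f x) : ℂ) * (show ℂ from mfderiv IX 𝓘(ℝ, ℂ) (fun x => (det (g x) : ℂ)) x (v 0)) +
    (det (g x) : ℂ) * (show ℂ from mfderiv IX 𝓘(ℝ, ℂ) (fun x => (det (f x) : ℂ)) x (v 0)) at h4
  rw [h4, hmul, Circle.coe_mul, map_mul]
  generalize (show ℂ from mfderiv IX 𝓘(ℝ, ℂ) (fun x => (det (f x) : ℂ)) x (v 0)) = a
  generalize (show ℂ from mfderiv IX 𝓘(ℝ, ℂ) (fun x => (det (g x) : ℂ)) x (v 0)) = b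
  linear_combination ((starRingEnd ℂ) (det (g x) : ℂ) * b) * h3 (det (f x)) +
    ((starRingEnd ℂ) (det (f x) : ℂ) * a) * h3 (det (g x))

theorem detForm_pullback_const (h : Spinc k) (x : X) :
    (detForm k).pullback IX (fun _ => h) x = 0 := by
  have h1 : mfderiv IX 𝓘(ℝ, spincLie k) (fun _ : X => h) x = 0 := mfderiv_const
  refine ContinuousAlternatingMap.ext fun v => ?_
  rw [DForm.pullback_apply]
  exact (detForm k h).map_coord_zero 0 (congrArg (fun L : EX →L[ℝ] spincLie k => L (v 0)) h1)

theorem mdifferentiableAt_spinc_inv {f : X → Spinc k} {x : X}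
    (hf : MDifferentiableAt IX 𝓘(ℝ, spincLie k) f x) :
    MDifferentiableAt IX 𝓘(ℝ, spincLie k) (fun x => (f x)⁻¹) x :=
  ((contMDiff_inv 𝓘(ℝ, spincLie k) ∞).mdifferentiable (by simp) (f x)).comp x hf

theorem detForm_pullback_inv {f : X → Spinc k} {x : X}
    (hf : MDifferentiableAt IX 𝓘(ℝ, spincLie k) f x) :
    (detForm k).pullback IX (fun x => (f x)⁻¹) x = -(detForm k).pullback IX f x := by
  have h1 := detForm_pullback_mul (mdifferentiableAt_spinc_inv hf) hf
  simp only [inv_mul_cancel, detForm_pullback_const] at h1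
  exact eq_neg_of_add_eq_zero_left h1.symm

theorem detForm_pullback_spincMap (j : cliffordForm k →qᵢ cliffordForm l) {f : X → Spinc k} {x : X}
    (hf : MDifferentiableAt IX 𝓘(ℝ, spincLie k) f x) :
    (detForm l).pullback IX (fun x => spincMap j (f x)) x = (detForm k).pullback IX f x := by
  have h1 : MDifferentiableAt IX 𝓘(ℝ, spincLie l) (fun x => spincMap j (f x)) x :=
    ((contMDiff_spincMap j).mdifferentiable (by simp) (f x)).comp x hf
  rw [detForm_pullback hf, detForm_pullback h1]
  simp only [det_spincMap]

theorem mdifferentiableAt_spincMul {m n : ℕ} {f : X → Spinc m} {g : X → Spinc n} {x : X}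
    (hf : MDifferentiableAt IX 𝓘(ℝ, spincLie m) f x)
    (hg : MDifferentiableAt IX 𝓘(ℝ, spincLie n) g x) :
    MDifferentiableAt IX 𝓘(ℝ, spincLie (m + n)) (fun x => spincMul (f x) (g x)) x :=
  (contMDiff_spincMul.mdifferentiable (by simp) (f x, g x)).comp x (hf.prodMk hg)

theorem detForm_pullback_spincMul {m n : ℕ} {f : X → Spinc m} {g : X → Spinc n} {x : X}
    (hf : MDifferentiableAt IX 𝓘(ℝ, spincLie m) f x)
    (hg : MDifferentiableAt IX 𝓘(ℝ, spincLie n) g x) :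
    (detForm (m + n)).pullback IX (fun x => spincMul (f x) (g x)) x =
      (detForm m).pullback IX f x + (detForm n).pullback IX g x := by
  have h1 : MDifferentiableAt IX 𝓘(ℝ, spincLie (m + n))
      (fun x => spincMap (inlVec m n) (f x)) x :=
    ((contMDiff_spincMap _).mdifferentiable (by simp) (f x)).comp x hf
  have h2 : MDifferentiableAt IX 𝓘(ℝ, spincLie (m + n))
      (fun x => spincMap (inrVec m n) (g x)) x :=
    ((contMDiff_spincMap _).mdifferentiable (by simp) (g x)).comp x hg
  rw [← detForm_pullback_spincMap (inlVec m n) hf, ← detForm_pullback_spincMap (inrVec m n) hg]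
  exact detForm_pullback_mul h1 h2

theorem maurerCartan_one (ξ : LieSpinc k) : maurerCartan (1 : Spinc k) ξ = ξ := by
  have h : (fun x : Spinc k => (1 : Spinc k)⁻¹ * x) = id := by
    funext x
    simp
  have h1 : mfderiv 𝓘(ℝ, spincLie k) 𝓘(ℝ, spincLie k)
      (fun x : Spinc k => (1 : Spinc k)⁻¹ * x) 1 ξ =
      mfderiv 𝓘(ℝ, spincLie k) 𝓘(ℝ, spincLie k) (id : Spinc k → Spinc k) 1 ξ :=
    congrArg (fun F : Spinc k → Spinc k =>
      (show spincLie k from mfderiv 𝓘(ℝ, spincLie k) 𝓘(ℝ, spincLie k) F 1 ξ)) h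
  exact h1.trans (congrArg (fun L : spincLie k →L[ℝ] spincLie k => L ξ)
    (mfderiv_id (I := 𝓘(ℝ, spincLie k)) (x := (1 : Spinc k))))

end DetPullback

/-! ### Transformation of a spin^c connection under variable group elements -/

section ConnectionPullback

variable {EG : Type*} [NormedAddCommGroup EG] [NormedSpace ℝ EG]
  {G : Type*} [Group G] [TopologicalSpace G] [ChartedSpace EG G]
  {E H M : Type*} [NormedAddCommGroup E] [NormedSpace ℝ E] [TopologicalSpace H]
  {I : ModelWithCorners ℝ E H} [TopologicalSpace M] [ChartedSpace H M] [IsManifold I ∞ M]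
  {EP P : Type*} [NormedAddCommGroup EP] [NormedSpace ℝ EP]
  [TopologicalSpace P] [ChartedSpace EP P]
  {k : ℕ} {B : OrientedRiemannianAction I M EG G k} {S : EquivariantSpincStructure B EP P}
  {η : DForm I M 2 ℝ} {θ : DForm 𝓘(ℝ, EP) P 1 ℂ}

theorem EquivariantSpincStructure.contMDiff_ract_right (S : EquivariantSpincStructure B EP P)
    (p : P) : ContMDiff 𝓘(ℝ, spincLie k) 𝓘(ℝ, EP) ∞ (S.ract p) :=
  S.contMDiff_ract.comp (contMDiff_const.prodMk contMDiff_id)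

theorem EquivariantSpincStructure.contMDiff_act_apply (S : EquivariantSpincStructure B EP P)
    (g : G) : ContMDiff 𝓘(ℝ, EP) 𝓘(ℝ, EP) ∞ (S.act g) :=
  S.contMDiff_act.comp (contMDiff_const.prodMk contMDiff_id)

/-- Since `p y = (p x)(x⁻¹ y)`, the orbit map of `p` is that of `p x` after left translation by
`x⁻¹`, whose derivative at `x` is the Maurer–Cartan form. -/
theorem mfderiv_ract_right (S : EquivariantSpincStructure B EP P) (p : P) (x : Spinc k)
    (w : TangentSpace 𝓘(ℝ, spincLie k) x) :
    mfderiv 𝓘(ℝ, spincLie k) 𝓘(ℝ, EP) (S.ract p) x w =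
      S.fundVec (S.ract p x) (maurerCartan x w) := by
  have h1 : HasMFDerivAt 𝓘(ℝ, spincLie k) 𝓘(ℝ, EP) (S.ract (S.ract p x)) (x⁻¹ * x)
      (mfderiv 𝓘(ℝ, spincLie k) 𝓘(ℝ, EP) (S.ract (S.ract p x)) 1) := by
    rw [inv_mul_cancel]
    exact ((S.contMDiff_ract_right _).mdifferentiable (by simp) 1).hasMFDerivAt
  have h2 : MDifferentiableAt 𝓘(ℝ, spincLie k) 𝓘(ℝ, spincLie k) (fun y : Spinc k => x⁻¹ * y) x :=
    (contMDiff_mul_left (a := x⁻¹) (n := ∞)).mdifferentiable (by simp) x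
  have h3 := h1.comp x h2.hasMFDerivAt
  have h4 : S.ract (S.ract p x) ∘ (fun y : Spinc k => x⁻¹ * y) = S.ract p := by
    funext y
    rw [Function.comp_apply, ← S.ract_mul, mul_inv_cancel_left]
  rw [h4] at h3
  exact congrArg (fun L : spincLie k →L[ℝ] EP => L w) h3.mfderiv

/-- Both sides are additive in `ξ`, vanish on `𝔰𝔭𝔦𝔫(k)` and agree on `𝔲(1)`, and these subspaces
span. The two vertical conditions on a connection are thus a single formula. -/
theorem IsSpincPrequantization.apply_fundVec (h : IsSpincPrequantization S η θ) (p : P)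
    (ξ : LieSpinc k) : θ p ![S.fundVec p ξ] = 1 / 2 * detStar ξ := by
  obtain ⟨ζ, hζ, s, rfl, hs⟩ := exists_spinLie_add_u1Vec ξ
  have h1 : S.fundVec p (ζ + u1Vec k s) = S.fundVec p ζ + S.fundVec p (u1Vec k s) :=
    map_add (mfderiv 𝓘(ℝ, spincLie k) 𝓘(ℝ, EP) (fun h => S.ract p h) 1) ζ (u1Vec k s)
  rw [hs, h1]
  refine (oneForm_add (E := EP) (θ p) _ _).trans ?_
  exact (congrArg₂ (· + ·) (h.spin_vertical p ζ hζ) (h.vertical p s)).trans (by ring)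

variable {EX HX X : Type*} [NormedAddCommGroup EX] [NormedSpace ℝ EX] [TopologicalSpace HX]
  {IX : ModelWithCorners ℝ EX HX} [TopologicalSpace X] [ChartedSpace HX X]

/-- The behaviour of the connection under the action of a variable element of `Spin^c(k)`. -/
theorem IsSpincPrequantization.pullback_ract (h : IsSpincPrequantization S η θ) {f : X → P}
    {a : X → Spinc k} {x : X} (hf : MDifferentiableAt IX 𝓘(ℝ, EP) f x)
    (ha : MDifferentiableAt IX 𝓘(ℝ, spincLie k) a x) :
    θ.pullback IX (fun x => S.ract (f x) (a x)) x =
      θ.pullback IX f x + (1 / 2 : ℝ) • (detForm k).pullback IX a x := by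
  have h0 : MDifferentiableAt (𝓘(ℝ, EP).prod 𝓘(ℝ, spincLie k)) 𝓘(ℝ, EP)
      (fun q : P × Spinc k => S.ract q.1 q.2) (f x, a x) :=
    S.contMDiff_ract.mdifferentiable (by simp) _
  have h1 := h0.hasMFDerivAt.comp x (hf.hasMFDerivAt.prodMk ha.hasMFDerivAt)
  refine ContinuousAlternatingMap.ext fun v => ?_
  have h2 := congrArg (fun L : EX →L[ℝ] EP => L (v 0)) h1.mfderiv
  have h3 := mfderiv_prod_eq_add_apply h0 (v := (show EP × spincLie k from
    (mfderiv IX 𝓘(ℝ, EP) f x (v 0), mfderiv IX 𝓘(ℝ, spincLie k) a x (v 0))))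
  -- The velocity of `f · a` is the translate of the velocity of `f`, where the invariance of `θ`
  -- applies, plus a vertical vector, where its value is `½ det_*`.
  have h4 : (show EP from mfderiv IX 𝓘(ℝ, EP) (fun x => S.ract (f x) (a x)) x (v 0)) =
      (show EP from mfderiv 𝓘(ℝ, EP) 𝓘(ℝ, EP) (fun q => S.ract q (a x)) (f x)
        (mfderiv IX 𝓘(ℝ, EP) f x (v 0))) +
      (show EP from mfderiv 𝓘(ℝ, spincLie k) 𝓘(ℝ, EP) (S.ract (f x)) (a x)
        (mfderiv IX 𝓘(ℝ, spincLie k) a x (v 0))) := h2.trans h3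
  have h5 : θ.pullback IX (fun x => S.ract (f x) (a x)) x v = θ (S.ract (f x) (a x))
      ![mfderiv IX 𝓘(ℝ, EP) (fun x => S.ract (f x) (a x)) x (v 0)] :=
    oneForm_apply (E := EP) (θ (S.ract (f x) (a x))) _
  have h6 : θ.pullback IX f x v = θ (f x) ![mfderiv IX 𝓘(ℝ, EP) f x (v 0)] :=
    oneForm_apply (E := EP) (θ (f x)) _
  have h7 := h.ract_invariant (a x) (f x) (mfderiv IX 𝓘(ℝ, EP) f x (v 0))
  have h8 := h.apply_fundVec (S.ract (f x) (a x))
    (maurerCartan (a x) (mfderiv IX 𝓘(ℝ, spincLie k) a x (v 0)))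
  rw [← mfderiv_ract_right] at h8
  have h9 : (detForm k).pullback IX a x v =
    detStar (maurerCartan (a x) (mfderiv IX 𝓘(ℝ, spincLie k) a x (v 0))) :=
    detForm_apply (a x) fun i => mfderiv IX 𝓘(ℝ, spincLie k) a x (v i)
  rw [h5]
  refine (congrArg (fun w : EP => θ (S.ract (f x) (a x)) ![w]) h4).trans ?_
  refine (oneForm_add (E := EP) (θ (S.ract (f x) (a x))) _ _).trans ?_
  refine (congrArg₂ (· + ·) h7 h8).trans ?_
  change _ = θ.pullback IX f x v + (1 / 2 : ℝ) • (detForm k).pullback IX a x v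
  rw [h6, h9, Complex.real_smul]
  push_cast
  rfl

theorem IsSpincPrequantization.pullback_act [I.Boundaryless] (h : IsSpincPrequantization S η θ)
    (g : G) {f : X → P} {x : X} (hf : MDifferentiableAt IX 𝓘(ℝ, EP) f x) :
    θ.pullback IX (fun x => S.act g (f x)) x = θ.pullback IX f x := by
  have h1 : (θ.pullback 𝓘(ℝ, EP) (S.act g)).pullback IX f x =
      θ.pullback IX (fun x => S.act g (f x)) x :=
    θ.pullback_pullback ((S.contMDiff_act_apply g).mdifferentiable (by simp) _) hf
  have h2 : θ.pullback 𝓘(ℝ, EP) (S.act g) = θ := by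
    funext p
    refine ContinuousAlternatingMap.ext fun v => ?_
    exact (oneForm_apply (E := EP) (θ (S.act g p)) _).trans ((h.act_invariant g p (v 0)).trans
      (oneForm_apply (E := EP) (θ p) v).symm)
  rw [← h1, h2]

end ConnectionPullback

end

noncomputable section

/-! ### The form `ω_M ⊕ ω_N` -/

section SumForm

variable {E H M : Type*} [NormedAddCommGroup E] [NormedSpace ℝ E] [TopologicalSpace H]
  {I : ModelWithCorners ℝ E H} [TopologicalSpace M] [ChartedSpace H M] [IsManifold I ∞ M]
  {E' H' N : Type*} [NormedAddCommGroup E'] [NormedSpace ℝ E'] [TopologicalSpace H']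
  {J : ModelWithCorners ℝ E' H'} [TopologicalSpace N] [ChartedSpace H' N] [IsManifold J ∞ N]
  {EX HX X : Type*} [NormedAddCommGroup EX] [NormedSpace ℝ EX] [TopologicalSpace HX]
  {IX : ModelWithCorners ℝ EX HX} [TopologicalSpace X] [ChartedSpace HX X]
  {η : DForm I M 2 ℝ} {η' : DForm J N 2 ℝ}

theorem sumForm_eq_pullback (η : DForm I M 2 ℝ) (η' : DForm J N 2 ℝ) :
    sumForm η η' = fun z => η.pullback (I.prod J) Prod.fst z + η'.pullback (I.prod J) Prod.snd z := by
  funext z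
  have h1 := η.compContinuousLinearMap_congr (F := E × E') (x := z.1) rfl
    (mfderiv_fst (I := I) (I' := J) (x := z)).symm
  have h2 := η'.compContinuousLinearMap_congr (F := E × E') (x := z.2) rfl
    (mfderiv_snd (I := I) (I' := J) (x := z)).symm
  exact congrArg₂ (fun a b : (E × E') [⋀^Fin 2]→L[ℝ] ℝ => a + b) h1 h2

theorem isSmooth_sumForm [I.Boundaryless] [J.Boundaryless] (hη : η.IsSmooth) (hη' : η'.IsSmooth) :
    (sumForm η η').IsSmooth := by
  rw [sumForm_eq_pullback]
  exact (hη.pullback contMDiff_fst).add (hη'.pullback contMDiff_snd)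

theorem extD_sumForm [I.Boundaryless] [J.Boundaryless] (hη : η.IsSmooth) (hη' : η'.IsSmooth)
    (h : ∀ x, η.extD x = 0) (h' : ∀ x, η'.extD x = 0) (z : M × N) :
    (sumForm η η').extD z = 0 := by
  rw [sumForm_eq_pullback, (hη.pullback contMDiff_fst).extD_add (hη'.pullback contMDiff_snd),
    hη.extD_pullback contMDiff_fst, hη'.extD_pullback contMDiff_snd, DForm.pullback, DForm.pullback,
    h, h']
  ext v
  exact add_zero (0 : ℝ)

theorem sumForm_pullback_apply {f : X → M} {g : X → N} {x : X} (hf : MDifferentiableAt IX I f x)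
    (hg : MDifferentiableAt IX J g x) (v : Fin 2 → TangentSpace IX x) :
    sumForm η η' (f x, g x)
      (fun i => mfderiv IX (I.prod J) (fun x => (f x, g x)) x (v i)) =
      η (f x) (fun i => mfderiv IX I f x (v i)) + η' (g x) (fun i => mfderiv IX J g x (v i)) := by
  have h := (hf.hasMFDerivAt.prodMk hg.hasMFDerivAt).mfderiv
  exact congrArg (fun L : EX →L[ℝ] E × E' => sumForm η η' (f x, g x) fun i => L (v i)) h

end SumForm

/-! ### The form `Θ` on `P_M × P_N × Spin^c(m+n)` and its invariance -/

section TotalForm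

variable {EG : Type*} [NormedAddCommGroup EG] [NormedSpace ℝ EG]
  {G : Type*} [Group G] [TopologicalSpace G] [ChartedSpace EG G]
  {E H M : Type*} [NormedAddCommGroup E] [NormedSpace ℝ E] [TopologicalSpace H]
  {I : ModelWithCorners ℝ E H} [TopologicalSpace M] [ChartedSpace H M] [IsManifold I ∞ M]
  {E' H' N : Type*} [NormedAddCommGroup E'] [NormedSpace ℝ E'] [TopologicalSpace H']
  {J : ModelWithCorners ℝ E' H'} [TopologicalSpace N] [ChartedSpace H' N] [IsManifold J ∞ N]
  {EP P : Type*} [NormedAddCommGroup EP] [NormedSpace ℝ EP]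
  [TopologicalSpace P] [ChartedSpace EP P]
  {EQ Q : Type*} [NormedAddCommGroup EQ] [NormedSpace ℝ EQ]
  [TopologicalSpace Q] [ChartedSpace EQ Q]
  {m n : ℕ}
  {BM : OrientedRiemannianAction I M EG G m} {BN : OrientedRiemannianAction J N EG G n}
  {S : EquivariantSpincStructure BM EP P} {T : EquivariantSpincStructure BN EQ Q}
  [I.Boundaryless] [J.Boundaryless] [IsManifold 𝓘(ℝ, EP) ∞ P] [IsManifold 𝓘(ℝ, EQ) ∞ Q]
  {EX HX X : Type*} [NormedAddCommGroup EX] [NormedSpace ℝ EX] [TopologicalSpace HX]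
  {IX : ModelWithCorners ℝ EX HX} [TopologicalSpace X] [ChartedSpace HX X]
  {ηM : DForm I M 2 ℝ} {ηN : DForm J N 2 ℝ}
  {θM : DForm 𝓘(ℝ, EP) P 1 ℂ} {θN : DForm 𝓘(ℝ, EQ) Q 1 ℂ}

/-- The form `θ_M + θ_N + ½ det_* ∘ θ^L` on `P_M × P_N × Spin^c(k)`. -/
def totalForm (θM : DForm 𝓘(ℝ, EP) P 1 ℂ) (θN : DForm 𝓘(ℝ, EQ) Q 1 ℂ) (k : ℕ) :
    DForm (𝓘(ℝ, EP).prod (𝓘(ℝ, EQ).prod 𝓘(ℝ, spincLie k))) (P × Q × Spinc k) 1 ℂ := fun z =>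
  θM.pullback (𝓘(ℝ, EP).prod (𝓘(ℝ, EQ).prod 𝓘(ℝ, spincLie k))) (fun z => z.1) z +
    (θN.pullback (𝓘(ℝ, EP).prod (𝓘(ℝ, EQ).prod 𝓘(ℝ, spincLie k))) (fun z => z.2.1) z +
      (1 / 2 : ℝ) • (detForm k).pullback (𝓘(ℝ, EP).prod (𝓘(ℝ, EQ).prod 𝓘(ℝ, spincLie k)))
        (fun z => z.2.2) z)

theorem totalForm_pullback {k : ℕ} {f : X → P} {g : X → Q} {a : X → Spinc k} {x : X}
    (hf : MDifferentiableAt IX 𝓘(ℝ, EP) f x) (hg : MDifferentiableAt IX 𝓘(ℝ, EQ) g x)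
    (ha : MDifferentiableAt IX 𝓘(ℝ, spincLie k) a x) :
    (totalForm θM θN k).pullback IX (fun x => (f x, g x, a x)) x =
      θM.pullback IX f x + (θN.pullback IX g x + (1 / 2 : ℝ) • (detForm k).pullback IX a x) := by
  have hF : MDifferentiableAt IX (𝓘(ℝ, EP).prod (𝓘(ℝ, EQ).prod 𝓘(ℝ, spincLie k)))
      (fun x => (f x, g x, a x)) x := hf.prodMk (hg.prodMk ha)
  have h1 := θM.pullback_pullback (L := 𝓘(ℝ, EP)) (f := fun x => (f x, g x, a x))
    (g := fun z : P × Q × Spinc k => z.1)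
    (mdifferentiableAt_fst (x := (f x, g x, a x))) hF
  have h2 := θN.pullback_pullback (L := 𝓘(ℝ, EQ)) (f := fun x => (f x, g x, a x))
    (g := fun z : P × Q × Spinc k => z.2.1)
    (mdifferentiableAt_fst.comp (f x, g x, a x) mdifferentiableAt_snd) hF
  have h3 := (detForm k).pullback_pullback (f := fun x => (f x, g x, a x))
    (g := fun z : P × Q × Spinc k => z.2.2)
    (mdifferentiableAt_snd.comp (f x, g x, a x) mdifferentiableAt_snd) hF
  exact congrArg₂ (fun a b : EX [⋀^Fin 1]→L[ℝ] ℂ => a + b) h1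
    (congrArg₂ (fun a b : EX [⋀^Fin 1]→L[ℝ] ℂ => a + (1 / 2 : ℝ) • b) h2 h3)

theorem totalForm_apply {k : ℕ} (p : P) (q : Q) (h : Spinc k) (u : TangentSpace 𝓘(ℝ, EP) p)
    (v : TangentSpace 𝓘(ℝ, EQ) q) (w : TangentSpace 𝓘(ℝ, spincLie k) h) :
    totalForm θM θN k (p, q, h) ![(u, v, w)] =
      θM p ![u] + θN q ![v] + 1 / 2 * detStar (maurerCartan h w) := by
  have hsnd : HasMFDerivAt (𝓘(ℝ, EP).prod (𝓘(ℝ, EQ).prod 𝓘(ℝ, spincLie k)))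
    (𝓘(ℝ, EQ).prod 𝓘(ℝ, spincLie k)) (fun z : P × Q × Spinc k => z.2) (p, q, h) _ :=
      hasMFDerivAt_snd (p, q, h)
  have h1 := (hasMFDerivAt_fst (I := 𝓘(ℝ, EP)) (I' := 𝓘(ℝ, EQ).prod 𝓘(ℝ, spincLie k))
    (p, q, h)).mfderiv
  have h2 := ((hasMFDerivAt_fst (I := 𝓘(ℝ, EQ)) (I' := 𝓘(ℝ, spincLie k)) (q, h)).comp
    (p, q, h) hsnd).mfderiv
  have h3 := ((hasMFDerivAt_snd (I := 𝓘(ℝ, EQ)) (I' := 𝓘(ℝ, spincLie k)) (q, h)).comp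
    (p, q, h) hsnd).mfderiv
  have e1 : θM.pullback (𝓘(ℝ, EP).prod (𝓘(ℝ, EQ).prod 𝓘(ℝ, spincLie k)))
      (fun z : P × Q × Spinc k => z.1) (p, q, h) ![(u, v, w)] = θM p ![u] :=
    (oneForm_apply (E := EP) (θM p) _).trans
      (congrArg (fun L : EP × EQ × spincLie k →L[ℝ] EP => θM p ![L (u, v, w)]) h1)
  have e2 : θN.pullback (𝓘(ℝ, EP).prod (𝓘(ℝ, EQ).prod 𝓘(ℝ, spincLie k)))
      (fun z : P × Q × Spinc k => z.2.1) (p, q, h) ![(u, v, w)] = θN q ![v] :=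
    (oneForm_apply (E := EQ) (θN q) _).trans
      (congrArg (fun L : EP × EQ × spincLie k →L[ℝ] EQ => θN q ![L (u, v, w)]) h2)
  have e3 : (detForm k).pullback (𝓘(ℝ, EP).prod (𝓘(ℝ, EQ).prod 𝓘(ℝ, spincLie k)))
      (fun z : P × Q × Spinc k => z.2.2) (p, q, h) ![(u, v, w)] = detStar (maurerCartan h w) :=
    (congrArg (fun L : EP × EQ × spincLie k →L[ℝ] spincLie k =>
      detForm k h fun _ => L (u, v, w)) h3).trans (detForm_apply h fun _ => w)
  refine (congrArg₂ (· + ·) e1 (congrArg₂ (· + ·) e2 (congrArg ((1 / 2 : ℝ) • ·) e3))).trans ?_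
  simp only [Complex.real_smul]
  push_cast
  ring

theorem isSmooth_totalForm (hM : θM.IsSmooth) (hN : θN.IsSmooth) (k : ℕ) :
    (totalForm θM θN k).IsSmooth :=
  (hM.pullback contMDiff_fst).add ((hN.pullback (contMDiff_fst.comp contMDiff_snd)).add
    (((isSmooth_detForm k).pullback (contMDiff_snd.comp contMDiff_snd)).const_smul _))

/-- The Maurer–Cartan term is the pullback of a closed form and contributes nothing. -/
theorem extD_totalForm (hM : θM.IsSmooth) (hN : θN.IsSmooth) {k : ℕ} (z : P × Q × Spinc k) :
    (totalForm θM θN k).extD z =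
      θM.extD.pullback (𝓘(ℝ, EP).prod (𝓘(ℝ, EQ).prod 𝓘(ℝ, spincLie k))) (fun z => z.1) z +
      θN.extD.pullback (𝓘(ℝ, EP).prod (𝓘(ℝ, EQ).prod 𝓘(ℝ, spincLie k))) (fun z => z.2.1) z := by
  have h1 := hM.pullback (I := 𝓘(ℝ, EP).prod (𝓘(ℝ, EQ).prod 𝓘(ℝ, spincLie k)))
    (f := fun z : P × Q × Spinc k => z.1) contMDiff_fst
  have hq : ContMDiff (𝓘(ℝ, EP).prod (𝓘(ℝ, EQ).prod 𝓘(ℝ, spincLie k))) 𝓘(ℝ, EQ) ∞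
      (fun z : P × Q × Spinc k => z.2.1) := contMDiff_fst.comp contMDiff_snd
  have hh : ContMDiff (𝓘(ℝ, EP).prod (𝓘(ℝ, EQ).prod 𝓘(ℝ, spincLie k))) 𝓘(ℝ, spincLie k) ∞
      (fun z : P × Q × Spinc k => z.2.2) := contMDiff_snd.comp contMDiff_snd
  have h2 := hN.pullback hq
  have h3 := ((isSmooth_detForm k).pullback hh).const_smul (1 / 2 : ℝ)
  refine (h1.extD_add (h2.add h3) z).trans ?_
  rw [h2.extD_add h3, DForm.extD_const_smul, hM.extD_pullback contMDiff_fst,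
    hN.extD_pullback hq, (isSmooth_detForm k).extD_pullback hh]
  have h4 : (detForm k).extD.pullback (𝓘(ℝ, EP).prod (𝓘(ℝ, EQ).prod 𝓘(ℝ, spincLie k)))
      (fun z : P × Q × Spinc k => z.2.2) z = 0 := by
    rw [DForm.pullback, extD_detForm]
    ext v
    simp
  rw [h4, smul_zero, add_zero]

/-- Write `δ` for `det_* ∘ θ^L`. The term of `θ_M` gains `½ a^*δ`, that of `θ_N` gains `½ b^*δ`, and
the third term loses `½ (ab)^*δ`, which is the sum of the two. Because `a` and `b` may vary, this
says both that the form is invariant and that it vanishes along orbits. -/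
theorem totalForm_pullback_torsorAct (hM : IsSpincPrequantization S ηM θM)
    (hN : IsSpincPrequantization T ηN θN) {F : X → P × Q × Spinc (m + n)} {a : X → Spinc m}
    {b : X → Spinc n} {x : X}
    (hF : MDifferentiableAt IX (𝓘(ℝ, EP).prod (𝓘(ℝ, EQ).prod 𝓘(ℝ, spincLie (m + n)))) F x)
    (ha : MDifferentiableAt IX 𝓘(ℝ, spincLie m) a x)
    (hb : MDifferentiableAt IX 𝓘(ℝ, spincLie n) b x) :
    (totalForm θM θN (m + n)).pullback IX (fun x => torsorAct S T (F x) (a x) (b x)) x =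
      (totalForm θM θN (m + n)).pullback IX F x := by
  have h1 : MDifferentiableAt IX 𝓘(ℝ, EP) (fun x => (F x).1) x := mdifferentiableAt_fst.comp x hF
  have h0 : MDifferentiableAt IX (𝓘(ℝ, EQ).prod 𝓘(ℝ, spincLie (m + n))) (fun x => (F x).2) x :=
    mdifferentiableAt_snd.comp x hF
  have h2 : MDifferentiableAt IX 𝓘(ℝ, EQ) (fun x => (F x).2.1) x := mdifferentiableAt_fst.comp x h0
  have h3 : MDifferentiableAt IX 𝓘(ℝ, spincLie (m + n)) (fun x => (F x).2.2) x :=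
    mdifferentiableAt_snd.comp x h0
  have h4 : MDifferentiableAt IX 𝓘(ℝ, EP) (fun x => S.ract (F x).1 (a x)) x :=
    (S.contMDiff_ract.mdifferentiable (by simp) ((F x).1, a x)).comp x (h1.prodMk ha)
  have h5 : MDifferentiableAt IX 𝓘(ℝ, EQ) (fun x => T.ract (F x).2.1 (b x)) x :=
    (T.contMDiff_ract.mdifferentiable (by simp) ((F x).2.1, b x)).comp x (h2.prodMk hb)
  have h6 := mdifferentiableAt_spincMul ha hb
  have h7 : MDifferentiableAt IX 𝓘(ℝ, spincLie (m + n))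
      (fun x => (spincMul (a x) (b x))⁻¹ * (F x).2.2) x :=
    ((contMDiff_mul 𝓘(ℝ, spincLie (m + n)) ∞).mdifferentiable (by simp)
      ((spincMul (a x) (b x))⁻¹, (F x).2.2)).comp x ((mdifferentiableAt_spinc_inv h6).prodMk h3)
  have e1 := totalForm_pullback (θM := θM) (θN := θN) h4 h5 h7
  have e2 := totalForm_pullback (θM := θM) (θN := θN) h1 h2 h3
  refine e1.trans (Eq.trans ?_ e2.symm)
  rw [hM.pullback_ract h1 ha, hN.pullback_ract h2 hb,
    detForm_pullback_mul (mdifferentiableAt_spinc_inv h6) h3, detForm_pullback_inv h6,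
    detForm_pullback_spincMul ha hb]
  module

end TotalForm

end

noncomputable section

/-! ### Descent of the connection to `P_{M×N}` -/

section ProductConnection

variable {EG : Type*} [NormedAddCommGroup EG] [NormedSpace ℝ EG]
  {G : Type*} [Group G] [TopologicalSpace G] [ChartedSpace EG G]
  {E H M : Type*} [NormedAddCommGroup E] [NormedSpace ℝ E] [TopologicalSpace H]
  {I : ModelWithCorners ℝ E H} [TopologicalSpace M] [ChartedSpace H M] [IsManifold I ∞ M]
  {E' H' N : Type*} [NormedAddCommGroup E'] [NormedSpace ℝ E'] [TopologicalSpace H']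
  {J : ModelWithCorners ℝ E' H'} [TopologicalSpace N] [ChartedSpace H' N] [IsManifold J ∞ N]
  {EP P : Type*} [NormedAddCommGroup EP] [NormedSpace ℝ EP]
  [TopologicalSpace P] [ChartedSpace EP P]
  {EQ Q : Type*} [NormedAddCommGroup EQ] [NormedSpace ℝ EQ]
  [TopologicalSpace Q] [ChartedSpace EQ Q]
  {m n : ℕ}
  {BM : OrientedRiemannianAction I M EG G m} {BN : OrientedRiemannianAction J N EG G n}
  {S : EquivariantSpincStructure BM EP P} {T : EquivariantSpincStructure BN EQ Q}
  [I.Boundaryless] [J.Boundaryless] [IsManifold 𝓘(ℝ, EP) ∞ P] [IsManifold 𝓘(ℝ, EQ) ∞ Q]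
  {ηM : DForm I M 2 ℝ} {ηN : DForm J N 2 ℝ}
  {θM : DForm 𝓘(ℝ, EP) P 1 ℂ} {θN : DForm 𝓘(ℝ, EQ) Q 1 ℂ}
  {ε : G →* G} {hε : ContMDiff 𝓘(ℝ, EG) 𝓘(ℝ, EG) ∞ ε}

variable (S T θM θN) in
/-- The connection of the product bundle. -/
def prodForm : DForm 𝓘(ℝ, (E × E') × spincLie (m + n)) (ProdBundle S T) 1 ℂ := fun r =>
  (totalForm θM θN (m + n)).pullback 𝓘(ℝ, (E × E') × spincLie (m + n))
    (prodSec (exists_mem_prodTriv_source r).choose.1 (exists_mem_prodTriv_source r).choose.2) r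

theorem mdifferentiableAt_prodMk (z : P × Q × Spinc (m + n)) :
    MDifferentiableAt (𝓘(ℝ, EP).prod (𝓘(ℝ, EQ).prod 𝓘(ℝ, spincLie (m + n))))
      𝓘(ℝ, (E × E') × spincLie (m + n)) (prodMk S T) z :=
  contMDiff_prodMk.mdifferentiable (by simp) z

theorem mdifferentiableAt_prodSec {a : S.Gauge} {b : T.Gauge} {r : ProdBundle S T}
    (hr : r ∈ (prodTriv a b).source) :
    MDifferentiableAt 𝓘(ℝ, (E × E') × spincLie (m + n))
      (𝓘(ℝ, EP).prod (𝓘(ℝ, EQ).prod 𝓘(ℝ, spincLie (m + n)))) (prodSec a b) r :=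
  ((contMDiffOn_prodSec a b).contMDiffAt ((prodTriv a b).open_source.mem_nhds hr)).mdifferentiableAt
    (by simp)

theorem DForm.pullback_id {F K X V : Type*} [NormedAddCommGroup F] [NormedSpace ℝ F]
    [TopologicalSpace K] {L : ModelWithCorners ℝ F K} [TopologicalSpace X] [ChartedSpace K X]
    [NormedAddCommGroup V] [NormedSpace ℝ V] {n : ℕ} (α : DForm L X n V) (x : X) :
    α.pullback L id x = α x :=
  α.compContinuousLinearMap_congr (F := F) rfl (mfderiv_id (I := L) (x := x))

/-- Applying the quotient map and then a section moves `z` within its orbit, by a group element that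
depends smoothly on `z`. Invariance under variable group elements therefore applies. -/
theorem totalForm_pullback_prodSec (hM : IsSpincPrequantization S ηM θM)
    (hN : IsSpincPrequantization T ηN θN) {a : S.Gauge} {b : T.Gauge} {z : P × Q × Spinc (m + n)}
    (hz : z ∈ gaugeDom a b) :
    (totalForm θM θN (m + n)).pullback (𝓘(ℝ, EP).prod (𝓘(ℝ, EQ).prod 𝓘(ℝ, spincLie (m + n))))
      (prodSec a b ∘ prodMk S T) z = totalForm θM θN (m + n) z := by
  have hF : MDifferentiableAt (𝓘(ℝ, EP).prod (𝓘(ℝ, EQ).prod 𝓘(ℝ, spincLie (m + n))))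
      (𝓘(ℝ, EP).prod (𝓘(ℝ, EQ).prod 𝓘(ℝ, spincLie (m + n)))) (prodSec a b ∘ prodMk S T) z :=
    (mdifferentiableAt_prodSec hz).comp z (mdifferentiableAt_prodMk z)
  have ha : MDifferentiableAt (𝓘(ℝ, EP).prod (𝓘(ℝ, EQ).prod 𝓘(ℝ, spincLie (m + n))))
      𝓘(ℝ, spincLie m) (fun z : P × Q × Spinc (m + n) => a.coord z.1) z :=
    ((a.contMDiffOn_coord.contMDiffAt ((a.isOpen_dom.preimage
      S.contMDiff_proj.continuous).mem_nhds hz.1)).mdifferentiableAt (by simp)).comp z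
        mdifferentiableAt_fst
  have hb : MDifferentiableAt (𝓘(ℝ, EP).prod (𝓘(ℝ, EQ).prod 𝓘(ℝ, spincLie (m + n))))
      𝓘(ℝ, spincLie n) (fun z : P × Q × Spinc (m + n) => b.coord z.2.1) z :=
    ((b.contMDiffOn_coord.contMDiffAt ((b.isOpen_dom.preimage
      T.contMDiff_proj.continuous).mem_nhds hz.2)).mdifferentiableAt (by simp)).comp z
        (mdifferentiableAt_fst.comp z mdifferentiableAt_snd)
  have h1 := totalForm_pullback_torsorAct hM hN hF ha hb
  have h2 := (totalForm θM θN (m + n)).pullback_congr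
    (I := 𝓘(ℝ, EP).prod (𝓘(ℝ, EQ).prod 𝓘(ℝ, spincLie (m + n)))) (x := z) (g := id)
    (f := fun z => torsorAct S T ((prodSec a b ∘ prodMk S T) z) (a.coord z.1) (b.coord z.2.1)) (by
      filter_upwards [(isOpen_gaugeDom a b).mem_nhds hz] with w hw
      exact torsorAct_prodSec hw)
  exact h1.symm.trans (h2.trans ((totalForm θM θN (m + n)).pullback_id z))

theorem DForm.pullback_congr_left {F K X F' K' Y V : Type*} [NormedAddCommGroup F]
    [NormedSpace ℝ F] [TopologicalSpace K] {L : ModelWithCorners ℝ F K} [TopologicalSpace X]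
    [ChartedSpace K X] [NormedAddCommGroup F'] [NormedSpace ℝ F'] [TopologicalSpace K']
    {L' : ModelWithCorners ℝ F' K'} [TopologicalSpace Y] [ChartedSpace K' Y]
    [NormedAddCommGroup V] [NormedSpace ℝ V] {n : ℕ} {α β : DForm L X n V} {f : Y → X} {y : Y}
    (h : α (f y) = β (f y)) : α.pullback L' f y = β.pullback L' f y :=
  congrArg (fun γ : F [⋀^Fin n]→L[ℝ] V => γ.compContinuousLinearMap
    (show F' →L[ℝ] F from mfderiv L' L f y)) h

theorem exists_prodForm_eq (r : ProdBundle S T) : ∃ (a : S.Gauge) (b : T.Gauge),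
    r ∈ (prodTriv a b).source ∧ prodForm S T θM θN r =
      (totalForm θM θN (m + n)).pullback 𝓘(ℝ, (E × E') × spincLie (m + n)) (prodSec a b) r :=
  ⟨_, _, (exists_mem_prodTriv_source r).choose_spec, rfl⟩

/-- The defining property of the connection of the product bundle. -/
theorem prodForm_pullback_prodMk (hM : IsSpincPrequantization S ηM θM)
    (hN : IsSpincPrequantization T ηN θN) (z : P × Q × Spinc (m + n)) :
    (prodForm S T θM θN).pullback (𝓘(ℝ, EP).prod (𝓘(ℝ, EQ).prod 𝓘(ℝ, spincLie (m + n))))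
      (prodMk S T) z = totalForm θM θN (m + n) z := by
  obtain ⟨a, b, hr, h1⟩ := exists_prodForm_eq (θM := θM) (θN := θN) (prodMk S T z)
  have h2 := totalForm_pullback_prodSec hM hN (a := a) (b := b) (z := z) hr
  generalize totalForm θM θN (m + n) = α at h1 h2 ⊢
  have h3 := α.pullback_pullback
    (I := 𝓘(ℝ, EP).prod (𝓘(ℝ, EQ).prod 𝓘(ℝ, spincLie (m + n))))
    (f := prodMk S T) (g := prodSec a b) (mdifferentiableAt_prodSec hr) (mdifferentiableAt_prodMk z)
  exact (DForm.pullback_congr_left h1).trans (h3.trans h2)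

/-- The form is defined with one chosen pair of gauges at each point. As `q ∘ s = id` for every
section `s`, the formula for `q^*` shows that any other pair gives the same form, which is what its
smoothness requires. -/
theorem prodForm_eq_pullback_prodSec (hM : IsSpincPrequantization S ηM θM)
    (hN : IsSpincPrequantization T ηN θN) {a : S.Gauge} {b : T.Gauge} {r : ProdBundle S T}
    (hr : r ∈ (prodTriv a b).source) :
    prodForm S T θM θN r = (totalForm θM θN (m + n)).pullback 𝓘(ℝ, (E × E') × spincLie (m + n))
      (prodSec a b) r := by
  have h1 := (prodForm S T θM θN).pullback_pullback
    (mdifferentiableAt_prodMk (prodSec a b r)) (mdifferentiableAt_prodSec hr)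
  have h2 := (prodForm S T θM θN).pullback_congr
    (I := 𝓘(ℝ, (E × E') × spincLie (m + n))) (x := r) (f := prodMk S T ∘ prodSec a b) (g := id) (by
      filter_upwards [(prodTriv a b).open_source.mem_nhds hr] with w hw
      exact prodMk_prodSec hw)
  have h3 : (prodForm S T θM θN).pullback
      (𝓘(ℝ, EP).prod (𝓘(ℝ, EQ).prod 𝓘(ℝ, spincLie (m + n)))) (prodMk S T) =
      totalForm θM θN (m + n) := funext (prodForm_pullback_prodMk hM hN)
  rw [h3] at h1
  exact (((prodForm S T θM θN).pullback_id r).symm.trans h2.symm).trans h1.symm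

theorem isSmooth_prodForm (hM : IsSpincPrequantization S ηM θM)
    (hN : IsSpincPrequantization T ηN θN) : (prodForm S T θM θN).IsSmooth :=
  DForm.isSmooth_of_locally_pullback fun r => by
    obtain ⟨⟨a, b⟩, hab⟩ := exists_mem_prodTriv_source r
    exact ⟨_, (prodTriv a b).open_source, hab, prodSec a b, totalForm θM θN (m + n),
      isSmooth_totalForm hM.smooth hN.smooth _, contMDiffOn_prodSec a b,
      fun r' hr' => prodForm_eq_pullback_prodSec hM hN hr'⟩

theorem prodForm_mfderiv_prodMk (hM : IsSpincPrequantization S ηM θM)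
    (hN : IsSpincPrequantization T ηN θN) (p : P) (q : Q) (h : Spinc (m + n))
    (u : TangentSpace 𝓘(ℝ, EP) p) (v : TangentSpace 𝓘(ℝ, EQ) q)
    (w : TangentSpace 𝓘(ℝ, spincLie (m + n)) h) :
    prodForm S T θM θN (prodMk S T (p, q, h))
      ![mfderiv (𝓘(ℝ, EP).prod (𝓘(ℝ, EQ).prod 𝓘(ℝ, spincLie (m + n))))
        𝓘(ℝ, (E × E') × spincLie (m + n)) (prodMk S T) (p, q, h) (u, v, w)] =
      θM p ![u] + θN q ![v] + 1 / 2 * detStar (maurerCartan h w) := by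
  have h1 := congrArg (fun α : (EP × EQ × spincLie (m + n)) [⋀^Fin 1]→L[ℝ] ℂ => α ![(u, v, w)])
    (prodForm_pullback_prodMk hM hN (p, q, h))
  refine Eq.trans ?_ (h1.trans (totalForm_apply p q h u v w))
  exact (oneForm_apply (E := (E × E') × spincLie (m + n))
    (prodForm S T θM θN (prodMk S T (p, q, h))) (fun i =>
      mfderiv (𝓘(ℝ, EP).prod (𝓘(ℝ, EQ).prod 𝓘(ℝ, spincLie (m + n))))
        𝓘(ℝ, (E × E') × spincLie (m + n)) (prodMk S T) (p, q, h)
          ((![(u, v, w)] : Fin 1 → EP × EQ × spincLie (m + n)) i))).symm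

/-- Two forms on the product bundle agree if their pullbacks agree. -/
theorem eq_of_pullback_prodMk {d : ℕ} {V : Type*} [NormedAddCommGroup V] [NormedSpace ℝ V]
    {α β : DForm 𝓘(ℝ, (E × E') × spincLie (m + n)) (ProdBundle S T) d V}
    (h : ∀ z, α.pullback (𝓘(ℝ, EP).prod (𝓘(ℝ, EQ).prod 𝓘(ℝ, spincLie (m + n)))) (prodMk S T) z =
      β.pullback (𝓘(ℝ, EP).prod (𝓘(ℝ, EQ).prod 𝓘(ℝ, spincLie (m + n)))) (prodMk S T) z) :
    α = β := by
  funext r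
  obtain ⟨z, rfl⟩ : ∃ z, prodMk S T z = r := Quot.exists_rep r
  refine ContinuousAlternatingMap.ext fun v => ?_
  choose w hw using fun i => surjective_mfderiv_prodMk (S := S) (T := T) z (v i)
  have h1 := congrArg (fun γ : (EP × EQ × spincLie (m + n)) [⋀^Fin d]→L[ℝ] V => γ w) (h z)
  have h2 : v = fun i => mfderiv (𝓘(ℝ, EP).prod (𝓘(ℝ, EQ).prod 𝓘(ℝ, spincLie (m + n))))
      𝓘(ℝ, (E × E') × spincLie (m + n)) (prodMk S T) z (w i) := funext fun i => (hw i).symm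
  rw [h2]
  exact h1

/-- Invariance of the connection under a map that is covered by one that preserves the form on
`P_M × P_N × Spin^c(m+n)`. -/
theorem prodForm_pullback_of_lift (hM : IsSpincPrequantization S ηM θM)
    (hN : IsSpincPrequantization T ηN θN) {f : ProdBundle S T → ProdBundle S T}
    {F : P × Q × Spinc (m + n) → P × Q × Spinc (m + n)}
    (hf : ContMDiff 𝓘(ℝ, (E × E') × spincLie (m + n)) 𝓘(ℝ, (E × E') × spincLie (m + n)) ∞ f)
    (hF : ∀ z, MDifferentiableAt (𝓘(ℝ, EP).prod (𝓘(ℝ, EQ).prod 𝓘(ℝ, spincLie (m + n))))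
      (𝓘(ℝ, EP).prod (𝓘(ℝ, EQ).prod 𝓘(ℝ, spincLie (m + n)))) F z)
    (hfF : ∀ z, f (prodMk S T z) = prodMk S T (F z))
    (h : ∀ z, (totalForm θM θN (m + n)).pullback
      (𝓘(ℝ, EP).prod (𝓘(ℝ, EQ).prod 𝓘(ℝ, spincLie (m + n)))) F z = totalForm θM θN (m + n) z) :
    (prodForm S T θM θN).pullback 𝓘(ℝ, (E × E') × spincLie (m + n)) f = prodForm S T θM θN := by
  refine eq_of_pullback_prodMk fun z => ?_
  have h1 := (prodForm S T θM θN).pullback_pullback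
    (hf.mdifferentiable (by simp) (prodMk S T z)) (mdifferentiableAt_prodMk z)
  have h2 := (prodForm S T θM θN).pullback_pullback (mdifferentiableAt_prodMk (F z)) (hF z)
  have h3 : (prodForm S T θM θN).pullback
      (𝓘(ℝ, EP).prod (𝓘(ℝ, EQ).prod 𝓘(ℝ, spincLie (m + n)))) (prodMk S T) =
      totalForm θM θN (m + n) := funext (prodForm_pullback_prodMk hM hN)
  have h4 : f ∘ prodMk S T = prodMk S T ∘ F := funext hfF
  rw [h3] at h2 ⊢
  rw [h4] at h1
  exact h1.trans (h2.symm.trans (h z))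

/-- The lift of `g` acts as `g` on `P_M`, as `ε g` on `P_N` and trivially on `Spin^c(m+n)`, so it
preserves each of the three terms upstairs. -/
theorem prodForm_act (hM : IsSpincPrequantization S ηM θM) (hN : IsSpincPrequantization T ηN θN)
    (g : G) : (prodForm S T θM θN).pullback 𝓘(ℝ, (E × E') × spincLie (m + n))
      ((prodSpinc S T ε hε).act g) = prodForm S T θM θN := by
  have h1 : ContMDiff (𝓘(ℝ, EP).prod (𝓘(ℝ, EQ).prod 𝓘(ℝ, spincLie (m + n)))) 𝓘(ℝ, EP) ∞
      (fun z : P × Q × Spinc (m + n) => S.act g z.1) :=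
    (S.contMDiff_act_apply g).comp contMDiff_fst
  have h2 : ContMDiff (𝓘(ℝ, EP).prod (𝓘(ℝ, EQ).prod 𝓘(ℝ, spincLie (m + n)))) 𝓘(ℝ, EQ) ∞
      (fun z : P × Q × Spinc (m + n) => T.act (ε g) z.2.1) :=
    (T.contMDiff_act_apply (ε g)).comp (contMDiff_fst.comp contMDiff_snd)
  have h3 : ContMDiff (𝓘(ℝ, EP).prod (𝓘(ℝ, EQ).prod 𝓘(ℝ, spincLie (m + n))))
      𝓘(ℝ, spincLie (m + n)) ∞ (fun z : P × Q × Spinc (m + n) => z.2.2) :=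
    contMDiff_snd.comp contMDiff_snd
  refine prodForm_pullback_of_lift hM hN
    (F := fun z => (S.act g z.1, T.act (ε g) z.2.1, z.2.2))
    ((prodSpinc S T ε hε).contMDiff_act_apply g)
    (fun z => (h1.prodMk (h2.prodMk h3)).mdifferentiable (by simp) z) (fun z => rfl) fun z => ?_
  have hq : MDifferentiableAt (𝓘(ℝ, EP).prod (𝓘(ℝ, EQ).prod 𝓘(ℝ, spincLie (m + n)))) 𝓘(ℝ, EQ)
      (fun z : P × Q × Spinc (m + n) => z.2.1) z :=
    mdifferentiableAt_fst.comp z mdifferentiableAt_snd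
  have e1 := hM.pullback_act g (f := fun z : P × Q × Spinc (m + n) => z.1)
    (mdifferentiableAt_fst (I := 𝓘(ℝ, EP)) (I' := 𝓘(ℝ, EQ).prod 𝓘(ℝ, spincLie (m + n))) (x := z))
  have e2 := hN.pullback_act (ε g) hq
  rw [totalForm_pullback (h1.mdifferentiable (by simp) z) (h2.mdifferentiable (by simp) z)
    (h3.mdifferentiable (by simp) z), e1, e2]
  rfl

/-- The lift multiplies the third component by a constant, and the logarithmic derivative of a
constant is zero. -/
theorem prodForm_ract (hM : IsSpincPrequantization S ηM θM) (hN : IsSpincPrequantization T ηN θN)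
    (x : Spinc (m + n)) : (prodForm S T θM θN).pullback 𝓘(ℝ, (E × E') × spincLie (m + n))
      (fun r => prodRact S T r x) = prodForm S T θM θN := by
  have h1 : ContMDiff (𝓘(ℝ, EP).prod (𝓘(ℝ, EQ).prod 𝓘(ℝ, spincLie (m + n)))) 𝓘(ℝ, EP) ∞
      (fun z : P × Q × Spinc (m + n) => z.1) := contMDiff_fst
  have h2 : ContMDiff (𝓘(ℝ, EP).prod (𝓘(ℝ, EQ).prod 𝓘(ℝ, spincLie (m + n)))) 𝓘(ℝ, EQ) ∞
      (fun z : P × Q × Spinc (m + n) => z.2.1) := contMDiff_fst.comp contMDiff_snd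
  have h0 : ContMDiff (𝓘(ℝ, EP).prod (𝓘(ℝ, EQ).prod 𝓘(ℝ, spincLie (m + n))))
      𝓘(ℝ, spincLie (m + n)) ∞ (fun z : P × Q × Spinc (m + n) => z.2.2) :=
    contMDiff_snd.comp contMDiff_snd
  have h3 : ContMDiff (𝓘(ℝ, EP).prod (𝓘(ℝ, EQ).prod 𝓘(ℝ, spincLie (m + n))))
      𝓘(ℝ, spincLie (m + n)) ∞ (fun z : P × Q × Spinc (m + n) => z.2.2 * x) :=
    h0.mul (contMDiff_const (c := x))
  have hf : ContMDiff 𝓘(ℝ, (E × E') × spincLie (m + n)) 𝓘(ℝ, (E × E') × spincLie (m + n)) ∞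
      (fun r => prodRact S T r x) :=
    contMDiff_of_comp_prodMk (contMDiff_prodMk.comp (h1.prodMk (h2.prodMk h3)))
  refine prodForm_pullback_of_lift hM hN (F := fun z => (z.1, z.2.1, z.2.2 * x)) hf
    (fun z => (h1.prodMk (h2.prodMk h3)).mdifferentiable (by simp) z) (fun z => rfl) fun z => ?_
  have e1 := totalForm_pullback (θM := θM) (θN := θN) (h1.mdifferentiable (by simp) z)
    (h2.mdifferentiable (by simp) z) (h3.mdifferentiable (by simp) z)
  have e2 := detForm_pullback_mul (h0.mdifferentiable (by simp) z)
    (mdifferentiableAt_const (c := x))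
  rw [detForm_pullback_const, add_zero] at e2
  refine e1.trans ?_
  rw [e2]
  rfl

/-- The orbit map of `[p, q, h]` lifts to `x ↦ (p, q, h x)`. Along it the first two terms vanish,
and the third is unaffected by the left factor `h`; at `x = 1` what remains is `½ det_*`. -/
theorem prodForm_fundVec (hM : IsSpincPrequantization S ηM θM)
    (hN : IsSpincPrequantization T ηN θN) (r : ProdBundle S T) (ξ : LieSpinc (m + n)) :
    prodForm S T θM θN r ![(prodSpinc S T ε hε).fundVec r ξ] = 1 / 2 * detStar ξ := by
  obtain ⟨z, rfl⟩ : ∃ z, prodMk S T z = r := Quot.exists_rep r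
  have h1 : MDifferentiableAt 𝓘(ℝ, spincLie (m + n)) 𝓘(ℝ, EP)
      (fun _ : Spinc (m + n) => z.1) 1 := mdifferentiableAt_const
  have h2 : MDifferentiableAt 𝓘(ℝ, spincLie (m + n)) 𝓘(ℝ, EQ)
      (fun _ : Spinc (m + n) => z.2.1) 1 := mdifferentiableAt_const
  have h3 : MDifferentiableAt 𝓘(ℝ, spincLie (m + n)) 𝓘(ℝ, spincLie (m + n))
      (fun x : Spinc (m + n) => z.2.2 * x) 1 :=
    (contMDiff_mul_left (a := z.2.2) (n := ∞)).mdifferentiable (by simp) 1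
  have h4 : MDifferentiableAt 𝓘(ℝ, spincLie (m + n))
      (𝓘(ℝ, EP).prod (𝓘(ℝ, EQ).prod 𝓘(ℝ, spincLie (m + n))))
      (fun x : Spinc (m + n) => (z.1, z.2.1, z.2.2 * x)) 1 := h1.prodMk (h2.prodMk h3)
  have h5 := (prodForm S T θM θN).pullback_pullback
    (f := fun x : Spinc (m + n) => (z.1, z.2.1, z.2.2 * x))
    (mdifferentiableAt_prodMk (z.1, z.2.1, z.2.2 * 1)) h4
  have h6 : (prodForm S T θM θN).pullback
      (𝓘(ℝ, EP).prod (𝓘(ℝ, EQ).prod 𝓘(ℝ, spincLie (m + n)))) (prodMk S T) =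
      totalForm θM θN (m + n) := funext (prodForm_pullback_prodMk hM hN)
  have hc1 : θM.pullback 𝓘(ℝ, spincLie (m + n)) (fun _ : Spinc (m + n) => z.1) 1 = 0 := by
    refine ContinuousAlternatingMap.ext fun v => (θM z.1).map_coord_zero 0 ?_
    exact congrArg (fun L : spincLie (m + n) →L[ℝ] EP => L (v 0)) mfderiv_const
  have hc2 : θN.pullback 𝓘(ℝ, spincLie (m + n)) (fun _ : Spinc (m + n) => z.2.1) 1 = 0 := by
    refine ContinuousAlternatingMap.ext fun v => (θN z.2.1).map_coord_zero 0 ?_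
    exact congrArg (fun L : spincLie (m + n) →L[ℝ] EQ => L (v 0)) mfderiv_const
  have hc3 := detForm_pullback_mul (k := m + n)
    (mdifferentiableAt_const (I := 𝓘(ℝ, spincLie (m + n))) (x := (1 : Spinc (m + n))) (c := z.2.2))
    (mdifferentiableAt_id (I := 𝓘(ℝ, spincLie (m + n))))
  rw [detForm_pullback_const, zero_add] at hc3
  have hc4 : (detForm (m + n)).pullback 𝓘(ℝ, spincLie (m + n))
      (fun x : Spinc (m + n) => z.2.2 * x) 1 = detForm (m + n) 1 :=
    hc3.trans ((detForm (m + n)).pullback_id 1)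
  have h7 := totalForm_pullback (θM := θM) (θN := θN) h1 h2 h3
  rw [hc1, hc2, hc4, zero_add, zero_add] at h7
  rw [h6] at h5
  have h8 := congrArg (fun α : spincLie (m + n) [⋀^Fin 1]→L[ℝ] ℂ => α ![ξ]) (h5.symm.trans h7)
  have h9 : ((1 / 2 : ℝ) • detForm (m + n) 1) ![ξ] = 1 / 2 * detStar ξ := by
    change (1 / 2 : ℝ) • (detForm (m + n) 1 ![ξ]) = _
    rw [detForm_apply, maurerCartan_one, Complex.real_smul]
    push_cast
    rfl
  have h10 : (prodForm S T θM θN).pullback 𝓘(ℝ, spincLie (m + n))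
      (prodMk S T ∘ fun x : Spinc (m + n) => (z.1, z.2.1, z.2.2 * x)) 1 ![ξ] =
      1 / 2 * detStar ξ := h8.trans h9
  -- At `x = 1` the lifted orbit map sits over `h · 1`, which must be identified with `h` before the
  -- forms can be compared.
  have h11 := congrArg (fun h : Spinc (m + n) => prodMk S T (z.1, z.2.1, h)) (mul_one z.2.2)
  have h12 := (oneForm_apply (E := (E × E') × spincLie (m + n))
    (prodForm S T θM θN (prodMk S T (z.1, z.2.1, z.2.2 * 1)))
      (fun i => mfderiv 𝓘(ℝ, spincLie (m + n)) 𝓘(ℝ, (E × E') × spincLie (m + n))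
        (prodMk S T ∘ fun x : Spinc (m + n) => (z.1, z.2.1, z.2.2 * x)) 1
          ((![ξ] : Fin 1 → spincLie (m + n)) i))).symm
  refine Eq.trans ?_ (h12.trans h10)
  exact congrArg (fun r => (show ((E × E') × spincLie (m + n)) [⋀^Fin 1]→L[ℝ] ℂ from
    prodForm S T θM θN r) ![(prodSpinc S T ε hε).fundVec (prodMk S T z) ξ]) h11.symm

end ProductConnection

end

noncomputable section

/-! ### The prequantization conditions on the product -/

section ProductConnection

variable {EG : Type*} [NormedAddCommGroup EG] [NormedSpace ℝ EG]
  {G : Type*} [Group G] [TopologicalSpace G] [ChartedSpace EG G]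
  {E H M : Type*} [NormedAddCommGroup E] [NormedSpace ℝ E] [TopologicalSpace H]
  {I : ModelWithCorners ℝ E H} [TopologicalSpace M] [ChartedSpace H M] [IsManifold I ∞ M]
  {E' H' N : Type*} [NormedAddCommGroup E'] [NormedSpace ℝ E'] [TopologicalSpace H']
  {J : ModelWithCorners ℝ E' H'} [TopologicalSpace N] [ChartedSpace H' N] [IsManifold J ∞ N]
  {EP P : Type*} [NormedAddCommGroup EP] [NormedSpace ℝ EP]
  [TopologicalSpace P] [ChartedSpace EP P]
  {EQ Q : Type*} [NormedAddCommGroup EQ] [NormedSpace ℝ EQ]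
  [TopologicalSpace Q] [ChartedSpace EQ Q]
  {m n : ℕ}
  {BM : OrientedRiemannianAction I M EG G m} {BN : OrientedRiemannianAction J N EG G n}
  {S : EquivariantSpincStructure BM EP P} {T : EquivariantSpincStructure BN EQ Q}
  [I.Boundaryless] [J.Boundaryless] [IsManifold 𝓘(ℝ, EP) ∞ P] [IsManifold 𝓘(ℝ, EQ) ∞ Q]
  {ηM : DForm I M 2 ℝ} {ηN : DForm J N 2 ℝ}
  {θM : DForm 𝓘(ℝ, EP) P 1 ℂ} {θN : DForm 𝓘(ℝ, EQ) Q 1 ℂ}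
  {ε : G →* G} {hε : ContMDiff 𝓘(ℝ, EG) 𝓘(ℝ, EG) ∞ ε}

theorem sumForm_prod_act (hM : IsSpincPrequantization S ηM θM)
    (hN : IsSpincPrequantization T ηN θN) (g : G) (z : M × N)
    (v : Fin 2 → TangentSpace (I.prod J) z) :
    sumForm ηM ηN ((BM.prod BN ε hε).act g z)
      (fun i => mfderiv (I.prod J) (I.prod J) ((BM.prod BN ε hε).act g) z (v i)) =
      sumForm ηM ηN z v := by
  have h := fun i => mfderiv_prodMap_apply (z := z)
    ((BM.contMDiff_act_apply g).mdifferentiableAt (by simp))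
    ((BN.contMDiff_act_apply (ε g)).mdifferentiableAt (by simp)) (v i)
  exact (congrArg (fun w : Fin 2 → E × E' => sumForm ηM ηN (BM.act g z.1, BN.act (ε g) z.2) w)
    (funext h)).trans (congrArg₂ (· + ·) (hM.form_invariant g z.1 fun i => (v i).1)
      (hN.form_invariant (ε g) z.2 fun i => (v i).2))

/-- Every tangent vector of the quotient lifts, and on the lift each of the three terms is
imaginary. -/
theorem prodForm_imaginary (hM : IsSpincPrequantization S ηM θM)
    (hN : IsSpincPrequantization T ηN θN) (r : ProdBundle S T)
    (v : Fin 1 → TangentSpace 𝓘(ℝ, (E × E') × spincLie (m + n)) r) :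
    (prodForm S T θM θN r v).re = 0 := by
  obtain ⟨z, rfl⟩ : ∃ z, prodMk S T z = r := Quot.exists_rep r
  obtain ⟨w, hw⟩ := surjective_mfderiv_prodMk (S := S) (T := T) z (v 0)
  have h1 : prodForm S T θM θN (prodMk S T z) v = prodForm S T θM θN (prodMk S T z) ![v 0] :=
    oneForm_apply (E := (E × E') × spincLie (m + n)) (prodForm S T θM θN (prodMk S T z)) v
  have h2 := prodForm_mfderiv_prodMk hM hN z.1 z.2.1 z.2.2 w.1 w.2.1 w.2.2
  have h3 : prodForm S T θM θN (prodMk S T z) ![v 0] = _ :=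
    (congrArg (fun u : (E × E') × spincLie (m + n) =>
      prodForm S T θM θN (prodMk S T z) ![u]) hw.symm).trans h2
  have h4 : (1 / 2 * detStar (maurerCartan z.2.2 w.2.2)).re = 0 := by
    have h5 := detStar_re (maurerCartan z.2.2 w.2.2)
    rw [Complex.mul_re, h5]
    simp
  rw [h1, h3, Complex.add_re, Complex.add_re, hM.imaginary, hN.imaginary, h4]
  simp

theorem prodForm_extD_mfderiv_prodMk (hM : IsSpincPrequantization S ηM θM)
    (hN : IsSpincPrequantization T ηN θN) (z : P × Q × Spinc (m + n)) :
    (prodForm S T θM θN).extD.pullback (𝓘(ℝ, EP).prod (𝓘(ℝ, EQ).prod 𝓘(ℝ, spincLie (m + n))))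
      (prodMk S T) z =
      θM.extD.pullback (𝓘(ℝ, EP).prod (𝓘(ℝ, EQ).prod 𝓘(ℝ, spincLie (m + n)))) (fun z => z.1) z +
      θN.extD.pullback (𝓘(ℝ, EP).prod (𝓘(ℝ, EQ).prod 𝓘(ℝ, spincLie (m + n))))
        (fun z => z.2.1) z := by
  have h1 := (isSmooth_prodForm hM hN).extD_pullback (contMDiff_prodMk (S := S) (T := T)) z
  have h2 : (prodForm S T θM θN).pullback
      (𝓘(ℝ, EP).prod (𝓘(ℝ, EQ).prod 𝓘(ℝ, spincLie (m + n)))) (prodMk S T) =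
      totalForm θM θN (m + n) := funext (prodForm_pullback_prodMk hM hN)
  rw [h2] at h1
  exact h1.symm.trans (extD_totalForm hM.smooth hN.smooth z)

/-- Both vectors are lifted through the submersion `q`. Upstairs the left-hand side is `dθ_M +
dθ_N`, where the two curvature conditions apply, and the projection of the quotient composed with
`q` is the pair of projections of `P_M` and `P_N`. -/
theorem prodForm_curvature (hM : IsSpincPrequantization S ηM θM)
    (hN : IsSpincPrequantization T ηN θN) (r : ProdBundle S T)
    (v : Fin 2 → TangentSpace 𝓘(ℝ, (E × E') × spincLie (m + n)) r) :
    (prodForm S T θM θN).extD r v = -Complex.I * (sumForm ηM ηN ((prodSpinc S T ε hε).proj r)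
      (fun i => mfderiv 𝓘(ℝ, (E × E') × spincLie (m + n)) (I.prod J)
        (prodSpinc S T ε hε).proj r (v i)) : ℝ) := by
  obtain ⟨z, rfl⟩ : ∃ z, prodMk S T z = r := Quot.exists_rep r
  choose w hw using fun i => surjective_mfderiv_prodMk (S := S) (T := T) z (v i)
  have hv : v = fun i => mfderiv (𝓘(ℝ, EP).prod (𝓘(ℝ, EQ).prod 𝓘(ℝ, spincLie (m + n))))
      𝓘(ℝ, (E × E') × spincLie (m + n)) (prodMk S T) z (w i) := funext fun i => (hw i).symm
  have hp : MDifferentiableAt (𝓘(ℝ, EP).prod (𝓘(ℝ, EQ).prod 𝓘(ℝ, spincLie (m + n)))) 𝓘(ℝ, EP)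
      (fun z : P × Q × Spinc (m + n) => z.1) z := mdifferentiableAt_fst
  have hq : MDifferentiableAt (𝓘(ℝ, EP).prod (𝓘(ℝ, EQ).prod 𝓘(ℝ, spincLie (m + n)))) 𝓘(ℝ, EQ)
      (fun z : P × Q × Spinc (m + n) => z.2.1) z :=
    mdifferentiableAt_fst.comp z mdifferentiableAt_snd
  have hS := S.contMDiff_proj.mdifferentiable (by simp) z.1
  have hT := T.contMDiff_proj.mdifferentiable (by simp) z.2.1
  have hR := (prodSpinc S T ε hε).contMDiff_proj.mdifferentiable (by simp) (prodMk S T z)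
  have h1 := congrArg (fun α : (EP × EQ × spincLie (m + n)) [⋀^Fin 2]→L[ℝ] ℂ => α w)
    (prodForm_extD_mfderiv_prodMk hM hN z)
  have h2 := hM.curvature z.1 fun i => mfderiv (𝓘(ℝ, EP).prod (𝓘(ℝ, EQ).prod
    𝓘(ℝ, spincLie (m + n)))) 𝓘(ℝ, EP) (fun z : P × Q × Spinc (m + n) => z.1) z (w i)
  have h3 := hN.curvature z.2.1 fun i => mfderiv (𝓘(ℝ, EP).prod (𝓘(ℝ, EQ).prod
    𝓘(ℝ, spincLie (m + n)))) 𝓘(ℝ, EQ) (fun z : P × Q × Spinc (m + n) => z.2.1) z (w i)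
  have h4 := sumForm_pullback_apply (η := ηM) (η' := ηN)
    (f := S.proj ∘ fun z : P × Q × Spinc (m + n) => z.1)
    (g := T.proj ∘ fun z : P × Q × Spinc (m + n) => z.2.1) (hS.comp z hp) (hT.comp z hq) w
  have h5 := mfderiv_comp z hS hp
  have h6 := mfderiv_comp z hT hq
  have h7 := mfderiv_comp z hR (mdifferentiableAt_prodMk z)
  have e1 := congrArg (fun L : EP × EQ × spincLie (m + n) →L[ℝ] E =>
    ηM (S.proj z.1) fun i => L (w i)) h5
  have e2 := congrArg (fun L : EP × EQ × spincLie (m + n) →L[ℝ] E' =>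
    ηN (T.proj z.2.1) fun i => L (w i)) h6
  have e3 := congrArg (fun L : EP × EQ × spincLie (m + n) →L[ℝ] E × E' =>
    sumForm ηM ηN (S.proj z.1, T.proj z.2.1) fun i => L (w i)) h7
  have e4 := e3.symm.trans (h4.trans (congrArg₂ (· + ·) e1 e2))
  rw [hv]
  refine h1.trans ((congrArg₂ (· + ·) h2 h3).trans ?_)
  refine Eq.trans ?_ (congrArg (fun x : ℝ => -Complex.I * (x : ℂ)) e4.symm)
  rw [Complex.ofReal_add, mul_add]
  rfl

/-- The product of two spin^c prequantizations is a spin^c prequantization. -/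
theorem isSpincPrequantization_prodSpinc (hM : IsSpincPrequantization S ηM θM)
    (hN : IsSpincPrequantization T ηN θN) :
    IsSpincPrequantization (prodSpinc S T ε hε) (sumForm ηM ηN) (prodForm S T θM θN) where
  form_smooth := isSmooth_sumForm hM.form_smooth hN.form_smooth
  form_closed := extD_sumForm hM.form_smooth hN.form_smooth hM.form_closed hN.form_closed
  form_invariant := sumForm_prod_act hM hN
  smooth := isSmooth_prodForm hM hN
  imaginary := prodForm_imaginary hM hN
  act_invariant g r v := by
    have h := congrArg (fun α : ((E × E') × spincLie (m + n)) [⋀^Fin 1]→L[ℝ] ℂ => α ![v])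
      (congrFun (prodForm_act (hε := hε) hM hN g) r)
    exact (oneForm_apply (E := (E × E') × spincLie (m + n))
      (prodForm S T θM θN ((prodSpinc S T ε hε).act g r)) (fun i =>
        mfderiv 𝓘(ℝ, (E × E') × spincLie (m + n)) 𝓘(ℝ, (E × E') × spincLie (m + n))
          ((prodSpinc S T ε hε).act g) r
            ((![v] : Fin 1 → (E × E') × spincLie (m + n)) i))).symm.trans h
  ract_invariant x r v := by
    have h := congrArg (fun α : ((E × E') × spincLie (m + n)) [⋀^Fin 1]→L[ℝ] ℂ => α ![v])
      (congrFun (prodForm_ract hM hN x) r)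
    exact (oneForm_apply (E := (E × E') × spincLie (m + n))
      (prodForm S T θM θN (prodRact S T r x)) (fun i =>
        mfderiv 𝓘(ℝ, (E × E') × spincLie (m + n)) 𝓘(ℝ, (E × E') × spincLie (m + n))
          (fun r => prodRact S T r x) r
            ((![v] : Fin 1 → (E × E') × spincLie (m + n)) i))).symm.trans h
  vertical r s := by
    rw [prodForm_fundVec hM hN, detStar_u1Vec]
    ring
  spin_vertical r ζ hζ := by
    rw [prodForm_fundVec hM hN, detStar_of_mem_spinLie hζ, mul_zero]
  curvature := prodForm_curvature hM hN

end ProductConnection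

end

end SpinC

/-! ### The claim -/

theorem claim3p1 {m n : ℕ}
    {EG G : Type*} [NormedAddCommGroup EG] [NormedSpace ℝ EG] [FiniteDimensional ℝ EG]
    [Group G] [TopologicalSpace G] [ChartedSpace EG G] [LieGroup 𝓘(ℝ, EG) ∞ G]
    {M : Type*} [TopologicalSpace M] [T2Space M] [SecondCountableTopology M]
    [ChartedSpace (Vec m) M] [IsManifold (𝓡 m) ∞ M]
    {N : Type*} [TopologicalSpace N] [T2Space N] [SecondCountableTopology N]
    [ChartedSpace (Vec n) N] [IsManifold (𝓡 n) ∞ N]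
    {EPM PM : Type*} [NormedAddCommGroup EPM] [NormedSpace ℝ EPM] [FiniteDimensional ℝ EPM]
    [TopologicalSpace PM] [T2Space PM] [SecondCountableTopology PM]
    [ChartedSpace EPM PM] [IsManifold 𝓘(ℝ, EPM) ∞ PM]
    {EPN PN : Type*} [NormedAddCommGroup EPN] [NormedSpace ℝ EPN] [FiniteDimensional ℝ EPN]
    [TopologicalSpace PN] [T2Space PN] [SecondCountableTopology PN]
    [ChartedSpace EPN PN] [IsManifold 𝓘(ℝ, EPN) ∞ PN]
    (BM : OrientedRiemannianAction (𝓡 m) M EG G m)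
    (BN : OrientedRiemannianAction (𝓡 n) N EG G n)
    (SM : EquivariantSpincStructure BM EPM PM) (SN : EquivariantSpincStructure BN EPN PN)
    (ωM : DForm (𝓡 m) M 2 ℝ) (ωN : DForm (𝓡 n) N 2 ℝ)
    (θM : DForm 𝓘(ℝ, EPM) PM 1 ℂ) (θN : DForm 𝓘(ℝ, EPN) PN 1 ℂ)
    (hM : IsSpincPrequantization SM ωM θM) (hN : IsSpincPrequantization SN ωN θN) :
    T2Space (ProdBundle SM SN) ∧ SecondCountableTopology (ProdBundle SM SN) ∧
    ∃ (_ : ChartedSpace ((Vec m × Vec n) × spincLie (m + n)) (ProdBundle SM SN))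
      (_ : IsManifold 𝓘(ℝ, (Vec m × Vec n) × spincLie (m + n)) ∞ (ProdBundle SM SN))
      (θ : DForm 𝓘(ℝ, (Vec m × Vec n) × spincLie (m + n)) (ProdBundle SM SN) 1 ℂ),
      -- the quotient map is a smooth submersion
      ContMDiff (𝓘(ℝ, EPM).prod (𝓘(ℝ, EPN).prod 𝓘(ℝ, spincLie (m + n))))
        𝓘(ℝ, (Vec m × Vec n) × spincLie (m + n)) ∞ (prodMk SM SN) ∧
      (∀ z, Function.Surjective
        (mfderiv (𝓘(ℝ, EPM).prod (𝓘(ℝ, EPN).prod 𝓘(ℝ, spincLie (m + n))))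
          𝓘(ℝ, (Vec m × Vec n) × spincLie (m + n)) (prodMk SM SN) z)) ∧
      -- the formula for the connection
      (∀ (p : PM) (q : PN) (h : Spinc (m + n)) (u : TangentSpace 𝓘(ℝ, EPM) p)
        (v : TangentSpace 𝓘(ℝ, EPN) q) (w : TangentSpace 𝓘(ℝ, spincLie (m + n)) h),
        θ (prodMk SM SN (p, q, h))
          ![mfderiv (𝓘(ℝ, EPM).prod (𝓘(ℝ, EPN).prod 𝓘(ℝ, spincLie (m + n))))
            𝓘(ℝ, (Vec m × Vec n) × spincLie (m + n)) (prodMk SM SN) (p, q, h) (u, v, w)] =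
          θM p ![u] + θN q ![v] + 1 / 2 * detStar (maurerCartan h w)) ∧
      -- the prequantization, for the diagonal action of `G` and for the action on the first factor
      ∀ ε : G →* G, (ε = MonoidHom.id G ∨ ε = 1) →
        ∃ B : OrientedRiemannianAction ((𝓡 m).prod (𝓡 n)) (M × N) EG G (m + n),
          IsProduct BM BN ε B ∧
          ∃ R : EquivariantSpincStructure B ((Vec m × Vec n) × spincLie (m + n))
            (ProdBundle SM SN),
            IsProductSpinc SM SN ε R ∧ IsSpincPrequantization R (sumForm ωM ωN) θ := by
  refine ⟨t2Space_prodBundle, secondCountableTopology_prodBundle, inferInstance, inferInstance,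
    prodForm SM SN θM θN, contMDiff_prodMk, surjective_mfderiv_prodMk,
    fun p q h u v w => prodForm_mfderiv_prodMk hM hN p q h u v w, fun ε hε => ?_⟩
  -- Smoothness of the homomorphism `ε` is all that the construction asks of it, and both cases
  -- satisfy it.
  have hε' : ContMDiff 𝓘(ℝ, EG) 𝓘(ℝ, EG) ∞ ε := by
    rcases hε with rfl | rfl
    · exact contMDiff_id
    · exact contMDiff_const
  exact ⟨BM.prod BN ε hε', isProduct_prod BM BN ε hε', prodSpinc SM SN ε hε',
    isProductSpinc_prodSpinc SM SN ε hε', isSpincPrequantization_prodSpinc hM hN⟩
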